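/- Let $k\ge 1$ and let $\alpha_1,\dots,\alpha_k,\beta_1,\dots,\beta_k>0$ satisfy $\alpha_1\cdots\alpha_k=\beta_1\cdots\beta_k$. Put $$\Phi(z)=\frac{1}{(1-z^{-1})^k}\prod_{m=1}^k\begin{pmatrix}1&\alpha_m z^{-1}\\ \alpha_m^{-1}&1\end{pmatrix}\begin{pmatrix}1&\beta_m z^{-1}\\ \beta_m^{-1}&1\end{pmatrix},\qquad p(z)=\big((z-1)^k\operatorname{Tr}\Phi(z)\big)^2-4(z-1)^{2k}.$$ Then $p$ is a real polynomial of degree $2k-1$ whose zeros are real, non-positive and of order at most two. Write $p=q^2p_0$ with $q$ monic and $p_0$ having only simple zeros $0=x_0>x_1>\dots>x_{2(k'-1)}$, where $\deg p_0=2k'-1$. Let $\mathcal R$ be the compact Riemann surface consisting of the curve $\{(z,w)\in\mathbb C^2: w^2=p_0(z)\}$ and one point $(\infty,\infty)$. Let $C^+=\bigcup_{\ell=0}^{k'-1}C^+_\ell$, where $C_0^+=\{(z,w)\in\mathcal R: z\in[0,\infty)\}\cup\{(\infty,\infty)\}$ and $C^+_\ell=\{(z,w)\in\mathcal R: z\in[x_{2\ell},x_{2\ell-1}]\}$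 for $1\le\ell\le k'-1$. Let $p_0^{1/2}$ be the analytic continuation of $t\mapsto p_0(t)^{1/2}$, $t>0$, to $\mathbb C\setminus\big((-\infty,x_{2(k'-1)}]\cup\bigcup_{\ell=0}^{k'-2}[x_{2\ell+1},x_{2\ell}]\big)$, and let $\mathcal R_{12}\subset\mathcal R$ be the interior of the closure, in $\mathcal R$, of $$\{(z,p_0(z)^{1/2}):\operatorname{Im}z>0\}\cup\{(z,-p_0(z)^{1/2}):\operatorname{Im}z<0\}.$$ For $(\chi,\eta)\in(-1,1)^2$ consider on $\mathcal R$ the multi-valued function $$F(z,w;\chi,\eta)=\frac k4(\eta+1)\log z-\frac k2\log(z-1)-\frac\chi2\log\rho(z,w),\qquad \rho(z,w)=\frac12\operatorname{Tr}\Phi(z)+\frac{q(z)w}{2(z-1)^k}.$$ A critical point of $F$ is a point of $\mathcal R$ at which the derivative of $F$ (of any local analytic branch, in a local coordinate) vanishes; the points with $z\in\{0,1,\infty\}$, where $F$ has logarithmic singularities, are not critical. Let $\mathcal G_R$ (the rough region) be the set of $(\chi,\eta)\in(-1,1)^2$ for which $F(\cdot\,;\chi,\eta)$ has a critical point in $\mathcal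 R\setminus C^+$. **Proposition.** For each $(\chi,\eta)\in\mathcal G_R$ there is a unique critical point $(z,w)$ of $F(\cdot\,;\chi,\eta)$ in $\mathcal R_{12}$. Moreover $\mathcal G_R$ is open in $\mathbb R^2$, $\mathcal R_{12}$ is open in $\mathcal R$ and does not contain $(\infty,\infty)$, and the map $L:\mathcal G_R\to\mathcal R_{12}$, $L(\chi,\eta)=(z,w)$, is a ($C^\infty$) diffeomorphism: it is a bijection, and both $L$ and $L^{-1}$ are smooth. -/

import Mathlib

open scoped ContDiff Topology

noncomputable section

namespace Aztec

/-! ### The symbol and its discriminant -/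

/-- The matrix `(1, a z⁻¹; a⁻¹, 1)`. -/
def symbolFactor (a : ℝ) (z : ℂ) : Matrix (Fin 2) (Fin 2) ℂ :=
  !![1, (a : ℂ) * z⁻¹; (a : ℂ)⁻¹, 1]

/-- The matrix-valued weight
`Φ(z) = (1 - z⁻¹)^(-k) ∏ₘ (1, αₘ z⁻¹; αₘ⁻¹, 1) (1, βₘ z⁻¹; βₘ⁻¹, 1)` (ordered product),
to be used for `z ∉ {0, 1}`. -/
def Phi {k : ℕ} (α β : Fin k → ℝ) (z : ℂ) : Matrix (Fin 2) (Fin 2) ℂ :=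
  ((1 - z⁻¹) ^ k)⁻¹ •
    (List.ofFn fun m : Fin k => symbolFactor (α m) z * symbolFactor (β m) z).prod

/-- The polynomial matrix `(z - 1)^k Φ(z)`; see `Phi_eq`. -/
def PhiPoly {k : ℕ} (α β : Fin k → ℝ) : Matrix (Fin 2) (Fin 2) (Polynomial ℝ) :=
  (List.ofFn fun m : Fin k =>
    (!![Polynomial.X + Polynomial.C (α m * (β m)⁻¹), Polynomial.C (α m + β m);
        Polynomial.C ((α m)⁻¹ + (β m)⁻¹) * Polynomial.X,
        Polynomial.X + Polynomial.C ((α m)⁻¹ * β m)] :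
      Matrix (Fin 2) (Fin 2) (Polynomial ℝ))).prod

/-- The discriminant `p(z) = ((z - 1)^k Tr Φ(z))² - 4 (z - 1)^(2k)`, as a polynomial;
see `eval_discPoly`. -/
def discPoly {k : ℕ} (α β : Fin k → ℝ) : Polynomial ℝ :=
  (PhiPoly α β).trace ^ 2 - 4 * (Polynomial.X - 1) ^ (2 * k)

theorem Phi_eq {k : ℕ} (α β : Fin k → ℝ) {z : ℂ} (h0 : z ≠ 0) (h1 : z ≠ 1) :
    (PhiPoly α β).map (Polynomial.aeval z) = (z - 1) ^ k • Phi α β z := by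
  have hz : (1 - z⁻¹) ≠ 0 := by
    intro h
    apply h1
    field_simp at h
    linear_combination h
  have key : z - 1 = z * (1 - z⁻¹) := by field_simp
  rw [Phi, smul_smul, key, mul_pow, mul_assoc, mul_inv_cancel₀ (pow_ne_zero _ hz), mul_one]
  clear key hz h1
  unfold PhiPoly
  induction k with
  | zero =>
    simp only [List.ofFn_zero, List.prod_nil, pow_zero, one_smul]
    exact (RingHom.mapMatrix (Polynomial.aeval z : Polynomial ℝ →ₐ[ℝ] ℂ).toRingHom).map_one
  | succ n ih =>
    rw [List.ofFn_succ, List.ofFn_succ, List.prod_cons, List.prod_cons, pow_succ', mul_smul,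
      Matrix.map_mul, ih (fun i => α i.succ) (fun i => β i.succ)]
    rw [Matrix.mul_smul, smul_comm (z) (z ^ n), ← Matrix.smul_mul z]
    refine congrArg (fun A => z ^ n • (A * _)) ?_
    ext i j
    fin_cases i <;> fin_cases j <;>
      simp [symbolFactor] <;> field_simp <;> ring

theorem eval_discPoly {k : ℕ} (α β : Fin k → ℝ) {z : ℂ} (h0 : z ≠ 0) (h1 : z ≠ 1) :
    Polynomial.aeval z (discPoly α β)
      = ((z - 1) ^ k * (Phi α β z).trace) ^ 2 - 4 * (z - 1) ^ (2 * k) := by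
  have h : Polynomial.aeval z (PhiPoly α β).trace = (z - 1) ^ k * (Phi α β z).trace := by
    rw [← smul_eq_mul, ← Matrix.trace_smul, ← Phi_eq α β h0 h1]
    simp [Matrix.trace, Fin.sum_univ_two]
  have h4 : Polynomial.aeval z (4 : Polynomial ℝ) = 4 := map_ofNat _ 4
  rw [discPoly, map_sub, map_pow, h, map_mul, h4, map_pow, map_sub, Polynomial.aeval_X, map_one]

/-! ### The factorization `p = q² p₀` -/

/-- `(p₀, q)` is the factorization `p = q² p₀` with `p₀` having only simple zeros and `q` having
leading coefficient one. For `p ≠ 0` there is exactly one such pair. -/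
def IsSquarefreeFactorization (p : Polynomial ℝ) (P : Polynomial ℝ × Polynomial ℝ) : Prop :=
  p = P.2 ^ 2 * P.1 ∧ Squarefree P.1 ∧ P.2.Monic

theorem exists_squarefreeFactorization (p : Polynomial ℝ) (hp : p ≠ 0) :
    ∃ P, IsSquarefreeFactorization p P := by
  induction h : p.natDegree using Nat.strong_induction_on generalizing p with
  | _ n ih =>
    by_cases hs : Squarefree p
    · exact ⟨(p, 1), by simp, hs, Polynomial.monic_one⟩
    · unfold Squarefree at hs
      push Not at hs
      obtain ⟨x, ⟨r, hr⟩, hx⟩ := hs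
      have hx0 : x ≠ 0 := by rintro rfl; simp at hr; exact hp hr
      have hr0 : r ≠ 0 := by rintro rfl; simp at hr; exact hp hr
      have hxd : 0 < x.natDegree := by
        by_contra hd
        apply hx
        rw [Polynomial.eq_C_of_natDegree_eq_zero (by omega : x.natDegree = 0)] at hx0 ⊢
        exact Polynomial.isUnit_C.mpr (isUnit_iff_ne_zero.mpr (by simpa using hx0))
      have hd : r.natDegree < n := by
        rw [← h, hr, Polynomial.natDegree_mul (mul_ne_zero hx0 hx0) hr0,
          Polynomial.natDegree_mul hx0 hx0]
        omega
      obtain ⟨P, h1, h2, h3⟩ := ih _ hd r hr0 rfl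
      have hl : x.leadingCoeff ≠ 0 := Polynomial.leadingCoeff_ne_zero.mpr hx0
      have hu : IsUnit (Polynomial.C (x.leadingCoeff ^ 2)) :=
        Polynomial.isUnit_C.mpr (isUnit_iff_ne_zero.mpr (pow_ne_zero _ hl))
      refine ⟨(Polynomial.C (x.leadingCoeff ^ 2) * P.1,
        (x * Polynomial.C (x.leadingCoeff)⁻¹) * P.2), ?_, ?_, ?_⟩
      · have : (Polynomial.C (x.leadingCoeff)⁻¹) ^ 2 * Polynomial.C (x.leadingCoeff ^ 2)
            = (1 : Polynomial ℝ) := by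
          rw [← Polynomial.C_pow, ← Polynomial.C_mul, inv_pow,
            inv_mul_cancel₀ (pow_ne_zero _ hl), Polynomial.C_1]
        rw [hr, h1]
        linear_combination (-(x * x * (P.2 ^ 2 * P.1))) * this
      · exact h2.squarefree_of_dvd (hu.mul_left_dvd.mpr dvd_rfl)
      · exact (Polynomial.monic_mul_leadingCoeff_inv hx0).mul h3

theorem discPoly_ne_zero {k : ℕ} (hk : 0 < k) (α β : Fin k → ℝ)
    (hα : ∀ m, 0 < α m) (hβ : ∀ m, 0 < β m) : discPoly α β ≠ 0 := by
  have key : ∀ (n : ℕ) (a b : Fin n → ℝ), (∀ m, 0 < a m) → (∀ m, 0 < b m) →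
      0 < ((PhiPoly a b) 0 0).eval 1 ∧ 0 ≤ ((PhiPoly a b) 0 1).eval 1 ∧
      0 ≤ ((PhiPoly a b) 1 0).eval 1 ∧ 0 < ((PhiPoly a b) 1 1).eval 1 := by
    intro n
    induction n with
    | zero => intro a b _ _; simp [PhiPoly]
    | succ n ih =>
      intro a b ha hb
      obtain ⟨i1, i2, i3, i4⟩ := ih (fun i => a i.succ) (fun i => b i.succ)
        (fun i => ha i.succ) (fun i => hb i.succ)
      have ha0 := ha 0
      have hb0 := hb 0
      rw [show PhiPoly a b = _ * PhiPoly (fun i : Fin n => a i.succ) (fun i => b i.succ) by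
        rw [PhiPoly, List.ofFn_succ, List.prod_cons]; rfl]
      generalize PhiPoly (fun i : Fin n => a i.succ) (fun i => b i.succ) = M at i1 i2 i3 i4 ⊢
      simp only [Matrix.mul_apply, Fin.sum_univ_two, Polynomial.eval_add, Polynomial.eval_mul]
      refine ⟨?_, ?_, ?_, ?_⟩ <;> simp <;> positivity
  obtain ⟨h1, -, -, h4⟩ := key k α β hα hβ
  intro h
  have he : (discPoly α β).eval 1 = 0 := by rw [h, Polynomial.eval_zero]
  have h2k : 2 * k ≠ 0 := by omega
  simp [discPoly, Matrix.trace, Fin.sum_univ_two, hk.ne'] at he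
  linarith

/-- The pair `(p₀, q)`. -/
def factorPair {k : ℕ} (α β : Fin k → ℝ) : Polynomial ℝ × Polynomial ℝ :=
  Classical.epsilon (IsSquarefreeFactorization (discPoly α β))

/-- The polynomial `p₀`. -/
def p0 {k : ℕ} (α β : Fin k → ℝ) : Polynomial ℝ := (factorPair α β).1

/-- The polynomial `q`. -/
def q {k : ℕ} (α β : Fin k → ℝ) : Polynomial ℝ := (factorPair α β).2

theorem factorPair_spec {k : ℕ} (hk : 0 < k) (α β : Fin k → ℝ)
    (hα : ∀ m, 0 < α m) (hβ : ∀ m, 0 < β m) :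
    discPoly α β = q α β ^ 2 * p0 α β ∧ Squarefree (p0 α β) ∧ (q α β).Monic :=
  Classical.epsilon_spec (exists_squarefreeFactorization _ (discPoly_ne_zero hk α β hα hβ))

/-- The zeros `0 = x₀ > x₁ > ⋯ > x_{2(k'-1)}` of `p₀` in decreasing order. -/
def x {k : ℕ} (α β : Fin k → ℝ) (l : ℕ) : ℝ :=
  ((p0 α β).roots.sort (· ≥ ·)).getD l 0

/-- The number `k'`, given by `deg p₀ = 2 k' - 1`. -/
def kPrime {k : ℕ} (α β : Fin k → ℝ) : ℕ := ((p0 α β).natDegree + 1) / 2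

/-! ### The Riemann surface -/

/-- The affine curve `{(z, w) ∈ ℂ² : w² = p₀(z)}`. -/
abbrev Curve {k : ℕ} (α β : Fin k → ℝ) : Type :=
  {P : ℂ × ℂ // P.2 ^ 2 - Polynomial.aeval P.1 (p0 α β) = 0}

/-- The compact Riemann surface `ℛ`: the affine curve together with the point `(∞, ∞)`.
Since `deg p₀` is odd there is one point at infinity, so topologically `ℛ` is the one-point
compactification of the affine curve. -/
abbrev Surface {k : ℕ} (α β : Fin k → ℝ) : Type := OnePoint (Curve α β)

/-- The loops `C₀⁺ = {z ∈ [0, ∞)} ∪ {(∞, ∞)}` and `C_ℓ⁺ = {z ∈ [x_{2ℓ}, x_{2ℓ-1}]}` for `ℓ ≥ 1`. -/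
def loop {k : ℕ} (α β : Fin k → ℝ) : ℕ → Set (Surface α β)
  | 0 => insert OnePoint.infty
      {P | ∃ S : Curve α β, P = ↑S ∧ ∃ t : ℝ, 0 ≤ t ∧ S.1.1 = t}
  | l + 1 => {P | ∃ S : Curve α β, P = ↑S ∧
      ∃ t : ℝ, t ∈ Set.Icc (x α β (2 * (l + 1))) (x α β (2 * (l + 1) - 1)) ∧ S.1.1 = t}

/-- `C⁺ = C₀⁺ ∪ ⋯ ∪ C_{k'-1}⁺`. -/
def realLocus {k : ℕ} (α β : Fin k → ℝ) : Set (Surface α β) :=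
  ⋃ l ∈ Finset.range (kPrime α β), loop α β l

/-- The cuts `(-∞, x_{2(k'-1)}] ∪ ⋃_{ℓ=0}^{k'-2} [x_{2ℓ+1}, x_{2ℓ}]`. -/
def cuts {k : ℕ} (α β : Fin k → ℝ) : Set ℝ :=
  Set.Iic (x α β (2 * (kPrime α β - 1))) ∪
    ⋃ l ∈ Finset.range (kPrime α β - 1), Set.Icc (x α β (2 * l + 1)) (x α β (2 * l))

/-- `g` is an analytic continuation of `t ↦ p₀(t)^{1/2}`, `t > 0`, to the plane slit along
the cuts. -/
def IsSqrtContinuation {k : ℕ} (α β : Fin k → ℝ) (g : ℂ → ℂ) : Prop :=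
  DifferentiableOn ℂ g ((fun t : ℝ => (t : ℂ)) '' cuts α β)ᶜ ∧
    ∀ t : ℝ, 0 < t → g t = (Real.sqrt ((p0 α β).eval t) : ℂ)

/-- The branch `p₀^{1/2}` on the slit plane (its values on the cuts are irrelevant here). -/
def sqrtP0 {k : ℕ} (α β : Fin k → ℝ) : ℂ → ℂ := Classical.epsilon (IsSqrtContinuation α β)

/-- The region `ℛ₁₂`: the interior of the closure, in `ℛ`, of the union of the upper half plane
of the first sheet and the lower half plane of the second sheet. -/
def R12 {k : ℕ} (α β : Fin k → ℝ) : Set (Surface α β) :=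
  interior (closure {P | ∃ S : Curve α β, P = ↑S ∧
    ((0 < S.1.1.im ∧ S.1.2 = sqrtP0 α β S.1.1) ∨
      (S.1.1.im < 0 ∧ S.1.2 = -sqrtP0 α β S.1.1))})

/-! ### The action function, its critical points and the rough region -/

/-- The meromorphic function `ρ(z, w) = Tr Φ(z) / 2 + q(z) w / (2 (z - 1)^k)`. -/
def rho {k : ℕ} (α β : Fin k → ℝ) (P : ℂ × ℂ) : ℂ :=
  (Phi α β P.1).trace / 2 + Polynomial.aeval P.1 (q α β) * P.2 / (2 * (P.1 - 1) ^ k)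

/-- `γ` is (the inverse of) a holomorphic chart of the affine curve, centred at `S`. -/
def IsLocalParam {k : ℕ} (α β : Fin k → ℝ) (S : Curve α β) (γ : ℂ → ℂ × ℂ) : Prop :=
  AnalyticAt ℂ γ 0 ∧ γ 0 = S.1 ∧ deriv γ 0 ≠ 0 ∧
    ∀ᶠ t in 𝓝 (0 : ℂ), (γ t).2 ^ 2 - Polynomial.aeval (γ t).1 (p0 α β) = 0

/-- `f` is, near `0`, an analytic branch of `log (h)`. -/
def IsLogBranch (h f : ℂ → ℂ) : Prop :=
  AnalyticAt ℂ f 0 ∧ ∀ᶠ t in 𝓝 (0 : ℂ), Complex.exp (f t) = h t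

/-- `f` is, near `0`, a branch of the multi-valued function
`F(z, w; χ, η) = (k/4) (η + 1) log z - (k/2) log (z - 1) - (χ/2) log ρ(z, w)`
read in the local coordinate given by `γ`; here `v = (χ, η)`. -/
def IsBranchOfF {k : ℕ} (α β : Fin k → ℝ) (v : ℝ × ℝ) (γ : ℂ → ℂ × ℂ) (f : ℂ → ℂ) : Prop :=
  ∃ a b c : ℂ → ℂ,
    IsLogBranch (fun t => (γ t).1) a ∧
    IsLogBranch (fun t => (γ t).1 - 1) b ∧
    IsLogBranch (fun t => rho α β (γ t)) c ∧
    f = fun t => (k : ℂ) / 4 * ((v.2 : ℂ) + 1) * a t - (k : ℂ) / 2 * b t - (v.1 : ℂ) / 2 * c t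

/-- `P` is a critical point of `F(· ; χ, η)`, `v = (χ, η)`: the derivative of `F` in a local
coordinate centred at `P` vanishes. (This does not depend on the coordinate or on the branch.)
The points of `ℛ` with `z ∈ {0, 1, ∞}` are not critical points: `F` has no
local branch there, its differential having a pole with non-zero residue for
`(χ, η) ∈ (-1, 1)²`. -/
def IsCriticalPoint {k : ℕ} (α β : Fin k → ℝ) (v : ℝ × ℝ) (P : Surface α β) : Prop :=
  ∃ S : Curve α β, P = ↑S ∧ S.1.1 ≠ 0 ∧ S.1.1 ≠ 1 ∧
    ∃ γ f, IsLocalParam α β S γ ∧ IsBranchOfF α β v γ f ∧ deriv f 0 = 0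

/-- The rough region `𝒢_R`: those `(χ, η) ∈ (-1, 1)²` for which `F` has a critical point in
`ℛ \ C⁺`. -/
def roughRegion {k : ℕ} (α β : Fin k → ℝ) : Set (ℝ × ℝ) :=
  {v | v ∈ Set.Ioo (-1 : ℝ) 1 ×ˢ Set.Ioo (-1 : ℝ) 1 ∧
    ∃ P : Surface α β, P ∉ realLocus α β ∧ IsCriticalPoint α β v P}

/-! ### Diffeomorphisms onto regions of the surface -/

/-- The embedding of the affine part of `ℛ` into `ℂ²` (with a junk value at infinity). -/
def affineCoord {k : ℕ} (α β : Fin k → ℝ) (P : Surface α β) : ℂ × ℂ :=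
  OnePoint.elim P (0, 0) Subtype.val

/-- `L` is a diffeomorphism (of class `C^∞`) from the open set `G ⊆ ℝ²` onto the open subset `V`
of the affine part of `ℛ`. The affine part is a smooth submanifold of `ℂ²`, so `L` is smooth when
it is smooth as a map into `ℂ²`, and `L⁻¹` is smooth when it extends, near each point of `V`,
to a smooth map on an open subset of `ℂ²`. -/
def IsDiffeomorphism {k : ℕ} (α β : Fin k → ℝ) (L : ℝ × ℝ → Surface α β)
    (G : Set (ℝ × ℝ)) (V : Set (Surface α β)) : Prop :=
  IsOpen G ∧ IsOpen V ∧ OnePoint.infty ∉ V ∧ Set.BijOn L G V ∧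
    ContDiffOn ℝ ∞ (fun v => affineCoord α β (L v)) G ∧
    ∀ P ∈ V, ∃ U : Set (ℂ × ℂ), IsOpen U ∧ affineCoord α β P ∈ U ∧
      ∃ g : ℂ × ℂ → ℝ × ℝ, ContDiffOn ℝ ∞ g U ∧
        ∀ v ∈ G, affineCoord α β (L v) ∈ U → g (affineCoord α β (L v)) = v

end Aztec

end

/-!
With `T = (z - 1)^k Tr Φ`, the polynomial `p = T² - 4 (z - 1)^(2k)` is the discriminant of the
characteristic polynomial of the transfer matrix `(z - 1)^k Φ`. Off `(-∞, 0]` this matrix strictly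
expands an indefinite Hermitian form, which excludes zeros of `p`. On `z < 0`, suitably conjugated,
it rotates every vector monotonically in `z`; at a multiple zero of `p` it is therefore scalar and
`p'' < 0`, so that the zero is double and `p₀ < 0` there.

Clearing denominators in `dF = 0` gives `k ((η - 1) z - (η + 1)) w = 2 χ z n(z)`, where `n` has
degree at most `m = k' - 1` and, by Rolle's theorem for `(Tr Φ)² - 4 = p / (z - 1)^(2k)`, one zero
in each of the `m` gaps `[x₂ₗ₊₂, x₂ₗ₊₁]`. If `χ ≠ 0`, squaring and dividing by `z` leaves a
polynomial of degree at most `2m + 2` with two zeros in every gap, hence with at most one pair of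
nonreal zeros. When there is such a pair, its members are simple zeros, which is the nonvanishing
of the Jacobian in the implicit function theorem, and the absence of zeros on `[0, ∞)` forces
`(χ, η) ∈ (-1, 1)²`.

Conversely, at a nonreal point of the curve the equation determines `(χ, η)` uniquely, because
`d log ρ / d log z` is not real there. Conjugation reverses the sign of its imaginary part, and
`ℛ₁₂` is one of the two halves of the nonreal curve on which this sign is constant.
-/

noncomputable section

namespace Aztec

open Polynomial
open scoped Matrix ComplexConjugate

/-! ### The transfer matrix -/

/-- The factor of the ordered product `PhiPoly` with parameters `αₘ = a` and `βₘ = b`. -/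
def stepPoly (a b : ℝ) : Matrix (Fin 2) (Fin 2) ℝ[X] :=
  !![X + C (a * b⁻¹), C (a + b); C (a⁻¹ + b⁻¹) * X, X + C (a⁻¹ * b)]

theorem PhiPoly_induction {p : ℕ → Matrix (Fin 2) (Fin 2) ℝ[X] → Prop} {k : ℕ} {α β : Fin k → ℝ}
    (one : p 0 1) (step : ∀ m n M, p n M → p (n + 1) (stepPoly (α m) (β m) * M)) :
    p k (PhiPoly α β) := by
  induction k with
  | zero => simpa only [PhiPoly, List.ofFn_zero, List.prod_nil] using one
  | succ k ih =>
    rw [PhiPoly, List.ofFn_succ, List.prod_cons]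
    exact step 0 k _ (ih fun m => step m.succ)

theorem det_stepPoly {a b : ℝ} (ha : a ≠ 0) (hb : b ≠ 0) : (stepPoly a b).det = (X - 1) ^ 2 := by
  refine Polynomial.funext fun t => ?_
  simp only [stepPoly, Matrix.det_fin_two_of, eval_sub, eval_mul, eval_add, eval_X, eval_C,
    eval_pow, eval_one]
  field_simp
  ring

theorem stepPoly_coeff_nonneg {a b : ℝ} (ha : 0 ≤ a) (hb : 0 ≤ b) (i j : Fin 2) (n : ℕ) :
    0 ≤ (stepPoly a b i j).coeff n := by
  have hX : 0 ≤ (X : ℝ[X]).coeff n := by rw [coeff_X]; positivity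
  have hC {r : ℝ} (hr : 0 ≤ r) : 0 ≤ (C r : ℝ[X]).coeff n := by rw [coeff_C]; positivity
  fin_cases i <;> fin_cases j
  · exact (add_nonneg hX (hC (by positivity))).trans_eq (coeff_add X _ n).symm
  · exact hC (by positivity)
  · exact (mul_nonneg (by positivity) hX).trans_eq (coeff_C_mul X).symm
  · exact (add_nonneg hX (hC (by positivity))).trans_eq (coeff_add X _ n).symm

theorem natDegree_stepPoly_le (a b : ℝ) (i j : Fin 2) : (stepPoly a b i j).natDegree ≤ 1 := by
  fin_cases i <;> fin_cases j
  · exact (natDegree_X_add_C _).le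
  · exact (natDegree_C _).trans_le zero_le_one
  · exact (natDegree_C_mul_le _ _).trans natDegree_X_le
  · exact (natDegree_X_add_C _).le

theorem natDegree_stepPoly_mul_le {a b : ℝ} {M : Matrix (Fin 2) (Fin 2) ℝ[X]} {n : ℕ}
    (hM : ∀ i j, (M i j).natDegree ≤ n) (i j : Fin 2) :
    ((stepPoly a b * M) i j).natDegree ≤ n + 1 := by
  rw [Matrix.mul_apply, add_comm n]
  exact natDegree_sum_le_of_forall_le _ _ fun l _ =>
    natDegree_mul_le_of_le (natDegree_stepPoly_le a b i l) (hM l j)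

theorem coeff_one_stepPoly (a b : ℝ) :
    (stepPoly a b 0 0).coeff 1 = 1 ∧ (stepPoly a b 0 1).coeff 1 = 0 ∧
      (stepPoly a b 1 1).coeff 1 = 1 := by
  simp [stepPoly]

section PhiPoly

variable {k : ℕ} {α β : Fin k → ℝ}

theorem det_PhiPoly (hα : ∀ m, α m ≠ 0) (hβ : ∀ m, β m ≠ 0) :
    (PhiPoly α β).det = (X - 1) ^ (2 * k) :=
  PhiPoly_induction (p := fun n M => M.det = (X - 1) ^ (2 * n)) (by simp) fun m n M hM => by
    rw [Matrix.det_mul, det_stepPoly (hα m) (hβ m), hM, ← pow_add]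
    ring

theorem PhiPoly_coeff_nonneg (hα : ∀ m, 0 ≤ α m) (hβ : ∀ m, 0 ≤ β m) (i j : Fin 2) (n : ℕ) :
    0 ≤ (PhiPoly α β i j).coeff n := by
  refine PhiPoly_induction (p := fun _ M => ∀ i j n, 0 ≤ (M i j).coeff n) ?_ ?_ i j n
  · intro i j n
    rw [Matrix.one_apply]
    split_ifs
    · rw [coeff_one]; positivity
    · exact (coeff_zero n).ge
  · intro m _ M hM i j n
    rw [Matrix.mul_apply, finsetSum_coeff]
    refine Finset.sum_nonneg fun l _ => ?_
    rw [coeff_mul]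
    exact Finset.sum_nonneg fun s _ =>
      mul_nonneg (stepPoly_coeff_nonneg (hα m) (hβ m) i l s.1) (hM l j s.2)

theorem natDegree_PhiPoly_le (i j : Fin 2) : (PhiPoly α β i j).natDegree ≤ k := by
  refine PhiPoly_induction (p := fun n M => ∀ i j, (M i j).natDegree ≤ n) ?_ ?_ i j
  · intro i j
    fin_cases i <;> fin_cases j <;> simp
  · exact fun m n M hM => natDegree_stepPoly_mul_le hM

theorem PhiPoly_coeff_self :
    (PhiPoly α β 0 0).coeff k = 1 ∧ (PhiPoly α β 0 1).coeff k = 0 ∧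
      (PhiPoly α β 1 1).coeff k = 1 := by
  refine (PhiPoly_induction (p := fun n M => (∀ i j, (M i j).natDegree ≤ n) ∧
    (M 0 0).coeff n = 1 ∧ (M 0 1).coeff n = 0 ∧ (M 1 1).coeff n = 1) ?_ ?_).2
  · refine ⟨fun i j => ?_, by simp⟩
    fin_cases i <;> fin_cases j <;> simp
  · rintro m n M ⟨hdeg, h00, h01, h11⟩
    have hcoeff (i j : Fin 2) : ((stepPoly (α m) (β m) * M) i j).coeff (n + 1) =
        (stepPoly (α m) (β m) i 0).coeff 1 * (M 0 j).coeff n +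
          (stepPoly (α m) (β m) i 1).coeff 1 * (M 1 j).coeff n := by
      rw [Matrix.mul_apply, Fin.sum_univ_two, coeff_add, add_comm n,
        coeff_mul_add_eq_of_natDegree_le (natDegree_stepPoly_le _ _ i 0) (hdeg 0 j),
        coeff_mul_add_eq_of_natDegree_le (natDegree_stepPoly_le _ _ i 1) (hdeg 1 j)]
    obtain ⟨s00, s01, s11⟩ := coeff_one_stepPoly (α m) (β m)
    refine ⟨natDegree_stepPoly_mul_le hdeg, ?_, ?_, ?_⟩
    · rw [hcoeff, s00, s01, h00]; ring
    · rw [hcoeff, s00, s01, h01]; ring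
    · rw [hcoeff, s11, h01, h11]; ring

theorem PhiPoly_eval_zero :
    (PhiPoly α β 1 0).eval 0 = 0 ∧ (PhiPoly α β 0 0).eval 0 = ∏ m, (α m * (β m)⁻¹) ∧
      (PhiPoly α β 1 1).eval 0 = ∏ m, ((α m)⁻¹ * β m) := by
  induction k with
  | zero => simp [PhiPoly]
  | succ k ih =>
    obtain ⟨h10, h00, h11⟩ := ih (α := fun m => α m.succ) (β := fun m => β m.succ)
    have hsucc : PhiPoly α β = stepPoly (α 0) (β 0) *
        PhiPoly (fun m : Fin k => α m.succ) (fun m => β m.succ) := by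
      rw [PhiPoly, List.ofFn_succ, List.prod_cons]; rfl
    rw [hsucc, Fin.prod_univ_succ, Fin.prod_univ_succ]
    simp [Matrix.mul_apply, Fin.sum_univ_two, stepPoly, h10, h00, h11]

end PhiPoly

/-! ### The trace polynomial and the discriminant -/

/-- The polynomial `(z - 1)^k Tr Φ(z)`. -/
def trPoly {k : ℕ} (α β : Fin k → ℝ) : ℝ[X] := (PhiPoly α β).trace

theorem monic_X_sub_one_pow (n : ℕ) : ((X - 1 : ℝ[X]) ^ n).Monic :=
  (monic_X_sub_C 1).pow n

theorem natDegree_X_sub_one_pow (n : ℕ) : ((X - 1 : ℝ[X]) ^ n).natDegree = n := by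
  rw [← C_1, natDegree_pow, natDegree_X_sub_C, mul_one]

section trPoly

variable {k : ℕ} {α β : Fin k → ℝ}

theorem trPoly_eq : trPoly α β = PhiPoly α β 0 0 + PhiPoly α β 1 1 := Matrix.trace_fin_two _

theorem trPoly_coeff_nonneg (hα : ∀ m, 0 ≤ α m) (hβ : ∀ m, 0 ≤ β m) (n : ℕ) :
    0 ≤ (trPoly α β).coeff n := by
  rw [trPoly_eq, coeff_add]
  exact add_nonneg (PhiPoly_coeff_nonneg hα hβ 0 0 n) (PhiPoly_coeff_nonneg hα hβ 1 1 n)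

theorem natDegree_trPoly_le : (trPoly α β).natDegree ≤ k := by
  rw [trPoly_eq]
  exact natDegree_add_le_of_degree_le (natDegree_PhiPoly_le 0 0) (natDegree_PhiPoly_le 1 1)

theorem trPoly_coeff_self : (trPoly α β).coeff k = 2 := by
  rw [trPoly_eq, coeff_add, PhiPoly_coeff_self.1, PhiPoly_coeff_self.2.2]
  norm_num

theorem trPoly_eval_one_pos (hα : ∀ m, 0 ≤ α m) (hβ : ∀ m, 0 ≤ β m) :
    0 < (trPoly α β).eval 1 := by
  rw [eval_eq_sum_range' (Nat.lt_succ_of_le natDegree_trPoly_le)]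
  simp only [one_pow, mul_one]
  exact Finset.sum_pos' (fun i _ => trPoly_coeff_nonneg hα hβ i)
    ⟨k, Finset.self_mem_range_succ k, by rw [trPoly_coeff_self]; norm_num⟩

theorem trPoly_eval_zero (hβ : ∀ m, β m ≠ 0) (hαβ : ∏ m, α m = ∏ m, β m) :
    (trPoly α β).eval 0 = 2 := by
  obtain ⟨-, h00, h11⟩ := PhiPoly_eval_zero (α := α) (β := β)
  have hprod : ∏ m, β m ≠ 0 := Finset.prod_ne_zero_iff.2 fun m _ => hβ m
  rw [trPoly_eq, eval_add, h00, h11, Finset.prod_mul_distrib, Finset.prod_mul_distrib,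
    Finset.prod_inv_distrib, Finset.prod_inv_distrib, hαβ, mul_inv_cancel₀ hprod,
    inv_mul_cancel₀ hprod]
  norm_num

theorem trPoly_derivative_eval_zero_nonneg (hα : ∀ m, 0 ≤ α m) (hβ : ∀ m, 0 ≤ β m) :
    0 ≤ (derivative (trPoly α β)).eval 0 := by
  rw [← coeff_zero_eq_eval_zero, coeff_derivative]
  exact mul_nonneg (trPoly_coeff_nonneg hα hβ _) (by positivity)

theorem natDegree_trPoly_add :
    (trPoly α β + C 2 * (X - 1) ^ k).natDegree = k ∧
      (trPoly α β + C 2 * (X - 1) ^ k).leadingCoeff = 4 := by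
  have hcoeff : (trPoly α β + C 2 * (X - 1) ^ k).coeff k = 4 := by
    have hX := (monic_X_sub_one_pow k).coeff_natDegree
    rw [natDegree_X_sub_one_pow] at hX
    rw [coeff_add, coeff_C_mul, trPoly_coeff_self, hX]
    norm_num
  have hdeg : (trPoly α β + C 2 * (X - 1) ^ k).natDegree = k :=
    natDegree_eq_of_le_of_coeff_ne_zero (natDegree_add_le_of_degree_le natDegree_trPoly_le
      ((natDegree_C_mul_le _ _).trans (natDegree_X_sub_one_pow k).le)) (by rw [hcoeff]; norm_num)
  exact ⟨hdeg, by rw [leadingCoeff, hdeg, hcoeff]⟩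

theorem natDegree_trPoly_sub (hk : 0 < k) (hα : ∀ m, 0 ≤ α m) (hβ : ∀ m, 0 ≤ β m) :
    (trPoly α β - C 2 * (X - 1) ^ k).natDegree = k - 1 ∧
      0 < (trPoly α β - C 2 * (X - 1) ^ k).leadingCoeff := by
  obtain ⟨j, rfl⟩ := Nat.exists_eq_add_one.2 hk
  have hX := (monic_X_sub_one_pow (j + 1)).coeff_natDegree
  rw [natDegree_X_sub_one_pow] at hX
  have htop : (trPoly α β - C 2 * (X - 1) ^ (j + 1)).coeff (j + 1) = 0 := by
    rw [coeff_sub, coeff_C_mul, trPoly_coeff_self, hX]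
    norm_num
  have hcoeff : 0 < (trPoly α β - C 2 * (X - 1) ^ (j + 1)).coeff j := by
    have hX' : ((X - 1 : ℝ[X]) ^ (j + 1)).coeff j = -(j + 1) := by
      rw [sub_eq_add_neg, ← C_1, ← C_neg, coeff_X_add_C_pow]
      simp
    have hT := trPoly_coeff_nonneg hα hβ j
    rw [coeff_sub, coeff_C_mul, hX']
    linarith [j.cast_nonneg (α := ℝ)]
  have hdeg : (trPoly α β - C 2 * (X - 1) ^ (j + 1)).natDegree = j := by
    have hle : (trPoly α β - C 2 * (X - 1) ^ (j + 1)).natDegree ≤ j + 1 :=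
      (natDegree_sub_le_of_le natDegree_trPoly_le
        ((natDegree_C_mul_le _ _).trans (natDegree_X_sub_one_pow _).le)).trans (max_self _).le
    exact natDegree_eq_of_le_of_coeff_ne_zero (natDegree_le_pred hle htop) hcoeff.ne'
  exact ⟨hdeg, by rwa [leadingCoeff, hdeg]⟩

theorem discPoly_eq_trPoly : discPoly α β = trPoly α β ^ 2 - C 4 * (X - 1) ^ (2 * k) := rfl

theorem discPoly_eq_sub_mul_add : discPoly α β =
    (trPoly α β - C 2 * (X - 1) ^ k) * (trPoly α β + C 2 * (X - 1) ^ k) := by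
  rw [discPoly_eq_trPoly, show (4 : ℝ) = 2 * 2 by norm_num, C_mul]
  ring

theorem discPoly_eq_sq_add (hα : ∀ m, α m ≠ 0) (hβ : ∀ m, β m ≠ 0) :
    discPoly α β = (PhiPoly α β 0 0 - PhiPoly α β 1 1) ^ 2 +
      C 4 * (PhiPoly α β 0 1 * PhiPoly α β 1 0) := by
  rw [discPoly_eq_trPoly, ← det_PhiPoly hα hβ, Matrix.det_fin_two, trPoly_eq,
    show (C 4 : ℝ[X]) = 4 from rfl]
  ring

theorem natDegree_discPoly (hk : 0 < k) (hα : ∀ m, 0 ≤ α m) (hβ : ∀ m, 0 ≤ β m) :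
    (discPoly α β).natDegree = 2 * k - 1 := by
  obtain ⟨hsub, hsub_pos⟩ := natDegree_trPoly_sub hk hα hβ
  obtain ⟨hadd, hadd_eq⟩ := natDegree_trPoly_add (α := α) (β := β)
  have hadd_ne : (trPoly α β + C 2 * (X - 1) ^ k).leadingCoeff ≠ 0 := by rw [hadd_eq]; norm_num
  rw [discPoly_eq_sub_mul_add, natDegree_mul (leadingCoeff_ne_zero.1 hsub_pos.ne')
    (leadingCoeff_ne_zero.1 hadd_ne), hsub, hadd]
  omega

theorem discPoly_leadingCoeff_pos (hk : 0 < k) (hα : ∀ m, 0 ≤ α m) (hβ : ∀ m, 0 ≤ β m) :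
    0 < (discPoly α β).leadingCoeff := by
  rw [discPoly_eq_sub_mul_add, leadingCoeff_mul, natDegree_trPoly_add.2]
  exact mul_pos (natDegree_trPoly_sub hk hα hβ).2 (by norm_num)

theorem discPoly_eval_one_pos (hk : 0 < k) (hα : ∀ m, 0 ≤ α m) (hβ : ∀ m, 0 ≤ β m) :
    0 < (discPoly α β).eval 1 := by
  have htr := trPoly_eval_one_pos hα hβ
  rw [discPoly_eq_trPoly, eval_sub, eval_mul, eval_pow, eval_pow, eval_sub, eval_X, eval_one,
    sub_self, zero_pow (by omega), mul_zero, sub_zero]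
  positivity

theorem discPoly_eval_zero (hβ : ∀ m, β m ≠ 0) (hαβ : ∏ m, α m = ∏ m, β m) :
    (discPoly α β).eval 0 = 0 := by
  rw [discPoly_eq_trPoly, eval_sub, eval_mul, eval_pow, eval_pow, eval_sub, eval_X, eval_one,
    trPoly_eval_zero hβ hαβ, eval_C, pow_mul]
  norm_num

theorem discPoly_derivative_eval_zero_pos (hk : 0 < k) (hα : ∀ m, 0 ≤ α m)
    (hβ : ∀ m, 0 < β m) (hαβ : ∏ m, α m = ∏ m, β m) :
    0 < (derivative (discPoly α β)).eval 0 := by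
  have htr := trPoly_derivative_eval_zero_nonneg hα fun m => (hβ m).le
  have hodd : ((-1 : ℝ)) ^ (2 * k - 1) = -1 := Odd.neg_one_pow ⟨k - 1, by omega⟩
  have hderiv : (derivative (discPoly α β)).eval 0 =
      4 * (derivative (trPoly α β)).eval 0 + 8 * k := by
    simp only [discPoly_eq_trPoly, derivative_sub, derivative_mul, derivative_pow, derivative_C,
      derivative_X, derivative_one, eval_sub, eval_add, eval_mul, eval_pow, eval_C, eval_X,
      eval_one, eval_zero, trPoly_eval_zero (fun m => (hβ m).ne') hαβ, zero_sub, hodd]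
    push_cast
    ring
  have : (0 : ℝ) < k := by exact_mod_cast hk
  rw [hderiv]
  positivity

end trPoly

/-! ### Multiple zeros of the discriminant on the negative axis -/

/-- The rotation form at `z` of a matrix `A` with `z`-derivative `A'`. For `z < 0`, after
conjugation of `A` by `diag (√(-z), 1)`, it is, up to a negative factor, the squared length of the
image of a vector times the `z`-derivative of the angle of that image. -/
def rotationForm (A A' : Matrix (Fin 2) (Fin 2) ℝ) (z : ℝ) (v : Fin 2 → ℝ) : ℝ :=
  2 * z * ((A *ᵥ v) 0 * (A' *ᵥ v) 1 - (A *ᵥ v) 1 * (A' *ᵥ v) 0)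
    - (A *ᵥ v) 0 * (A *ᵥ v) 1 + A.det * (v 0 * v 1)

theorem rotationForm_mul (A A' B B' : Matrix (Fin 2) (Fin 2) ℝ) (z : ℝ) (v : Fin 2 → ℝ) :
    rotationForm (A * B) (A' * B + A * B') z v =
      A.det * rotationForm B B' z v + rotationForm A A' z (B *ᵥ v) := by
  simp only [rotationForm, Matrix.det_fin_two, Matrix.mulVec, dotProduct, Fin.sum_univ_two,
    Matrix.mul_apply, Matrix.add_apply]
  ring

theorem map_derivative_mul (M N : Matrix (Fin 2) (Fin 2) ℝ[X]) :
    (M * N).map derivative = M.map derivative * N + M * N.map derivative := by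
  ext1 i j
  simp only [Matrix.map_apply, Matrix.mul_apply, Matrix.add_apply, derivative_sum, derivative_mul,
    Finset.sum_add_distrib]

/-- The rotation form at `z` of a matrix of polynomials. -/
def polyRotationForm (M : Matrix (Fin 2) (Fin 2) ℝ[X]) (z : ℝ) (v : Fin 2 → ℝ) : ℝ :=
  rotationForm (M.map (eval z)) ((M.map derivative).map (eval z)) z v

theorem polyRotationForm_mul (M N : Matrix (Fin 2) (Fin 2) ℝ[X]) (z : ℝ) (v : Fin 2 → ℝ) :
    polyRotationForm (M * N) z v =
      M.det.eval z * polyRotationForm N z v + polyRotationForm M z (N.map (eval z) *ᵥ v) := by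
  have hdet : M.det.eval z = (M.map (eval z)).det := (evalRingHom z).map_det M
  have hmul (A B : Matrix (Fin 2) (Fin 2) ℝ[X]) :
      (A * B).map (eval z) = A.map (eval z) * B.map (eval z) :=
    Matrix.map_mul (f := evalRingHom z)
  have hadd (A B : Matrix (Fin 2) (Fin 2) ℝ[X]) :
      (A + B).map (eval z) = A.map (eval z) + B.map (eval z) :=
    Matrix.map_add _ (fun _ _ => eval_add) A B
  rw [polyRotationForm, map_derivative_mul, hadd, hmul, hmul, hmul, rotationForm_mul, hdet]
  rfl

theorem polyRotationForm_stepPoly {a b : ℝ} (ha : a ≠ 0) (hb : b ≠ 0) (z : ℝ) (v : Fin 2 → ℝ) :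
    polyRotationForm (stepPoly a b) z v = z * a * (v 0 / b + v 1) ^ 2
      - (z * v 0 + b * v 1) ^ 2 / a - (1 - z) * (b * v 1 ^ 2 - z * v 0 ^ 2 / b) := by
  simp only [polyRotationForm, rotationForm, stepPoly, Matrix.det_fin_two, Matrix.mulVec,
    dotProduct, Fin.sum_univ_two, Matrix.map_apply, Matrix.of_apply, Matrix.cons_val',
    Matrix.cons_val_zero, Matrix.cons_val_one, Matrix.cons_val_fin_one, derivative_add,
    derivative_mul, derivative_X, derivative_C, eval_add, eval_mul, eval_X, eval_C, eval_one,
    eval_zero]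
  field_simp
  ring

theorem polyRotationForm_stepPoly_neg {a b z : ℝ} (ha : 0 < a) (hb : 0 < b) (hz : z < 0)
    {v : Fin 2 → ℝ} (hv : v ≠ 0) : polyRotationForm (stepPoly a b) z v < 0 := by
  have hpos : 0 < b * v 1 ^ 2 + -z * v 0 ^ 2 / b := by
    have hz' : 0 < -z := neg_pos.2 hz
    by_cases h1 : v 1 = 0
    · have h0 : v 0 ≠ 0 := fun h0 => hv (by ext i; fin_cases i <;> assumption)
      positivity
    · positivity
  have hfirst : 0 ≤ -z * (a * (v 0 / b + v 1) ^ 2) :=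
    mul_nonneg (neg_nonneg.2 hz.le) (by positivity)
  have hsecond : 0 ≤ (z * v 0 + b * v 1) ^ 2 / a := by positivity
  have hthird : 0 < (1 - z) * (b * v 1 ^ 2 + -z * v 0 ^ 2 / b) := mul_pos (by linarith) hpos
  rw [polyRotationForm_stepPoly ha.ne' hb.ne']
  linear_combination hfirst + hsecond + hthird

theorem polyRotationForm_stepPoly_mul_neg {a b z : ℝ} (ha : 0 < a) (hb : 0 < b) (hz : z < 0)
    {M : Matrix (Fin 2) (Fin 2) ℝ[X]} (hdet : M.det.eval z ≠ 0) {v : Fin 2 → ℝ} (hv : v ≠ 0)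
    (hM : polyRotationForm M z v ≤ 0) : polyRotationForm (stepPoly a b * M) z v < 0 := by
  have hMv : M.map (eval z) *ᵥ v ≠ 0 := fun h =>
    hv (Matrix.eq_zero_of_mulVec_eq_zero (((evalRingHom z).map_det M).symm.trans_ne hdet) h)
  rw [polyRotationForm_mul]
  refine add_neg_of_nonpos_of_neg (mul_nonpos_of_nonneg_of_nonpos ?_ hM)
    (polyRotationForm_stepPoly_neg ha hb hz hMv)
  rw [det_stepPoly ha.ne' hb.ne', eval_pow]
  positivity

theorem polyRotationForm_PhiPoly_neg {k : ℕ} (hk : 0 < k) {α β : Fin k → ℝ} (hα : ∀ m, 0 < α m)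
    (hβ : ∀ m, 0 < β m) {z : ℝ} (hz : z < 0) {v : Fin 2 → ℝ} (hv : v ≠ 0) :
    polyRotationForm (PhiPoly α β) z v < 0 := by
  refine (PhiPoly_induction (p := fun n M => M.det.eval z ≠ 0 ∧ polyRotationForm M z v ≤ 0 ∧
    (0 < n → polyRotationForm M z v < 0)) ?_ ?_).2.2 hk
  · refine ⟨by simp, le_of_eq ?_, fun h => absurd h (lt_irrefl 0)⟩
    simp [polyRotationForm, rotationForm]
  · rintro m n M ⟨hdet, hM, -⟩
    have hneg := polyRotationForm_stepPoly_mul_neg (hα m) (hβ m) hz hdet hv hM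
    refine ⟨?_, hneg.le, fun _ => hneg⟩
    rw [Matrix.det_mul, eval_mul, det_stepPoly (hα m).ne' (hβ m).ne', eval_pow, eval_sub, eval_X,
      eval_one]
    exact mul_ne_zero (pow_ne_zero _ (by linarith)) hdet

section DoubleZero

variable {A A' : Matrix (Fin 2) (Fin 2) ℝ} {z : ℝ}

theorem rotationForm_apply (s t : ℝ) : rotationForm A A' z ![s, t] =
    2 * z * ((A 0 0 * s + A 0 1 * t) * (A' 1 0 * s + A' 1 1 * t) -
        (A 1 0 * s + A 1 1 * t) * (A' 0 0 * s + A' 0 1 * t)) -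
      (A 0 0 * s + A 0 1 * t) * (A 1 0 * s + A 1 1 * t) +
      (A 0 0 * A 1 1 - A 0 1 * A 1 0) * (s * t) := by
  simp [rotationForm, Matrix.det_fin_two, Matrix.mulVec, dotProduct, Fin.sum_univ_two]

/- Where the discriminant vanishes, `(A 0 1, (A 1 1 - A 0 0) / 2)` and
`((A 0 0 - A 1 1) / 2, A 1 0)` span the range of `A - (tr A / 2)`, whose elements are eigenvectors
of `A`; on them the rotation form is a multiple of the derivative of the discriminant. -/
theorem eq_scalar_of_rotationForm_neg (hneg : ∀ v ≠ 0, rotationForm A A' z v < 0)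
    (hdisc : (A 0 0 - A 1 1) ^ 2 + 4 * (A 0 1 * A 1 0) = 0)
    (hderiv : 2 * (A 0 0 - A 1 1) * (A' 0 0 - A' 1 1) +
      4 * (A' 0 1 * A 1 0 + A 0 1 * A' 1 0) = 0) :
    A 0 1 = 0 ∧ A 1 0 = 0 ∧ A 0 0 = A 1 1 := by
  have hfst : (![A 0 1, (A 1 1 - A 0 0) / 2] : Fin 2 → ℝ) = 0 := by
    refine not_imp_comm.1 (hneg _) (Eq.not_lt ?_)
    rw [rotationForm_apply]
    linear_combination (z * A 0 1 * (A 0 0 + A 1 1) / 4) * hderiv +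
      ((-(z * (A 0 0 + A 1 1) * A' 0 1) -
        2 * z * (A' 0 0 * A 0 1 + A' 0 1 * ((A 1 1 - A 0 0) / 2)) -
        (A 0 0 + A 1 1) / 2 * A 0 1 - A 0 1 * ((A 1 1 - A 0 0) / 2)) / 4) * hdisc
  have hsnd : (![(A 0 0 - A 1 1) / 2, A 1 0] : Fin 2 → ℝ) = 0 := by
    refine not_imp_comm.1 (hneg _) (Eq.not_lt ?_)
    rw [rotationForm_apply]
    linear_combination (-(z * A 1 0 * (A 0 0 + A 1 1) / 4)) * hderiv +
      ((z * (A 0 0 + A 1 1) * A' 1 0 +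
        2 * z * (A' 1 0 * ((A 0 0 - A 1 1) / 2) + A' 1 1 * A 1 0) -
        (A 0 0 + A 1 1) / 2 * A 1 0 - (A 0 0 - A 1 1) / 2 * A 1 0) / 4) * hdisc
  have hdiag : (A 0 0 - A 1 1) / 2 = 0 := congrFun hsnd 0
  exact ⟨congrFun hfst 0, congrFun hsnd 1, by linarith⟩

theorem disc_neg_of_rotationForm_neg (hneg : ∀ v ≠ 0, rotationForm A A' z v < 0)
    (h01 : A 0 1 = 0) (h10 : A 1 0 = 0) (hdiag : A 0 0 = A 1 1) :
    (A' 0 0 - A' 1 1) ^ 2 + 4 * (A' 0 1 * A' 1 0) < 0 := by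
  have hform (s t : ℝ) : rotationForm A A' z ![s, t] =
      2 * z * A 1 1 * (A' 1 0 * s ^ 2 - (A' 0 0 - A' 1 1) * s * t - A' 0 1 * t ^ 2) := by
    rw [rotationForm_apply, h01, h10, hdiag]
    ring
  have h := hneg ![1, 0] fun h => one_ne_zero (congrFun h 0)
  rw [hform] at h
  have hc : A' 1 0 ≠ 0 := fun hc => by simp [hc] at h
  have hcomplete := hneg ![A' 0 0 - A' 1 1, 2 * A' 1 0] fun h =>
    hc (by simpa using congrFun h 1)
  rw [hform] at hcomplete
  nlinarith

end DoubleZero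

theorem discPoly_double_zero {k : ℕ} (hk : 0 < k) {α β : Fin k → ℝ} (hα : ∀ m, 0 < α m)
    (hβ : ∀ m, 0 < β m) {z : ℝ} (hz : z < 0) (hzero : (discPoly α β).IsRoot z)
    (hderiv : (derivative (discPoly α β)).IsRoot z) :
    (derivative (derivative (discPoly α β))).eval z < 0 := by
  have hneg : ∀ v ≠ 0, polyRotationForm (PhiPoly α β) z v < 0 := fun v hv =>
    polyRotationForm_PhiPoly_neg hk hα hβ hz hv
  rw [discPoly_eq_sq_add (fun m => (hα m).ne') fun m => (hβ m).ne'] at hzero hderiv ⊢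
  simp only [IsRoot.def, derivative_add, derivative_sub, derivative_mul, derivative_pow,
    derivative_C, eval_add, eval_sub, eval_mul, eval_pow, eval_C, zero_mul,
    zero_add, pow_one, Nat.cast_ofNat, Nat.add_one_sub_one] at hzero hderiv ⊢
  obtain ⟨h01, h10, hdiag⟩ := eq_scalar_of_rotationForm_neg hneg hzero hderiv
  have hdisc := disc_neg_of_rotationForm_neg hneg h01 h10 hdiag
  simp only [Matrix.map_apply] at h01 h10 hdiag hdisc
  simp only [h01, h10, hdiag]
  linear_combination 2 * hdisc

/-! ### Reality of the zeros of the discriminant -/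

/-- The indefinite Hermitian form `Im (u₀ ū₁)`. -/
def imForm (u : Fin 2 → ℂ) : ℝ := (u 0 * conj (u 1)).im

/-- The matrix `(r, -a; a⁻¹, r)`. It is `r` times the conjugate by `diag (r, 1)` of the factor
`symbolFactor a z` at `z = -r²`. -/
def conjFactor (a : ℝ) (r : ℂ) : Matrix (Fin 2) (Fin 2) ℂ := !![r, -a; (a : ℂ)⁻¹, r]

theorem imForm_smul (c : ℂ) (u : Fin 2 → ℂ) : imForm (c • u) = Complex.normSq c * imForm u := by
  simp only [imForm, Pi.smul_apply, smul_eq_mul, map_mul]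
  rw [mul_mul_mul_comm, Complex.mul_conj, Complex.im_ofReal_mul]

theorem imForm_neg (u : Fin 2 → ℂ) : imForm (-u) = imForm u := by
  simp [imForm]

theorem imForm_conjFactor {a : ℝ} (ha : a ≠ 0) (r : ℂ) (u : Fin 2 → ℂ) :
    imForm (conjFactor a r *ᵥ u) = (Complex.normSq r + 1) * imForm u +
      r.im * (Complex.normSq (u 0) / a + a * Complex.normSq (u 1)) := by
  simp [imForm, conjFactor, Matrix.mulVec, dotProduct, Fin.sum_univ_two, Complex.normSq_apply,
    -Complex.ofReal_inv]
  field_simp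
  ring

theorem two_mul_abs_imForm_le {a : ℝ} (ha : 0 < a) (u : Fin 2 → ℂ) :
    2 * |imForm u| ≤ Complex.normSq (u 0) / a + a * Complex.normSq (u 1) := by
  have him : |imForm u| ≤ ‖u 0‖ * ‖u 1‖ := by
    refine (Complex.abs_im_le_norm _).trans_eq ?_
    rw [norm_mul, Complex.norm_conj]
  have hsq : ‖u 0‖ ^ 2 / a + a * ‖u 1‖ ^ 2 - 2 * (‖u 0‖ * ‖u 1‖) =
      (‖u 0‖ - a * ‖u 1‖) ^ 2 / a := by field_simp; ring
  have hnonneg : 0 ≤ (‖u 0‖ - a * ‖u 1‖) ^ 2 / a := by positivity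
  rw [Complex.normSq_eq_norm_sq, Complex.normSq_eq_norm_sq]
  linarith

theorem norm_sq_add_one_le (r : ℂ) : ‖r ^ 2 + 1‖ ≤ Complex.normSq r + 1 := by
  refine (norm_add_le _ _).trans_eq ?_
  rw [norm_pow, norm_one, Complex.normSq_eq_norm_sq]

theorem lt_norm_sq_add_one {r : ℂ} (hr : 0 < r.im) (hr' : r ^ 2 + 1 ≠ 0) :
    Complex.normSq r + 1 - 2 * r.im < ‖r ^ 2 + 1‖ := by
  have hfactor : r ^ 2 + 1 = (r - Complex.I) * (r + Complex.I) := by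
    linear_combination Complex.I_sq
  have hpos : 0 < ‖r - Complex.I‖ :=
    norm_pos_iff.2 fun h => hr' (by rw [hfactor, h, zero_mul])
  have hsub : ‖r - Complex.I‖ ^ 2 = Complex.normSq r + 1 - 2 * r.im := by
    simp only [← Complex.normSq_eq_norm_sq, Complex.normSq_apply, Complex.sub_re, Complex.sub_im,
      Complex.I_re, Complex.I_im]
    ring
  have hadd : ‖r + Complex.I‖ ^ 2 = Complex.normSq r + 1 + 2 * r.im := by
    simp only [← Complex.normSq_eq_norm_sq, Complex.normSq_apply, Complex.add_re, Complex.add_im,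
      Complex.I_re, Complex.I_im]
    ring
  have hlt : ‖r - Complex.I‖ < ‖r + Complex.I‖ :=
    lt_of_pow_lt_pow_left₀ 2 (norm_nonneg _) (by rw [hsub, hadd]; linarith)
  rw [hfactor, norm_mul, ← hsub, sq]
  exact mul_lt_mul_of_pos_left hlt hpos

theorem lt_imForm_conjFactor {a : ℝ} (ha : 0 < a) {r : ℂ} (hr : 0 < r.im) (hr' : r ^ 2 + 1 ≠ 0)
    {u : Fin 2 → ℂ} (hu : u ≠ 0) :
    ‖r ^ 2 + 1‖ * imForm u < imForm (conjFactor a r *ᵥ u) := by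
  rw [imForm_conjFactor ha.ne']
  have hform := two_mul_abs_imForm_le ha u
  have hpos : 0 < Complex.normSq (u 0) / a + a * Complex.normSq (u 1) := by
    have h0 := Complex.normSq_nonneg (u 0)
    have h1 := Complex.normSq_nonneg (u 1)
    obtain ⟨i, hi⟩ := Function.ne_iff.1 hu
    have hi' := Complex.normSq_pos.2 hi
    fin_cases i <;> simp only [Fin.zero_eta, Fin.mk_one] at hi' <;> positivity
  rcases le_or_gt 0 (imForm u) with h | h
  · nlinarith [norm_sq_add_one_le r]
  · rw [abs_of_neg h] at hform
    nlinarith [lt_norm_sq_add_one hr hr']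

/-- The form `Im (r v₀ v̄₁)`, the pullback of `imForm` under `diag (r, 1)`. -/
def diagForm (r : ℂ) (v : Fin 2 → ℂ) : ℝ := imForm ![r * v 0, v 1]

theorem diagForm_smul (r c : ℂ) (v : Fin 2 → ℂ) :
    diagForm r (c • v) = Complex.normSq c * diagForm r v := by
  rw [diagForm, diagForm, ← imForm_smul]
  congr 1
  ext i
  fin_cases i
  · exact mul_left_comm r c (v 0)
  · rfl

theorem diag_mulVec_stepPoly {a b : ℝ} (ha : a ≠ 0) (hb : b ≠ 0) (r : ℂ) (v : Fin 2 → ℂ) :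
    ![r * ((stepPoly a b).map (aeval (-r ^ 2)) *ᵥ v) 0,
        ((stepPoly a b).map (aeval (-r ^ 2)) *ᵥ v) 1] =
      -(conjFactor a r *ᵥ conjFactor b r *ᵥ ![r * v 0, v 1]) := by
  have ha' : (a : ℂ) ≠ 0 := Complex.ofReal_ne_zero.2 ha
  have hb' : (b : ℂ) ≠ 0 := Complex.ofReal_ne_zero.2 hb
  ext i
  fin_cases i <;>
    simp [stepPoly, conjFactor, Matrix.mulVec, dotProduct, Fin.sum_univ_two] <;> field_simp <;>
    ring

theorem lt_diagForm_stepPoly {a b : ℝ} (ha : 0 < a) (hb : 0 < b) {r : ℂ} (hr : 0 < r.im)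
    (hr' : r ^ 2 + 1 ≠ 0) {v : Fin 2 → ℂ} (hv : v ≠ 0) :
    ‖r ^ 2 + 1‖ ^ 2 * diagForm r v < diagForm r ((stepPoly a b).map (aeval (-r ^ 2)) *ᵥ v) := by
  have hr0 : r ≠ 0 := fun h => by simp [h] at hr
  have hu : ![r * v 0, v 1] ≠ 0 := fun h => hv <| by
    ext i
    fin_cases i
    · exact (mul_eq_zero.1 (congrFun h 0)).resolve_left hr0
    · exact congrFun h 1
  have hne : conjFactor b r *ᵥ ![r * v 0, v 1] ≠ 0 := by
    refine fun h => hu (Matrix.eq_zero_of_mulVec_eq_zero ?_ h)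
    have hdet : (conjFactor b r).det = r ^ 2 + 1 := by
      have hb' : (b : ℂ) ≠ 0 := Complex.ofReal_ne_zero.2 hb.ne'
      rw [conjFactor, Matrix.det_fin_two_of, neg_mul, mul_inv_cancel₀ hb']
      ring
    rwa [hdet]
  rw [diagForm, diagForm, diag_mulVec_stepPoly ha.ne' hb.ne', imForm_neg, sq, mul_assoc]
  exact (mul_le_mul_of_nonneg_left (lt_imForm_conjFactor hb hr hr' hu).le (norm_nonneg _)).trans_lt
    (lt_imForm_conjFactor ha hr hr' hne)

theorem lt_diagForm_PhiPoly {k : ℕ} (hk : 0 < k) {α β : Fin k → ℝ} (hα : ∀ m, 0 < α m)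
    (hβ : ∀ m, 0 < β m) {r : ℂ} (hr : 0 < r.im) (hr' : r ^ 2 + 1 ≠ 0) {v : Fin 2 → ℂ}
    (hv : v ≠ 0) :
    ‖r ^ 2 + 1‖ ^ (2 * k) * diagForm r v <
      diagForm r ((PhiPoly α β).map (aeval (-r ^ 2)) *ᵥ v) := by
  refine (PhiPoly_induction (p := fun n M => M.map (aeval (-r ^ 2)) *ᵥ v ≠ 0 ∧
    ‖r ^ 2 + 1‖ ^ (2 * n) * diagForm r v ≤ diagForm r (M.map (aeval (-r ^ 2)) *ᵥ v) ∧
    (0 < n → ‖r ^ 2 + 1‖ ^ (2 * n) * diagForm r v <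
      diagForm r (M.map (aeval (-r ^ 2)) *ᵥ v))) ?_ ?_).2.2 hk
  · simpa [Matrix.map_one] using hv
  · rintro m n M ⟨hMv, hle, -⟩
    have hstep := lt_diagForm_stepPoly (hα m) (hβ m) hr hr' hMv
    have hlt : ‖r ^ 2 + 1‖ ^ (2 * (n + 1)) * diagForm r v <
        diagForm r ((stepPoly (α m) (β m) * M).map (aeval (-r ^ 2)) *ᵥ v) := by
      rw [Matrix.map_mul, ← Matrix.mulVec_mulVec, mul_add_one, pow_add, mul_comm (_ ^ (2 * n)),
        mul_assoc]
      exact (mul_le_mul_of_nonneg_left hle (by positivity)).trans_lt hstep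
    refine ⟨fun h => hMv ?_, hlt.le, fun _ => hlt⟩
    rw [Matrix.map_mul, ← Matrix.mulVec_mulVec] at h
    refine Matrix.eq_zero_of_mulVec_eq_zero ?_ h
    rw [← AlgHom.mapMatrix_apply, ← AlgHom.map_det, det_stepPoly (hα m).ne' (hβ m).ne', map_pow,
      map_sub, aeval_X, map_one]
    exact pow_ne_zero _ fun h => hr' (by linear_combination -h)

theorem exists_mulVec_eq_smul_of_trace_sq {M : Matrix (Fin 2) (Fin 2) ℂ}
    (h : M.trace ^ 2 = 4 * M.det) : ∃ v ≠ 0, M *ᵥ v = (M.trace / 2) • v := by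
  have hdet : (M - (M.trace / 2) • (1 : Matrix (Fin 2) (Fin 2) ℂ)).det = 0 := by
    rw [Matrix.det_fin_two, Matrix.trace_fin_two] at h ⊢
    simp only [Matrix.sub_apply, Matrix.smul_apply, Matrix.one_apply_eq, smul_eq_mul, mul_one,
      Matrix.one_apply_ne zero_ne_one, Matrix.one_apply_ne one_ne_zero, mul_zero, sub_zero]
    linear_combination -h / 4
  obtain ⟨v, hv, hMv⟩ := Matrix.exists_mulVec_eq_zero_iff.2 hdet
  rw [Matrix.sub_mulVec, Matrix.smul_mulVec, Matrix.one_mulVec, sub_eq_zero] at hMv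
  exact ⟨v, hv, hMv⟩

theorem exists_sqrt_neg_im_pos {z : ℂ} (hz : z ∈ Complex.slitPlane) :
    ∃ r : ℂ, -r ^ 2 = z ∧ 0 < r.im := by
  obtain ⟨r, hr⟩ := IsAlgClosed.exists_pow_nat_eq (-z) two_pos
  rcases lt_trichotomy r.im 0 with h | h | h
  · exact ⟨-r, by rw [neg_sq, hr, neg_neg], by simpa using h⟩
  · have hr' : z = ((-(r.re ^ 2) : ℝ) : ℂ) := by
      rw [← neg_neg z, ← hr]
      apply Complex.ext <;> simp [sq, h]
    rw [hr', Complex.ofReal_mem_slitPlane] at hz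
    exact absurd hz (by simpa using sq_nonneg r.re)
  · exact ⟨r, by rw [hr, neg_neg], h⟩

/- At a zero `-r²` of the discriminant the eigenvalue `μ` of the transfer matrix satisfies
`|μ|² = |r² + 1|^(2k)`, so the form of an eigenvector scales exactly by the factor that
`lt_diagForm_PhiPoly` shows to be exceeded. -/
theorem notMem_slitPlane_of_aeval_discPoly_eq_zero {k : ℕ} (hk : 0 < k) {α β : Fin k → ℝ}
    (hα : ∀ m, 0 < α m) (hβ : ∀ m, 0 < β m) {z : ℂ} (hzero : aeval z (discPoly α β) = 0) :
    z ∉ Complex.slitPlane := by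
  intro hz
  obtain ⟨r, rfl, hr⟩ := exists_sqrt_neg_im_pos hz
  have hr' : r ^ 2 + 1 ≠ 0 := fun h => by
    rw [← eq_neg_of_add_eq_zero_right h, ← Complex.ofReal_one] at hzero
    exact (discPoly_eval_one_pos hk (fun m => (hα m).le) fun m => (hβ m).le).ne'
      (Complex.ofReal_eq_zero.1 ((aeval_ofReal (K := ℂ) _ 1).symm.trans hzero))
  set M := (PhiPoly α β).map (aeval (-r ^ 2))
  have htrace : M.trace = aeval (-r ^ 2) (trPoly α β) := by
    rw [trPoly_eq, map_add]
    exact Matrix.trace_fin_two _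
  have hdet : M.det = (r ^ 2 + 1) ^ (2 * k) := by
    refine ((aeval (-r ^ 2)).map_det (PhiPoly α β)).symm.trans ?_
    rw [det_PhiPoly (fun m => (hα m).ne') fun m => (hβ m).ne', map_pow, map_sub, aeval_X, map_one,
      ← (even_two_mul k).neg_pow]
    ring
  have hdisc : M.trace ^ 2 = 4 * M.det := by
    rw [discPoly_eq_trPoly, ← det_PhiPoly (fun m => (hα m).ne') fun m => (hβ m).ne', map_sub,
      map_pow, map_mul, AlgHom.map_det, ← htrace, sub_eq_zero] at hzero
    simpa using hzero
  obtain ⟨v, hv, hMv⟩ := exists_mulVec_eq_smul_of_trace_sq hdisc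
  have hscale : Complex.normSq (M.trace / 2) = ‖r ^ 2 + 1‖ ^ (2 * k) := by
    rw [Complex.normSq_eq_norm_sq, ← norm_pow, div_pow, hdisc, hdet, ← norm_pow]
    norm_num
  have hlt := lt_diagForm_PhiPoly hk hα hβ hr hr' hv
  rw [hMv, diagForm_smul, hscale] at hlt
  exact lt_irrefl _ hlt

/-! ### Polynomials with prescribed zeros and gaps -/

theorem prod_range_two_mul_add_one_eq_head_mul {M : Type*} [CommMonoid M] (f : ℕ → M) (m : ℕ) :
    ∏ j ∈ Finset.range (2 * m + 1), f j =
      f 0 * ∏ l ∈ Finset.range m, f (2 * l + 1) * f (2 * l + 2) := by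
  induction m with
  | zero => simp
  | succ m ih =>
    rw [show 2 * (m + 1) + 1 = 2 * m + 1 + 1 + 1 by ring, Finset.prod_range_succ,
      Finset.prod_range_succ, ih, Finset.prod_range_succ _ m]
    simp only [mul_assoc]

/-- The zeros of the real polynomial `P` are `0 = x₀ > x₁ > ⋯ > x₂ₘ`, all of them simple, and its
leading coefficient is positive. The values `x j` for `j > 2m` are irrelevant. -/
structure IsSpectralPoly (m : ℕ) (P : ℝ[X]) (x : ℕ → ℝ) : Prop where
  leadingCoeff_pos : 0 < P.leadingCoeff
  eq_C_mul_prod : P = C P.leadingCoeff * ∏ j ∈ Finset.range (2 * m + 1), (X - C (x j))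
  x_zero : x 0 = 0
  x_lt : ∀ i j, i < j → j < 2 * m + 1 → x j < x i

/-- Membership in one of the closed gaps `[x₂ₗ₊₂, x₂ₗ₊₁]`, `l < m`. -/
def InGap (m : ℕ) (x : ℕ → ℝ) (t : ℝ) : Prop :=
  ∃ l < m, t ∈ Set.Icc (x (2 * l + 2)) (x (2 * l + 1))

namespace IsSpectralPoly

variable {m : ℕ} {P : ℝ[X]} {x : ℕ → ℝ} (h : IsSpectralPoly m P x)
include h

theorem x_neg {j : ℕ} (h0 : 0 < j) (hj : j < 2 * m + 1) : x j < 0 :=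
  h.x_zero ▸ h.x_lt 0 j h0 hj

theorem x_nonpos {j : ℕ} (hj : j < 2 * m + 1) : x j ≤ 0 := by
  rcases j.eq_zero_or_pos with rfl | h0
  · exact h.x_zero.le
  · exact (h.x_neg h0 hj).le

theorem lt_of_gap_lt {i j : ℕ} (hij : i < j) (hj : j < m) {s t : ℝ}
    (hs : x (2 * i + 2) ≤ s) (ht : t ≤ x (2 * j + 1)) : t < s :=
  ht.trans_lt ((h.x_lt (2 * i + 2) (2 * j + 1) (by omega) (by omega)).trans_le hs)

theorem ne_of_gap_ne {i j : ℕ} (hi : i < m) (hj : j < m) (hij : i ≠ j) {s t : ℝ}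
    (hs : s ∈ Set.Icc (x (2 * i + 2)) (x (2 * i + 1)))
    (ht : t ∈ Set.Icc (x (2 * j + 2)) (x (2 * j + 1))) : s ≠ t := by
  rcases hij.lt_or_gt with hlt | hlt
  · exact (h.lt_of_gap_lt hlt hj hs.1 ht.2).ne'
  · exact (h.lt_of_gap_lt hlt hi ht.1 hs.2).ne

theorem natDegree_eq : P.natDegree = 2 * m + 1 := by
  rw [h.eq_C_mul_prod, natDegree_C_mul h.leadingCoeff_pos.ne',
    natDegree_prod_of_monic _ _ fun j _ => monic_X_sub_C _]
  simp

theorem aeval_eq {A : Type*} [CommRing A] [Algebra ℝ A] (z : A) :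
    aeval z P = algebraMap ℝ A P.leadingCoeff *
      ∏ j ∈ Finset.range (2 * m + 1), (z - algebraMap ℝ A (x j)) := by
  conv_lhs => rw [h.eq_C_mul_prod]
  simp only [map_mul, map_prod, map_sub, aeval_X, aeval_C]

theorem aeval_ne_zero {z : ℂ} (hz : z.im ≠ 0) : aeval z P ≠ 0 := by
  rw [h.aeval_eq]
  refine mul_ne_zero (Complex.ofReal_ne_zero.2 h.leadingCoeff_pos.ne')
    (Finset.prod_ne_zero_iff.2 fun j _ hj => hz ?_)
  rw [sub_eq_zero.1 hj, Complex.coe_algebraMap, Complex.ofReal_im]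

theorem eval_eq (t : ℝ) : P.eval t = P.leadingCoeff *
    (t * ∏ l ∈ Finset.range m, (t - x (2 * l + 1)) * (t - x (2 * l + 2))) := by
  have heq := h.aeval_eq t
  rw [prod_range_two_mul_add_one_eq_head_mul, h.x_zero, map_zero, sub_zero] at heq
  simpa only [coe_aeval_eq_eval, Algebra.algebraMap_self, RingHom.id_apply] using heq

theorem eval_x {j : ℕ} (hj : j < 2 * m + 1) : P.eval (x j) = 0 := by
  rw [← coe_aeval_eq_eval, h.aeval_eq, Finset.prod_eq_zero (Finset.mem_range.2 hj) (sub_self _),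
    mul_zero]

theorem eval_pos {t : ℝ} (ht : 0 < t) : 0 < P.eval t := by
  rw [h.eval_eq]
  refine mul_pos h.leadingCoeff_pos (mul_pos ht (Finset.prod_pos fun l hl => ?_))
  have hl := Finset.mem_range.1 hl
  exact mul_pos (sub_pos.2 ((h.x_neg (by omega) (by omega)).trans ht))
    (sub_pos.2 ((h.x_neg (by omega) (by omega)).trans ht))

theorem eval_nonneg {t : ℝ} (ht : 0 ≤ t) : 0 ≤ P.eval t := by
  rcases ht.eq_or_lt with rfl | ht
  · rw [h.eval_eq, zero_mul, mul_zero]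
  · exact (h.eval_pos ht).le

theorem eval_neg {t : ℝ} (ht : t < 0) (hgap : ¬ InGap m x t) : P.eval t < 0 := by
  rw [h.eval_eq]
  refine mul_neg_of_pos_of_neg h.leadingCoeff_pos
    (mul_neg_of_neg_of_pos ht (Finset.prod_pos fun l hl => ?_))
  have hl := Finset.mem_range.1 hl
  have hlt := h.x_lt (2 * l + 1) (2 * l + 2) (by omega) (by omega)
  rcases lt_or_ge t (x (2 * l + 2)) with hleft | hleft
  · exact mul_pos_of_neg_of_neg (by linarith) (by linarith)
  · have hright : x (2 * l + 1) < t := not_le.1 fun hle => hgap ⟨l, hl, hleft, hle⟩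
    exact mul_pos (by linarith) (by linarith)

/-- In a gap only the first factor `t` and one factor of the pair belonging to that gap are
negative. -/
theorem eval_pos_of_mem_Ioo {l : ℕ} (hl : l < m) {t : ℝ}
    (ht : t ∈ Set.Ioo (x (2 * l + 2)) (x (2 * l + 1))) : 0 < P.eval t := by
  have htneg : t < 0 := ht.2.trans (h.x_neg (by omega) (by omega))
  have hothers : 0 < ∏ i ∈ (Finset.range m).erase l,
      ((t - x (2 * i + 1)) * (t - x (2 * i + 2))) := by
    refine Finset.prod_pos fun i hi => ?_
    obtain ⟨hne, hi⟩ := Finset.mem_erase.1 hi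
    have hi := Finset.mem_range.1 hi
    have hlt := h.x_lt (2 * i + 1) (2 * i + 2) (by omega) (by omega)
    rcases hne.lt_or_gt with hil | hil
    · have := h.lt_of_gap_lt hil hl le_rfl ht.2.le
      exact mul_pos_of_neg_of_neg (by linarith) (by linarith)
    · have := h.lt_of_gap_lt hil hi ht.1.le le_rfl
      exact mul_pos (by linarith) (by linarith)
  rw [h.eval_eq, ← Finset.mul_prod_erase _ _ (Finset.mem_range.2 hl)]
  exact mul_pos h.leadingCoeff_pos (mul_pos_of_neg_of_neg htneg (mul_neg_of_neg_of_pos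
    (mul_neg_of_neg_of_pos (sub_neg.2 ht.2) (sub_pos.2 ht.1)) hothers))

theorem eval_nonneg_iff {t : ℝ} : 0 ≤ P.eval t ↔ 0 ≤ t ∨ InGap m x t := by
  constructor
  · contrapose!
    exact fun ht => h.eval_neg ht.1 ht.2
  · rintro (ht | ⟨l, hl, hleft, hright⟩)
    · exact h.eval_nonneg ht
    · rcases hleft.eq_or_lt with rfl | hleft
      · exact (h.eval_x (by omega)).ge
      rcases hright.eq_or_lt with rfl | hright
      · exact (h.eval_x (by omega)).ge
      exact (h.eval_pos_of_mem_Ioo hl ⟨hleft, hright⟩).le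

end IsSpectralPoly

/-- The pair `(P, n)` of real polynomials describing the spectral curve `w² = P(z)` together with
the differential `n(z) dz / ((z - 1) w)`: the polynomial `n`, of degree at most `m`, has a zero in
each of the gaps `(x₂ₗ₊₂, x₂ₗ₊₁)` of `P`. The normalization at `1` prescribes the residues
there. -/
structure IsHarnackPair (m : ℕ) (κ : ℝ) (P n : ℝ[X]) (x : ℕ → ℝ) : Prop
    extends IsSpectralPoly m P x where
  kappa_pos : 0 < κ
  natDegree_le : n.natDegree ≤ m
  eval_one : n.eval 1 ^ 2 = κ ^ 2 * P.eval 1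
  exists_isRoot : ∀ l < m, ∃ c ∈ Set.Ioo (x (2 * l + 2)) (x (2 * l + 1)), n.IsRoot c

namespace IsHarnackPair

variable {m : ℕ} {κ : ℝ} {P n : ℝ[X]} {x : ℕ → ℝ} (h : IsHarnackPair m κ P n x)
include h

theorem n_ne_zero : n ≠ 0 := by
  rintro rfl
  have hpos : 0 < κ ^ 2 * P.eval 1 := mul_pos (pow_pos h.kappa_pos 2) (h.eval_pos one_pos)
  rw [← h.eval_one, eval_zero, zero_pow two_ne_zero] at hpos
  exact hpos.false

/-- The `m` gaps already contain as many zeros as the degree of `n` allows. -/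
theorem exists_mem_gap_of_isRoot {t : ℝ} (ht : n.IsRoot t) :
    ∃ l < m, t ∈ Set.Ioo (x (2 * l + 2)) (x (2 * l + 1)) := by
  by_contra! houtside
  choose! c hc hroot using h.exists_isRoot
  have hinj : Set.InjOn c (Finset.range m) := by
    intro i hi j hj
    contrapose!
    exact fun hij => h.ne_of_gap_ne (Finset.mem_range.1 hi) (Finset.mem_range.1 hj) hij
      (Set.Ioo_subset_Icc_self (hc i (Finset.mem_range.1 hi)))
      (Set.Ioo_subset_Icc_self (hc j (Finset.mem_range.1 hj)))
  have hnew : t ∉ (Finset.range m).image c := by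
    intro hmem
    obtain ⟨l, hl, rfl⟩ := Finset.mem_image.1 hmem
    exact houtside l (Finset.mem_range.1 hl) (hc l (Finset.mem_range.1 hl))
  have hsubset : insert t ((Finset.range m).image c) ⊆ n.roots.toFinset := by
    refine Finset.insert_subset ?_ (Finset.image_subset_iff.2 fun l hl => ?_)
    · exact Multiset.mem_toFinset.2 ((mem_roots h.n_ne_zero).2 ht)
    · exact Multiset.mem_toFinset.2 ((mem_roots h.n_ne_zero).2 (hroot l (Finset.mem_range.1 hl)))
  have hcard := (Finset.card_le_card hsubset).trans
    ((Multiset.toFinset_card_le n.roots).trans (card_roots' n))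
  rw [Finset.card_insert_of_notMem hnew, Finset.card_image_of_injOn hinj,
    Finset.card_range] at hcard
  exact absurd h.natDegree_le (by omega)

theorem n_eval_ne_zero {t : ℝ} (ht : P.eval t ≤ 0) : n.eval t ≠ 0 := by
  intro hroot
  obtain ⟨l, hl, hmem⟩ := h.exists_mem_gap_of_isRoot hroot
  exact absurd (h.eval_pos_of_mem_Ioo hl hmem) ht.not_gt

end IsHarnackPair

/-! ### The zeros of the critical polynomial -/

theorem exists_mul_X_sub_C_dvd_of_eval_nonpos {Q : ℝ[X]} {u v c : ℝ} (hc : c ∈ Set.Ioo u v)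
    (hu : 0 < Q.eval u) (hv : 0 < Q.eval v) (hQc : Q.eval c ≤ 0) :
    ∃ r ∈ Set.Ioo u v, ∃ s ∈ Set.Ioo u v, (X - C r) * (X - C s) ∣ Q := by
  obtain ⟨r, ⟨hur, hrc⟩, hr⟩ :=
    intermediate_value_Icc' hc.1.le Q.continuousOn ⟨hQc, hu.le⟩
  have hur : u < r := hur.lt_of_ne (by rintro rfl; exact hu.ne' hr)
  have hrv : r < v := hrc.trans_lt hc.2
  obtain ⟨S, hS⟩ := dvd_iff_isRoot.2 hr
  simp only [hS, eval_mul, eval_sub, eval_X, eval_C] at hu hv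
  have hSu : S.eval u < 0 := neg_of_mul_pos_right hu (sub_neg.2 hur).le
  have hSv : 0 < S.eval v := pos_of_mul_pos_right hv (sub_pos.2 hrv).le
  obtain ⟨s, ⟨hus, hsv⟩, hs⟩ :=
    intermediate_value_Icc (hc.1.trans hc.2).le S.continuousOn ⟨hSu.le, hSv.le⟩
  refine ⟨r, ⟨hur, hrv⟩, s, ⟨hus.lt_of_ne ?_, hsv.lt_of_ne ?_⟩, ?_⟩
  · rintro rfl; exact hSu.ne hs
  · rintro rfl; exact hSv.ne' hs
  · exact hS ▸ mul_dvd_mul_left _ (dvd_iff_isRoot.2 hs)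

/-- The monic real quadratic with zeros `z` and `conj z`. -/
def conjQuadratic (z : ℂ) : ℝ[X] := X ^ 2 - C (2 * z.re) * X + C (‖z‖ ^ 2)

theorem aeval_conjQuadratic (z u : ℂ) : aeval u (conjQuadratic z) = (u - z) * (u - conj z) := by
  have hsum := Complex.add_conj z
  have hprod := Complex.mul_conj' z
  simp only [conjQuadratic, map_add, map_sub, map_mul, map_pow, aeval_X, aeval_C,
    Complex.coe_algebraMap]
  push_cast at hsum ⊢
  linear_combination u * hsum - hprod

theorem aeval_derivative_conjQuadratic (z : ℂ) :
    aeval z (derivative (conjQuadratic z)) = z - conj z := by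
  have hderiv : derivative (conjQuadratic z) = C 2 * X - C (2 * z.re) := by
    rw [conjQuadratic, derivative_add, derivative_sub, derivative_X_sq, derivative_C_mul_X,
      derivative_C, add_zero]
  have hsum := Complex.add_conj z
  rw [hderiv, map_sub, map_mul, aeval_X, aeval_C, aeval_C, Complex.coe_algebraMap, ← hsum]
  push_cast
  ring

theorem eval_conjQuadratic_ne_zero {z : ℂ} (hz : z.im ≠ 0) (t : ℝ) :
    (conjQuadratic z).eval t ≠ 0 := by
  have hsq : (conjQuadratic z).eval t = (t - z.re) ^ 2 + z.im ^ 2 := by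
    simp only [conjQuadratic, eval_add, eval_sub, eval_mul, eval_pow, eval_C, eval_X,
      Complex.sq_norm, Complex.normSq_apply]
    ring
  rw [hsq]
  positivity

theorem monic_conjQuadratic (z : ℂ) : (conjQuadratic z).Monic := by
  rw [conjQuadratic]
  monicity!

theorem natDegree_conjQuadratic (z : ℂ) : (conjQuadratic z).natDegree = 2 := by
  rw [conjQuadratic]
  compute_degree!

/-- A point `(z, w)` of the curve `w² = P(z)` with `κ (a z - b) w = 2 c z n(z)` has `z = 0` or
`z` a zero of this polynomial, obtained by squaring and dividing by `z`. Division by `X` is exact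
when `P` vanishes at `0`. -/
def critPoly (κ : ℝ) (P n : ℝ[X]) (a b c : ℝ) : ℝ[X] :=
  C (κ ^ 2) * (C a * X - C b) ^ 2 * P.divX - C (4 * c ^ 2) * X * n ^ 2

theorem eval_critPoly (κ : ℝ) (P n : ℝ[X]) (a b c t : ℝ) :
    (critPoly κ P n a b c).eval t =
      κ ^ 2 * (a * t - b) ^ 2 * P.divX.eval t - 4 * c ^ 2 * t * n.eval t ^ 2 := by
  simp only [critPoly, eval_sub, eval_mul, eval_pow, eval_C, eval_X]

namespace IsSpectralPoly

variable {m : ℕ} {P : ℝ[X]} {x : ℕ → ℝ} (h : IsSpectralPoly m P x)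
include h

theorem X_mul_divX : X * P.divX = P := by
  have hcoeff : P.coeff 0 = 0 := by
    rw [coeff_zero_eq_eval_zero]
    exact h.x_zero ▸ h.eval_x (j := 0) (by omega)
  simpa only [hcoeff, C_0, add_zero] using P.X_mul_divX_add

theorem mul_eval_divX (t : ℝ) : t * P.divX.eval t = P.eval t := by
  conv_rhs => rw [← h.X_mul_divX, eval_mul, eval_X]

theorem X_mul_critPoly (κ : ℝ) (n : ℝ[X]) (a b c : ℝ) : X * critPoly κ P n a b c =
    C (κ ^ 2) * (C a * X - C b) ^ 2 * P - C (4 * c ^ 2) * (X * n) ^ 2 := by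
  rw [critPoly]
  linear_combination C (κ ^ 2) * (C a * X - C b) ^ 2 * h.X_mul_divX

theorem eval_divX_nonneg {t : ℝ} (ht : 0 ≤ t) : 0 ≤ P.divX.eval t := by
  have hpos : ∀ᶠ s in 𝓝[>] t, 0 ≤ P.divX.eval s := by
    filter_upwards [self_mem_nhdsWithin] with s hs
    have hs0 : 0 < s := ht.trans_lt hs
    exact (pos_of_mul_pos_right (h.mul_eval_divX s ▸ h.eval_pos hs0) hs0.le).le
  exact ge_of_tendsto (P.divX.continuous.tendsto t |>.mono_left nhdsWithin_le_nhds) hpos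

theorem natDegree_divX : P.divX.natDegree = 2 * m := by
  rw [natDegree_divX_eq_natDegree_tsub_one, h.natDegree_eq, Nat.add_sub_cancel]

theorem exists_eval_neg : ∃ t < 0, P.eval t < 0 := by
  have hlast := h.x_nonpos (j := 2 * m) (by omega)
  refine ⟨x (2 * m) - 1, by linarith, h.eval_neg (by linarith) ?_⟩
  rintro ⟨l, hl, hleft, -⟩
  have hanti : x (2 * m) ≤ x (2 * l + 2) := by
    rcases (show 2 * l + 2 ≤ 2 * m by omega).eq_or_lt with heq | hlt
    · rw [heq]
    · exact (h.x_lt _ _ hlt (by omega)).le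
  linarith

end IsSpectralPoly

namespace IsHarnackPair

variable {m : ℕ} {κ : ℝ} {P n : ℝ[X]} {x : ℕ → ℝ} (h : IsHarnackPair m κ P n x)
include h

theorem critPoly_eval_pos_of_eval_nonpos {a b c t : ℝ} (hc : c ≠ 0) (ht : t < 0)
    (hP : P.eval t ≤ 0) : 0 < (critPoly κ P n a b c).eval t := by
  have hn := h.n_eval_ne_zero hP
  have hdivX : 0 ≤ P.divX.eval t := by
    rw [← h.mul_eval_divX] at hP
    exact nonneg_of_mul_nonpos_right hP ht
  have hfirst : 0 ≤ κ ^ 2 * (a * t - b) ^ 2 * P.divX.eval t := by positivity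
  have hsecond : t * (4 * c ^ 2 * n.eval t ^ 2) < 0 := mul_neg_of_neg_of_pos ht (by positivity)
  rw [eval_critPoly]
  linarith

theorem critPoly_ne_zero {a b c : ℝ} (hc : c ≠ 0) : critPoly κ P n a b c ≠ 0 := by
  obtain ⟨t, ht, hP⟩ := h.exists_eval_neg
  intro hzero
  simpa only [hzero, eval_zero, lt_irrefl] using
    h.critPoly_eval_pos_of_eval_nonpos (a := a) (b := b) hc ht hP.le

theorem natDegree_critPoly_le {a b : ℝ} (c : ℝ) {d : ℕ}
    (hd : (C a * X - C b : ℝ[X]).natDegree ≤ d) :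
    (critPoly κ P n a b c).natDegree ≤ max (2 * d + 2 * m) (2 * m + 1) := by
  refine (natDegree_sub_le _ _).trans (max_le_max ?_ ?_)
  · refine natDegree_mul_le_of_le ((natDegree_C_mul_le _ _).trans ?_) h.natDegree_divX.le
    exact natDegree_pow_le_of_le 2 hd
  · refine (natDegree_mul_le_of_le ((natDegree_C_mul_le _ _).trans natDegree_X_le)
      (natDegree_pow_le_of_le 2 h.natDegree_le)).trans ?_
    omega

theorem exists_gap_factor_dvd_critPoly {a b c : ℝ} (hc : c ≠ 0) {l : ℕ} (hl : l < m) :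
    ∃ r ∈ Set.Ioo (x (2 * l + 2)) (x (2 * l + 1)), ∃ s ∈ Set.Ioo (x (2 * l + 2)) (x (2 * l + 1)),
      (X - C r) * (X - C s) ∣ critPoly κ P n a b c := by
  have hend : ∀ j, 0 < j → j < 2 * m + 1 → 0 < (critPoly κ P n a b c).eval (x j) :=
    fun j hj0 hj => h.critPoly_eval_pos_of_eval_nonpos hc (h.x_neg hj0 hj) (h.eval_x hj).le
  obtain ⟨t, ht, hroot⟩ := h.exists_isRoot l hl
  refine exists_mul_X_sub_C_dvd_of_eval_nonpos ht (hend _ (by omega) (by omega))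
    (hend _ (by omega) (by omega)) ?_
  have htneg : t < 0 := ht.2.trans (h.x_neg (by omega) (by omega))
  have hP := h.eval_pos_of_mem_Ioo hl ht
  rw [← h.mul_eval_divX] at hP
  rw [eval_critPoly, hroot.eq_zero, zero_pow two_ne_zero, mul_zero, sub_zero]
  exact mul_nonpos_of_nonneg_of_nonpos (by positivity) (neg_of_mul_pos_right hP htneg.le).le

theorem exists_monic_dvd_critPoly (a b : ℝ) {c : ℝ} (hc : c ≠ 0) :
    ∃ W : ℝ[X], W.Monic ∧ W.natDegree = 2 * m ∧ W ∣ critPoly κ P n a b c ∧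
      ∀ z : ℂ, aeval z W = 0 → ∃ t < 0, z = (t : ℝ) := by
  choose! r hr s hs hdvd using
    fun l (hl : l < m) => h.exists_gap_factor_dvd_critPoly (a := a) (b := b) hc hl
  have hmonic : ∀ l ∈ Finset.range m, ((X - C (r l)) * (X - C (s l))).Monic :=
    fun l _ => (monic_X_sub_C _).mul (monic_X_sub_C _)
  have hneg : ∀ l < m, ∀ t ∈ Set.Ioo (x (2 * l + 2)) (x (2 * l + 1)), t < 0 :=
    fun l hl t ht => ht.2.trans (h.x_neg (by omega) (by omega))
  have hcoprime : ∀ i < m, ∀ j < m, i ≠ j → ∀ u ∈ Set.Ioo (x (2 * i + 2)) (x (2 * i + 1)),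
      ∀ v ∈ Set.Ioo (x (2 * j + 2)) (x (2 * j + 1)), IsCoprime (X - C u) (X - C v : ℝ[X]) :=
    fun i hi j hj hij u hu v hv => isCoprime_X_sub_C_of_isUnit_sub (sub_ne_zero.2
      (h.ne_of_gap_ne hi hj hij (Set.Ioo_subset_Icc_self hu) (Set.Ioo_subset_Icc_self hv))).isUnit
  refine ⟨∏ l ∈ Finset.range m, (X - C (r l)) * (X - C (s l)), monic_prod_of_monic _ _ hmonic,
    ?_, ?_, ?_⟩
  · rw [natDegree_prod_of_monic _ _ hmonic]
    simp [natDegree_mul (X_sub_C_ne_zero _) (X_sub_C_ne_zero _), mul_comm]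
  · refine Finset.prod_dvd_of_coprime ?_ fun l hl => hdvd l (Finset.mem_range.1 hl)
    intro i hi j hj hij
    have hi := Finset.mem_range.1 hi
    have hj := Finset.mem_range.1 hj
    exact .mul_left
      (.mul_right (hcoprime i hi j hj hij _ (hr i hi) _ (hr j hj))
        (hcoprime i hi j hj hij _ (hr i hi) _ (hs j hj)))
      (.mul_right (hcoprime i hi j hj hij _ (hs i hi) _ (hr j hj))
        (hcoprime i hi j hj hij _ (hs i hi) _ (hs j hj)))
  · intro z hz
    rw [map_prod, Finset.prod_eq_zero_iff] at hz
    obtain ⟨l, hl, hz⟩ := hz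
    have hl := Finset.mem_range.1 hl
    simp only [map_mul, map_sub, aeval_X, aeval_C, Complex.coe_algebraMap, mul_eq_zero,
      sub_eq_zero] at hz
    rcases hz with hz | hz
    · exact ⟨r l, hneg l hl _ (hr l hl), hz⟩
    · exact ⟨s l, hneg l hl _ (hs l hl), hz⟩

variable {a b c : ℝ} (hc : c ≠ 0) {z : ℂ} (hz : z.im ≠ 0)
  (hroot : aeval z (critPoly κ P n a b c) = 0)
include hc hz hroot

/-- The gaps account for `2m` zeros, and a non-real zero and its conjugate for the remaining
two. -/
theorem exists_critPoly_eq_mul_conjQuadratic : ∃ W : ℝ[X], W.natDegree = 2 * m ∧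
    (∀ u : ℂ, aeval u W = 0 → ∃ t < 0, u = (t : ℝ)) ∧ ∃ s ≠ 0,
      critPoly κ P n a b c = W * (conjQuadratic z * C s) := by
  obtain ⟨W, hmonic, hdeg, ⟨S, hS⟩, hW⟩ := h.exists_monic_dvd_critPoly a b hc
  have hne := h.critPoly_ne_zero (a := a) (b := b) hc
  have hS0 : S ≠ 0 := by
    rintro rfl
    exact hne (hS.trans (mul_zero W))
  have hWz : aeval z W ≠ 0 := by
    intro hzero
    obtain ⟨t, -, rfl⟩ := hW z hzero
    exact hz (Complex.ofReal_im t)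
  have hSz : aeval z S = 0 := by
    rw [hS, map_mul] at hroot
    exact (mul_eq_zero.1 hroot).resolve_left hWz
  have hSdeg : S.natDegree ≤ 2 := by
    have hle := h.natDegree_critPoly_le (a := a) (b := b) c (d := 1)
      (natDegree_sub_C.trans_le ((natDegree_C_mul_le _ _).trans natDegree_X_le))
    rw [hS, natDegree_mul hmonic.ne_zero hS0, hdeg] at hle
    omega
  have hS_eq := eq_mul_leadingCoeff_of_monic_of_dvd_of_natDegree_le (monic_conjQuadratic z)
    (S.quadratic_dvd_of_aeval_eq_zero_im_ne_zero hSz hz)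
    (hSdeg.trans_eq (natDegree_conjQuadratic z).symm)
  exact ⟨W, hdeg, hW, S.leadingCoeff, leadingCoeff_ne_zero.2 hS0, by rw [hS, ← hS_eq]⟩

theorem fst_coeff_ne_zero_of_critPoly_nonreal_root : a ≠ 0 := by
  rintro rfl
  obtain ⟨W, hdeg, hW, s, hs, heq⟩ := h.exists_critPoly_eq_mul_conjQuadratic hc hz hroot
  have hle := h.natDegree_critPoly_le (a := 0) (b := b) c (d := 0) (by simp)
  have hW0 : W ≠ 0 := by
    rintro rfl
    exact h.critPoly_ne_zero hc (heq.trans (zero_mul _))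
  have hD0 := (monic_conjQuadratic z).ne_zero
  rw [heq, natDegree_mul hW0 (mul_ne_zero hD0 (C_ne_zero.2 hs)), hdeg, natDegree_mul_C hs,
    natDegree_conjQuadratic] at hle
  omega

theorem critPoly_eval_pos_of_nonreal_root {t : ℝ} (ht : 0 ≤ t) :
    0 < (critPoly κ P n a b c).eval t := by
  have hne : ∀ u : ℝ, 0 ≤ u → (critPoly κ P n a b c).eval u ≠ 0 := by
    obtain ⟨W, -, hW, s, hs, heq⟩ := h.exists_critPoly_eq_mul_conjQuadratic hc hz hroot
    intro u hu
    rw [heq, eval_mul, eval_mul, eval_C]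
    refine mul_ne_zero (fun hzero => ?_) (mul_ne_zero (eval_conjQuadratic_ne_zero hz u) hs)
    have hzeroC : aeval (u : ℂ) W = 0 :=
      (aeval_ofReal (K := ℂ) W u).trans (Complex.ofReal_eq_zero.2 hzero)
    obtain ⟨v, hv, huv⟩ := hW u hzeroC
    exact (hv.trans_le hu).ne' (Complex.ofReal_injective huv)
  have hzero : 0 < (critPoly κ P n a b c).eval 0 := by
    refine lt_of_le_of_ne ?_ (hne 0 le_rfl).symm
    rw [eval_critPoly, mul_zero (4 * c ^ 2), zero_mul, sub_zero]
    exact mul_nonneg (by positivity) (h.eval_divX_nonneg le_rfl)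
  by_contra! hnonpos
  obtain ⟨u, hu, hu0⟩ := intermediate_value_Icc' ht (critPoly κ P n a b c).continuousOn
    ⟨hnonpos, hzero.le⟩
  exact hne u hu.1 hu0

theorem mul_neg_of_critPoly_nonreal_root : a * b < 0 := by
  have ha := h.fst_coeff_ne_zero_of_critPoly_nonreal_root hc hz hroot
  by_contra! hab
  have hba : 0 ≤ b / a := by
    rw [show b / a = a * b / a ^ 2 by field_simp]
    positivity
  have hpos := h.critPoly_eval_pos_of_nonreal_root hc hz hroot hba
  rw [eval_critPoly, mul_div_cancel₀ _ ha] at hpos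
  have hsq : 0 ≤ 4 * c ^ 2 * (b / a) * n.eval (b / a) ^ 2 := by positivity
  linarith

theorem four_mul_sq_lt_of_critPoly_nonreal_root : 4 * c ^ 2 < (a - b) ^ 2 := by
  have hpos := h.critPoly_eval_pos_of_nonreal_root hc hz hroot zero_le_one
  have hP : 0 < κ ^ 2 * P.eval 1 := mul_pos (pow_pos h.kappa_pos 2) (h.eval_pos one_pos)
  have hdivX := h.mul_eval_divX 1
  rw [one_mul] at hdivX
  rw [eval_critPoly, h.eval_one, hdivX] at hpos
  have hmul : 0 < (κ ^ 2 * P.eval 1) * ((a - b) ^ 2 - 4 * c ^ 2) := by linarith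
  exact sub_pos.1 (pos_of_mul_pos_right hmul hP.le)

theorem aeval_derivative_critPoly_ne_zero :
    aeval z (derivative (critPoly κ P n a b c)) ≠ 0 := by
  obtain ⟨W, -, hW, s, hs, heq⟩ := h.exists_critPoly_eq_mul_conjQuadratic hc hz hroot
  have hWz : aeval z W ≠ 0 := by
    intro hzero
    obtain ⟨t, -, rfl⟩ := hW z hzero
    exact hz (Complex.ofReal_im t)
  have hDz : aeval z (conjQuadratic z) = 0 := by
    rw [aeval_conjQuadratic, sub_self, zero_mul]
  rw [heq]
  simp only [derivative_mul, derivative_C, map_add, map_mul, hDz,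
    aeval_derivative_conjQuadratic, zero_mul, mul_zero,
    zero_add, add_zero, aeval_C, Complex.coe_algebraMap]
  refine mul_ne_zero hWz (mul_ne_zero ?_ (Complex.ofReal_ne_zero.2 hs))
  exact sub_ne_zero.2 fun heq => hz (Complex.conj_eq_iff_im.1 heq.symm)

theorem eq_or_eq_conj_of_critPoly_nonreal_root {u : ℂ} (hu : u.im ≠ 0)
    (hroot' : aeval u (critPoly κ P n a b c) = 0) : u = z ∨ u = conj z := by
  obtain ⟨W, -, hW, s, hs, heq⟩ := h.exists_critPoly_eq_mul_conjQuadratic hc hz hroot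
  rw [heq, map_mul, map_mul, aeval_C, aeval_conjQuadratic, Complex.coe_algebraMap] at hroot'
  rcases mul_eq_zero.1 hroot' with hzero | hzero
  · obtain ⟨t, -, rfl⟩ := hW u hzero
    exact absurd (Complex.ofReal_im t) hu
  · simpa only [mul_eq_zero, sub_eq_zero, Complex.ofReal_eq_zero, hs, or_false] using hzero

end IsHarnackPair

/-! ### The critical point equation on the curve -/

/-- The affine curve `w² = P(z)` without its real points. -/
def nonrealCurve (P : ℝ[X]) : Set (ℂ × ℂ) :=
  {S | S.2 ^ 2 = aeval S.1 P ∧ (S.1.im ≠ 0 ∨ S.2.im ≠ 0)}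

/-- The equation `z dF/dz = 0` for `v = (χ, η)` at a point `S = (z, w)` of the curve, cleared of
denominators; `n` is a constant multiple of the numerator of `w (z - 1) dlog ρ/dz`. -/
def CritEq (κ : ℝ) (n : ℝ[X]) (v : ℝ × ℝ) (S : ℂ × ℂ) : Prop :=
  (κ : ℂ) * ((v.2 - 1) * S.1 - (v.2 + 1)) * S.2 = 2 * v.1 * S.1 * aeval S.1 n

/-- The logarithmic derivative `z d(log ρ)/dz`, up to a constant factor. -/
def logDer (n : ℝ[X]) (S : ℂ × ℂ) : ℂ := S.1 * aeval S.1 n / ((S.1 - 1) * S.2)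

/-- The solution `(χ, η)` of the critical point equation at a given point of the curve. -/
def critParam (κ : ℝ) (n : ℝ[X]) (S : ℂ × ℂ) : ℝ × ℝ :=
  (-κ * ((S.1 + 1) / (S.1 - 1)).im / (2 * (logDer n S).im),
    ((S.1 + 1) / (S.1 - 1)).re -
      ((S.1 + 1) / (S.1 - 1)).im / (logDer n S).im * (logDer n S).re)

/-- The Jacobian determinant, in the variables `(z, w)`, of the system formed by `w² = P(z)` and
`CritEq`. -/
def critJacobian (κ : ℝ) (P n : ℝ[X]) (v : ℝ × ℝ) (S : ℂ × ℂ) : ℂ :=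
  aeval S.1 (derivative P) * (κ * ((v.2 - 1) * S.1 - (v.2 + 1))) +
    2 * S.2 * (κ * (v.2 - 1) * S.2 - 2 * v.1 * (aeval S.1 n + S.1 * aeval S.1 (derivative n)))

theorem aeval_complex_ofReal (p : ℝ[X]) (t : ℝ) : aeval (t : ℂ) p = ((p.eval t : ℝ) : ℂ) :=
  aeval_ofReal (K := ℂ) p t

theorem logDer_conj (n : ℝ[X]) (S : ℂ × ℂ) :
    logDer n (conj S.1, conj S.2) = conj (logDer n S) := by
  simp [logDer, aeval_conj]

theorem CritEq.conj {κ : ℝ} {n : ℝ[X]} {v : ℝ × ℝ} {S : ℂ × ℂ} (hv : CritEq κ n v S) :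
    CritEq κ n v (conj S.1, conj S.2) := by
  simpa [CritEq, aeval_conj, map_ofNat] using congrArg (starRingEnd ℂ) hv

section critParam

variable {κ : ℝ} {n : ℝ[X]} {S : ℂ × ℂ}

theorem critEq_iff_logDer (hz : S.1 ≠ 1) (hw : S.2 ≠ 0) (v : ℝ × ℝ) :
    CritEq κ n v S ↔ (κ : ℂ) * v.2 = κ * ((S.1 + 1) / (S.1 - 1)) + 2 * v.1 * logDer n S := by
  have hz' : S.1 - 1 ≠ 0 := sub_ne_zero.2 hz
  rw [CritEq, logDer]
  field_simp
  constructor <;> intro hv <;> linear_combination hv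

theorem ofReal_mul_eq_add_iff (hκ : κ ≠ 0) {y Y : ℂ} (hY : Y.im ≠ 0) (a b : ℝ) :
    (κ : ℂ) * b = κ * y + 2 * a * Y ↔
      a = -κ * y.im / (2 * Y.im) ∧ b = y.re - y.im / Y.im * Y.re := by
  have hreal : (κ : ℂ) * b = κ * y + 2 * a * Y ↔
      κ * b = κ * y.re + 2 * a * Y.re ∧ 0 = κ * y.im + 2 * a * Y.im := by
    simp [Complex.ext_iff]
  rw [hreal]
  constructor
  · rintro ⟨hre, him⟩
    have ha : a = -κ * y.im / (2 * Y.im) := by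
      field_simp
      linarith
    refine ⟨ha, mul_left_cancel₀ hκ ?_⟩
    rw [hre, ha]
    field_simp
    ring
  · rintro ⟨rfl, rfl⟩
    constructor <;> field_simp <;> ring

theorem critEq_iff_eq_critParam (hκ : κ ≠ 0) (hz : S.1 ≠ 1) (hw : S.2 ≠ 0)
    (hY : (logDer n S).im ≠ 0) (v : ℝ × ℝ) : CritEq κ n v S ↔ v = critParam κ n S := by
  rw [critEq_iff_logDer hz hw, ofReal_mul_eq_add_iff hκ hY, critParam, Prod.ext_iff]

end critParam

theorem exists_eq_of_mem_nonrealCurve {P : ℝ[X]} {S : ℂ × ℂ} (hS : S ∈ nonrealCurve P)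
    (hz : S.1.im = 0) :
    ∃ t s : ℝ, P.eval t < 0 ∧ s ≠ 0 ∧ S = (↑t, s * Complex.I) := by
  obtain ⟨hsq, hnonreal⟩ := hS
  have hw : S.2.im ≠ 0 := hnonreal.resolve_left (not_not.2 hz)
  have hzre : S.1 = (S.1.re : ℂ) := Complex.ext rfl hz
  rw [hzre, aeval_complex_ofReal] at hsq
  have hre : S.2.re * S.2.re - S.2.im * S.2.im = P.eval S.1.re := by
    simpa [sq] using congrArg Complex.re hsq
  have him : S.2.re * S.2.im + S.2.im * S.2.re = 0 := by
    simpa [sq] using congrArg Complex.im hsq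
  have hwre : S.2.re = 0 := by
    refine (mul_eq_zero.1 (?_ : S.2.re * S.2.im = 0)).resolve_right hw
    linarith
  refine ⟨S.1.re, S.2.im, ?_, hw, Prod.ext hzre (Complex.ext ?_ ?_)⟩
  · rw [← hre, hwre]
    nlinarith [mul_self_pos.2 hw]
  · simp [hwre]
  · simp

theorem eq_or_eq_conj_of_mem_nonrealCurve {P : ℝ[X]} {S S' : ℂ × ℂ}
    (hS : S ∈ nonrealCurve P) (hS' : S' ∈ nonrealCurve P) (hz : S.1.im = 0) (hfst : S'.1 = S.1) :
    S' = S ∨ S' = (conj S.1, conj S.2) := by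
  obtain ⟨t, s, -, -, rfl⟩ := exists_eq_of_mem_nonrealCurve hS hz
  have hsq : S'.2 ^ 2 = (s * Complex.I) ^ 2 := by rw [hS'.1, hfst, ← hS.1]
  refine (sq_eq_sq_iff_eq_or_eq_neg.1 hsq).imp (Prod.ext hfst) fun hsnd => Prod.ext ?_ ?_
  · simpa using hfst
  · simpa using hsnd

theorem sub_one_mul_sub_add_one_ne_zero {z : ℂ} (hz : z.im ≠ 0) (b : ℝ) :
    ((b : ℂ) - 1) * z - (b + 1) ≠ 0 := by
  intro hzero
  have him : (b - 1) * z.im = 0 := by simpa using congrArg Complex.im hzero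
  have hb : b = 1 := sub_eq_zero.1 ((mul_eq_zero.1 him).resolve_right hz)
  norm_num [hb] at hzero

namespace IsSpectralPoly

variable {m : ℕ} {P : ℝ[X]} {x : ℕ → ℝ} (h : IsSpectralPoly m P x) {S : ℂ × ℂ}
include h

theorem neg_of_eval_neg {t : ℝ} (ht : P.eval t < 0) : t < 0 := by
  by_contra! hnonneg
  exact ht.not_ge (h.eval_nonneg hnonneg)

theorem fst_ne_of_nonneg (hS : S ∈ nonrealCurve P) {t : ℝ} (ht : 0 ≤ t) : S.1 ≠ t := by
  intro hz
  obtain ⟨s, _, hs, -, rfl⟩ := exists_eq_of_mem_nonrealCurve hS (by simp [hz])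
  exact (h.neg_of_eval_neg hs).not_ge (Complex.ofReal_injective hz ▸ ht)

theorem fst_ne_zero (hS : S ∈ nonrealCurve P) : S.1 ≠ 0 := by
  exact_mod_cast h.fst_ne_of_nonneg hS le_rfl

theorem fst_ne_one (hS : S ∈ nonrealCurve P) : S.1 ≠ 1 := by
  exact_mod_cast h.fst_ne_of_nonneg hS zero_le_one

theorem snd_ne_zero (hS : S ∈ nonrealCurve P) : S.2 ≠ 0 := by
  intro hw
  by_cases hz : S.1.im = 0
  · exact hS.2.elim (absurd hz) (absurd (by simp [hw]))
  · exact h.aeval_ne_zero hz (by rw [← hS.1, hw, zero_pow two_ne_zero])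

theorem aeval_critPoly_eq_zero {κ a b c : ℝ} {n : ℝ[X]} {z w : ℂ}
    (hsq : w ^ 2 = aeval z P) (hz : z ≠ 0)
    (heq : (κ : ℂ) * (a * z - b) * w = 2 * c * z * aeval z n) :
    aeval z (critPoly κ P n a b c) = 0 := by
  have hmul := congrArg (aeval z) (h.X_mul_critPoly κ n a b c)
  simp only [map_mul, map_sub, map_pow, aeval_X, aeval_C, Complex.coe_algebraMap] at hmul
  refine (mul_eq_zero.1 (hmul.trans ?_)).resolve_left hz
  rw [← hsq]
  push_cast
  linear_combination (κ * (a * z - b) * w + 2 * c * z * aeval z n) * heq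

end IsSpectralPoly

namespace IsHarnackPair

variable {m : ℕ} {κ : ℝ} {P n : ℝ[X]} {x : ℕ → ℝ} (h : IsHarnackPair m κ P n x)
include h

variable {S S' : ℂ × ℂ} {v : ℝ × ℝ}

theorem aeval_critPoly_eq_zero_of_critEq (hS : S ∈ nonrealCurve P) (hv : CritEq κ n v S) :
    aeval S.1 (critPoly κ P n (v.2 - 1) (v.2 + 1) v.1) = 0 :=
  h.aeval_critPoly_eq_zero hS.1 (h.fst_ne_zero hS) (by push_cast; exact hv)

theorem critEq_ofReal_iff {t s : ℝ} (ht : P.eval t < 0) (hs : s ≠ 0) :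
    CritEq κ n v (↑t, s * Complex.I) ↔ v.1 = 0 ∧ (v.2 - 1) * t - (v.2 + 1) = 0 := by
  have hreal : CritEq κ n v (↑t, s * Complex.I) ↔
      2 * v.1 * t * n.eval t = 0 ∧ κ * ((v.2 - 1) * t - (v.2 + 1)) * s = 0 := by
    simp only [CritEq, aeval_complex_ofReal]
    rw [Complex.ext_iff]
    simp
  simp [hreal, h.kappa_pos.ne', hs, (h.neg_of_eval_neg ht).ne, h.n_eval_ne_zero ht.le]

theorem logDer_im_ne_zero (hS : S ∈ nonrealCurve P) : (logDer n S).im ≠ 0 := by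
  intro him
  obtain ⟨y, hy⟩ : ∃ y : ℝ, logDer n S = y := ⟨_, Complex.ext rfl him⟩
  rw [logDer, div_eq_iff (mul_ne_zero (sub_ne_zero.2 (h.fst_ne_one hS)) (h.snd_ne_zero hS))] at hy
  by_cases hz : S.1.im = 0
  · obtain ⟨t, s, ht, -, rfl⟩ := exists_eq_of_mem_nonrealCurve hS hz
    rw [aeval_complex_ofReal] at hy
    have hre : t * n.eval t = 0 := by simpa using congrArg Complex.re hy
    exact mul_ne_zero (h.neg_of_eval_neg ht).ne (h.n_eval_ne_zero ht.le) hre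
  · have hκ : (κ : ℂ) ≠ 0 := Complex.ofReal_ne_zero.2 h.kappa_pos.ne'
    have hroot : aeval S.1 (critPoly κ P n (y / κ) (y / κ) (1 / 2)) = 0 := by
      refine h.aeval_critPoly_eq_zero hS.1 (h.fst_ne_zero hS) ?_
      push_cast
      field_simp
      linear_combination -hy
    have hneg := h.mul_neg_of_critPoly_nonreal_root (by norm_num) hz hroot
    exact hneg.not_ge (mul_self_nonneg _)

theorem critEq_iff (hS : S ∈ nonrealCurve P) : CritEq κ n v S ↔ v = critParam κ n S :=
  critEq_iff_eq_critParam h.kappa_pos.ne' (h.fst_ne_one hS) (h.snd_ne_zero hS)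
    (h.logDer_im_ne_zero hS) v

theorem fst_eq_zero_iff_of_critEq (hS : S ∈ nonrealCurve P) (hv : CritEq κ n v S) :
    v.1 = 0 ↔ S.1.im = 0 := by
  constructor
  · intro hχ
    by_contra hz
    simp only [CritEq, hχ, Complex.ofReal_zero, mul_zero, zero_mul] at hv
    exact mul_ne_zero (mul_ne_zero (Complex.ofReal_ne_zero.2 h.kappa_pos.ne')
      (sub_one_mul_sub_add_one_ne_zero hz v.2)) (h.snd_ne_zero hS) hv
  · intro hz
    obtain ⟨t, s, ht, hs, rfl⟩ := exists_eq_of_mem_nonrealCurve hS hz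
    exact ((h.critEq_ofReal_iff ht hs).1 hv).1

theorem critEq_mem (hS : S ∈ nonrealCurve P) (hv : CritEq κ n v S) :
    v ∈ Set.Ioo (-1 : ℝ) 1 ×ˢ Set.Ioo (-1 : ℝ) 1 := by
  by_cases hz : S.1.im = 0
  · obtain ⟨t, s, ht, hs, rfl⟩ := exists_eq_of_mem_nonrealCurve hS hz
    obtain ⟨hχ, hη⟩ := (h.critEq_ofReal_iff ht hs).1 hv
    have htneg := h.neg_of_eval_neg ht
    exact ⟨by norm_num [hχ], by nlinarith, by nlinarith⟩
  · have hχ := mt (h.fst_eq_zero_iff_of_critEq hS hv).1 hz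
    have hroot := h.aeval_critPoly_eq_zero_of_critEq hS hv
    have hχ_lt := h.four_mul_sq_lt_of_critPoly_nonreal_root hχ hz hroot
    have hη_lt := h.mul_neg_of_critPoly_nonreal_root hχ hz hroot
    exact ⟨abs_lt.1 ((sq_lt_one_iff_abs_lt_one _).1 (by linarith)),
      abs_lt.1 ((sq_lt_one_iff_abs_lt_one _).1 (by linarith))⟩

theorem eq_of_critEq_of_fst_eq (hz : S.1.im ≠ 0) (hv : CritEq κ n v S)
    (hv' : CritEq κ n v S') (hfst : S'.1 = S.1) : S' = S := by
  refine Prod.ext hfst (mul_left_cancel₀ (mul_ne_zero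
    (Complex.ofReal_ne_zero.2 h.kappa_pos.ne') (sub_one_mul_sub_add_one_ne_zero hz v.2)) ?_)
  rw [CritEq, hfst] at hv'
  exact hv'.trans hv.symm

theorem eq_or_eq_conj_of_critEq (hS : S ∈ nonrealCurve P) (hS' : S' ∈ nonrealCurve P)
    (hv : CritEq κ n v S) (hv' : CritEq κ n v S') : S' = S ∨ S' = (conj S.1, conj S.2) := by
  have hiff := (h.fst_eq_zero_iff_of_critEq hS hv).symm.trans (h.fst_eq_zero_iff_of_critEq hS' hv')
  by_cases hz : S.1.im = 0
  · refine eq_or_eq_conj_of_mem_nonrealCurve hS hS' hz ?_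
    obtain ⟨t, s, ht, hs, rfl⟩ := exists_eq_of_mem_nonrealCurve hS hz
    obtain ⟨t', s', ht', hs', rfl⟩ := exists_eq_of_mem_nonrealCurve hS' (hiff.1 hz)
    have hη := ((h.critEq_ofReal_iff ht hs).1 hv).2
    have hη' := ((h.critEq_ofReal_iff ht' hs').1 hv').2
    have hne : v.2 - 1 ≠ 0 := sub_ne_zero.2 (h.critEq_mem hS hv).2.2.ne
    have ht_eq : t' = t := mul_left_cancel₀ hne (by linarith)
    rw [ht_eq]
  · have hχ := mt (h.fst_eq_zero_iff_of_critEq hS hv).1 hz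
    refine (h.eq_or_eq_conj_of_critPoly_nonreal_root hχ hz
      (h.aeval_critPoly_eq_zero_of_critEq hS hv) (mt hiff.2 hz)
      (h.aeval_critPoly_eq_zero_of_critEq hS' hv')).imp
        (h.eq_of_critEq_of_fst_eq hz hv hv') fun hconj => ?_
    exact h.eq_of_critEq_of_fst_eq (by simpa using hz) hv.conj hv' hconj

theorem critEq_unique (hS : S ∈ nonrealCurve P) (hS' : S' ∈ nonrealCurve P)
    (hv : CritEq κ n v S) (hv' : CritEq κ n v S')
    (hsign : 0 < (logDer n S).im * (logDer n S').im) : S' = S := by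
  refine (h.eq_or_eq_conj_of_critEq hS hS' hv hv').resolve_right ?_
  rintro rfl
  rw [logDer_conj, Complex.conj_im] at hsign
  linarith [mul_self_nonneg (logDer n S).im]

theorem mul_aeval_derivative_critPoly (hS : S ∈ nonrealCurve P) (hv : CritEq κ n v S) :
    S.1 * aeval S.1 (derivative (critPoly κ P n (v.2 - 1) (v.2 + 1) v.1)) =
      κ * ((v.2 - 1) * S.1 - (v.2 + 1)) * critJacobian κ P n v S := by
  have hmul := congrArg (fun p => aeval S.1 (derivative p))
    (h.X_mul_critPoly κ n (v.2 - 1) (v.2 + 1) v.1)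
  have hroot := h.aeval_critPoly_eq_zero_of_critEq hS hv
  rw [CritEq] at hv
  simp only [derivative_mul, derivative_pow, derivative_X, derivative_C, derivative_one, map_mul,
    map_sub, map_add, map_pow, map_one, map_zero, aeval_X, aeval_C, Complex.coe_algebraMap, hroot,
    ← hS.1] at hmul
  push_cast at hmul
  rw [critJacobian]
  linear_combination hmul + 4 * v.1 * (aeval S.1 n + S.1 * aeval S.1 (derivative n)) * hv

theorem critJacobian_ne_zero (hS : S ∈ nonrealCurve P) (hv : CritEq κ n v S) :
    critJacobian κ P n v S ≠ 0 := by
  by_cases hz : S.1.im = 0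
  · have hη := (h.critEq_mem hS hv).2.2.ne
    obtain ⟨t, s, ht, hs, rfl⟩ := exists_eq_of_mem_nonrealCurve hS hz
    obtain ⟨hχ, hlin⟩ := (h.critEq_ofReal_iff ht hs).1 hv
    have hlin' : ((v.2 : ℂ) - 1) * t - (v.2 + 1) = 0 := by exact_mod_cast hlin
    have hη' : (v.2 : ℂ) - 1 ≠ 0 := sub_ne_zero.2 (by exact_mod_cast hη)
    simp [critJacobian, hlin', hχ, h.kappa_pos.ne', hη', hs]
  · intro hzero
    have hχ := mt (h.fst_eq_zero_iff_of_critEq hS hv).1 hz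
    refine mul_ne_zero (h.fst_ne_zero hS) (h.aeval_derivative_critPoly_ne_zero hχ hz
      (h.aeval_critPoly_eq_zero_of_critEq hS hv)) ?_
    rw [h.mul_aeval_derivative_critPoly hS hv, hzero, mul_zero]

end IsHarnackPair

/-! ### The spectral curve of the transfer matrix -/

/-- The `l`-th real zero of `P` in decreasing order, counted from `0`, and `0` when there are at
most `l` of them. -/
def sortedRoot (P : ℝ[X]) (l : ℕ) : ℝ := (P.roots.sort (· ≥ ·)).getD l 0

section sortedRoot

variable {P : ℝ[X]}

theorem sortedRoot_eq_getElem {l : ℕ} (hl : l < P.roots.card) :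
    sortedRoot P l = (P.roots.sort (· ≥ ·))[l]'(by rwa [Multiset.length_sort]) :=
  List.getD_eq_getElem _ _ _

theorem sortedRoot_mem_roots {l : ℕ} (hl : l < P.roots.card) : sortedRoot P l ∈ P.roots := by
  rw [sortedRoot_eq_getElem hl, ← Multiset.mem_sort (r := (· ≥ ·))]
  exact List.getElem_mem _

theorem exists_sortedRoot_eq {t : ℝ} (ht : t ∈ P.roots) :
    ∃ l < P.roots.card, sortedRoot P l = t := by
  rw [← Multiset.mem_sort (r := (· ≥ ·))] at ht
  obtain ⟨l, hl, rfl⟩ := List.getElem_of_mem ht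
  rw [Multiset.length_sort] at hl
  exact ⟨l, hl, sortedRoot_eq_getElem hl⟩

theorem sortedRoot_lt_sortedRoot (hP : P.roots.Nodup) {i j : ℕ} (hij : i < j)
    (hj : j < P.roots.card) : sortedRoot P j < sortedRoot P i := by
  rw [sortedRoot_eq_getElem hj, sortedRoot_eq_getElem (hij.trans hj)]
  have hlen := Multiset.length_sort (s := P.roots) (r := (· ≥ ·))
  have hsorted := Multiset.pairwise_sort P.roots (· ≥ ·)
  have hnodup : (P.roots.sort (· ≥ ·)).Nodup := by
    rwa [← Multiset.coe_nodup, Multiset.sort_eq]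
  refine lt_of_le_of_ne (List.pairwise_iff_getElem.1 hsorted i j (by omega) (by omega) hij) ?_
  exact fun heq => hij.ne' ((List.Nodup.getElem_inj_iff hnodup).1 heq)

theorem prod_X_sub_C_sortedRoot :
    ∏ l ∈ Finset.range P.roots.card, (X - C (sortedRoot P l)) =
      (P.roots.map fun r => X - C r).prod := by
  conv_rhs => rw [← Multiset.sort_eq P.roots (· ≥ ·), Multiset.map_coe, Multiset.prod_coe]
  have hlen := Multiset.length_sort (s := P.roots) (r := (· ≥ ·))
  rw [← hlen, Finset.prod_range, ← List.prod_ofFn]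
  congr 1
  refine List.ext_getElem (by simp) fun l hl hl' => ?_
  rw [List.getElem_ofFn, List.getElem_map, sortedRoot, List.getD_eq_getElem]

theorem splits_of_forall_aeval_eq_zero (hP : ∀ z : ℂ, aeval z P = 0 → z.im = 0) : P.Splits := by
  refine Splits.of_splits_map (algebraMap ℝ ℂ) (IsAlgClosed.splits _) fun z hz => ?_
  refine ⟨z.re, Complex.ext rfl ?_⟩
  exact (hP z ((mem_aroots.1 hz).2)).symm

theorem isSpectralPoly_sortedRoot {m : ℕ} (hdeg : P.natDegree = 2 * m + 1)
    (hlead : 0 < P.leadingCoeff) (hsq : Squarefree P)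
    (hroots : ∀ z : ℂ, aeval z P = 0 → z ∉ Complex.slitPlane) (hzero : P.IsRoot 0) :
    IsSpectralPoly m P (sortedRoot P) := by
  have hP : P ≠ 0 := leadingCoeff_ne_zero.1 hlead.ne'
  have hsplits : P.Splits := splits_of_forall_aeval_eq_zero fun z hz =>
    not_not.1 fun him => hroots z hz (Complex.mem_slitPlane_iff.2 (Or.inr him))
  have hcard : P.roots.card = 2 * m + 1 := by rw [← hsplits.natDegree_eq_card_roots, hdeg]
  have hlt : ∀ i j, i < j → j < 2 * m + 1 → sortedRoot P j < sortedRoot P i := fun i j hij hj =>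
    sortedRoot_lt_sortedRoot (nodup_roots (PerfectField.separable_iff_squarefree.2 hsq)) hij
      (hcard ▸ hj)
  refine ⟨hlead, ?_, ?_, hlt⟩
  · rw [← hcard, prod_X_sub_C_sortedRoot]
    exact hsplits.eq_prod_roots
  · have hnonpos : sortedRoot P 0 ≤ 0 := by
      have hroot : P.IsRoot (sortedRoot P 0) :=
        isRoot_of_mem_roots (sortedRoot_mem_roots (by omega))
      by_contra! hpos
      refine hroots (sortedRoot P 0) ?_ (Complex.ofReal_mem_slitPlane.2 hpos)
      rw [aeval_complex_ofReal, hroot.eq_zero, Complex.ofReal_zero]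
    obtain ⟨l, hl, hl_eq⟩ := exists_sortedRoot_eq ((mem_roots hP).2 hzero)
    rcases Nat.eq_zero_or_pos l with rfl | hpos
    · exact hl_eq
    · linarith [hlt 0 l hpos (hcard ▸ hl)]

end sortedRoot

theorem exists_sub_mul_derivative_eq {p : ℝ[X]} {a u v : ℝ} (huv : u < v)
    (ha : a ∉ Set.Icc u v) (hu : p.IsRoot u) (hv : p.IsRoot v) (N : ℕ) :
    ∃ c ∈ Set.Ioo u v, (c - a) * (derivative p).eval c = N * p.eval c := by
  have hne : ∀ t ∈ Set.Icc u v, t - a ≠ 0 := fun t ht hta => ha (sub_eq_zero.1 hta ▸ ht)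
  have hderiv : ∀ t ∈ Set.Icc u v, HasDerivAt (fun t => p.eval t / (t - a) ^ N)
      (((derivative p).eval t * (t - a) ^ N - p.eval t * (N * (t - a) ^ (N - 1) * 1)) /
        ((t - a) ^ N) ^ 2) t := fun t ht =>
    (p.hasDerivAt t).div (((hasDerivAt_id t).sub_const a).pow N) (pow_ne_zero _ (hne t ht))
  obtain ⟨c, hc, hc_zero⟩ := exists_hasDerivAt_eq_zero huv
    (fun t ht => (hderiv t ht).continuousAt.continuousWithinAt)
    (by rw [hu.eq_zero, hv.eq_zero, zero_div, zero_div])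
    (fun t ht => hderiv t (Set.Ioo_subset_Icc_self ht))
  refine ⟨c, hc, ?_⟩
  have hca : c - a ≠ 0 := hne c (Set.Ioo_subset_Icc_self hc)
  rw [div_eq_zero_iff, or_iff_left (pow_ne_zero _ (pow_ne_zero _ hca))] at hc_zero
  rcases N with - | N
  · rw [pow_zero, mul_one, Nat.cast_zero, zero_mul, zero_mul, mul_zero, sub_zero] at hc_zero
    rw [hc_zero, mul_zero, Nat.cast_zero, zero_mul]
  · refine mul_left_cancel₀ (pow_ne_zero N hca) ?_
    rw [Nat.add_sub_cancel] at hc_zero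
    linear_combination hc_zero

/-- The numerator `(z - 1) T' - k T` of the derivative of `Tr Φ = T / (z - 1)^k`. -/
def traceNumer {k : ℕ} (α β : Fin k → ℝ) : ℝ[X] :=
  (X - 1) * derivative (trPoly α β) - (k : ℝ[X]) * trPoly α β

/-- The quotient of `traceNumer` by `q`. -/
def reducedNumer {k : ℕ} (α β : Fin k → ℝ) : ℝ[X] := traceNumer α β /ₘ q α β

section

variable {k : ℕ} {α β : Fin k → ℝ}

theorem natDegree_traceNumer_le : (traceNumer α β).natDegree ≤ k - 1 := by
  refine natDegree_le_iff_coeff_eq_zero.2 fun j hj => ?_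
  obtain ⟨j, rfl⟩ : ∃ i, j = i + 1 := ⟨j - 1, by omega⟩
  have hcoeff : ∀ i, k < i → (trPoly α β).coeff i = 0 := fun i hi =>
    coeff_eq_zero_of_natDegree_lt (natDegree_trPoly_le.trans_lt hi)
  rw [traceNumer, sub_mul, one_mul, coeff_sub, coeff_sub, coeff_X_mul, coeff_natCast_mul,
    coeff_derivative, coeff_derivative, hcoeff (j + 1 + 1) (by omega)]
  rcases (show k ≤ j + 1 by omega).eq_or_lt with hk | hk
  · rw [show (k : ℝ) = j + 1 by exact_mod_cast hk]
    ring
  · rw [hcoeff (j + 1) hk]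
    ring

theorem two_mul_trPoly_mul_traceNumer (hk : 0 < k) :
    C 2 * trPoly α β * traceNumer α β =
      (X - 1) * derivative (discPoly α β) - ((2 * k : ℕ) : ℝ[X]) * discPoly α β := by
  obtain ⟨j, hj⟩ : ∃ j, 2 * k = j + 1 := ⟨2 * k - 1, by omega⟩
  have hj_cast : 2 * (k : ℝ[X]) = (j : ℝ[X]) + 1 := by
    exact_mod_cast congrArg (Nat.cast (R := ℝ[X])) hj
  have hC2 : (C 2 : ℝ[X]) = 2 := rfl
  simp only [traceNumer, discPoly_eq_trPoly, hj, derivative_sub, derivative_mul, derivative_pow,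
    derivative_C, derivative_X, derivative_one, Nat.add_sub_cancel, map_natCast]
  push_cast
  rw [hC2]
  linear_combination (-trPoly α β ^ 2) * hj_cast

theorem trPoly_eval_ne_zero {t : ℝ} (ht : t ≠ 1) (hdisc : 0 ≤ (discPoly α β).eval t) :
    (trPoly α β).eval t ≠ 0 := by
  intro hzero
  have hpos : 0 < (t - 1) ^ (2 * k) := (even_two_mul k).pow_pos (sub_ne_zero.2 ht)
  simp only [discPoly_eq_trPoly, eval_sub, eval_mul, eval_pow, hzero, eval_C, eval_X,
    eval_one] at hdisc
  linarith

variable (hk : 0 < k) (hα : ∀ m, 0 < α m) (hβ : ∀ m, 0 < β m)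
include hk hα hβ

theorem q_eval_one_ne_zero : (q α β).eval 1 ≠ 0 := by
  intro hzero
  have hpos := discPoly_eval_one_pos hk (fun m => (hα m).le) fun m => (hβ m).le
  simp [(factorPair_spec hk α β hα hβ).1, hzero] at hpos

theorem natDegree_q_add_natDegree_p0 :
    2 * (q α β).natDegree + (p0 α β).natDegree = 2 * k - 1 := by
  obtain ⟨hp, hsq, hq⟩ := factorPair_spec hk α β hα hβ
  rw [← natDegree_discPoly hk (fun m => (hα m).le) fun m => (hβ m).le, hp,
    natDegree_mul (pow_ne_zero _ hq.ne_zero) hsq.ne_zero, natDegree_pow]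

theorem natDegree_p0 : (p0 α β).natDegree = 2 * (kPrime α β - 1) + 1 := by
  have hdeg := natDegree_q_add_natDegree_p0 hk hα hβ
  unfold kPrime
  omega

theorem p0_leadingCoeff_pos : 0 < (p0 α β).leadingCoeff := by
  obtain ⟨hp, -, hq⟩ := factorPair_spec hk α β hα hβ
  have hpos := discPoly_leadingCoeff_pos hk (fun m => (hα m).le) fun m => (hβ m).le
  rwa [hp, leadingCoeff_mul, leadingCoeff_pow, hq.leadingCoeff, one_pow, one_mul] at hpos

theorem isCoprime_q_trPoly : IsCoprime (q α β) (trPoly α β) := by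
  have hX : IsCoprime (q α β) (X - 1) :=
    ((irreducible_X_sub_C 1).coprime_iff_not_dvd.2 fun hdvd =>
      q_eval_one_ne_zero hk hα hβ (dvd_iff_isRoot.1 hdvd)).symm
  have hC : IsCoprime (q α β) (C 4 * (X - 1) ^ (2 * k)) :=
    (isCoprime_mul_unit_left_right (isUnit_C.2 (IsUnit.mk0 (4 : ℝ) four_ne_zero)) _ _).2
      hX.pow_right
  have hdisc := discPoly_eq_trPoly (α := α) (β := β)
  rw [(factorPair_spec hk α β hα hβ).1] at hdisc
  rw [show C 4 * (X - 1) ^ (2 * k) = trPoly α β * trPoly α β + q α β * -(q α β * p0 α β) by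
    linear_combination hdisc] at hC
  exact hC.of_add_mul_left_right.of_mul_right_left

theorem q_dvd_traceNumer : q α β ∣ traceNumer α β := by
  have hsq : q α β ^ 2 ∣ discPoly α β := Dvd.intro _ (factorPair_spec hk α β hα hβ).1.symm
  have hderiv : q α β ∣ derivative (discPoly α β) := by
    simpa using pow_sub_one_dvd_derivative_of_pow_dvd hsq
  refine ((isCoprime_mul_unit_left_right (isUnit_C.2 (IsUnit.mk0 (2 : ℝ) two_ne_zero)) _ _).2
    (isCoprime_q_trPoly hk hα hβ)).dvd_of_dvd_mul_left ?_
  rw [two_mul_trPoly_mul_traceNumer hk]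
  exact dvd_sub (hderiv.mul_left _) (((dvd_pow_self _ two_ne_zero).trans hsq).mul_left _)

theorem q_mul_reducedNumer : q α β * reducedNumer α β = traceNumer α β := by
  obtain ⟨n, hn⟩ := q_dvd_traceNumer hk hα hβ
  rw [reducedNumer, hn, mul_divByMonic_cancel_left _ (factorPair_spec hk α β hα hβ).2.2]

variable (hαβ : ∏ m, α m = ∏ m, β m)
include hαβ

theorem p0_eval_neg_of_q_isRoot {t : ℝ} (ht : (q α β).IsRoot t) : (p0 α β).eval t < 0 := by
  have hp := (factorPair_spec hk α β hα hβ).1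
  have hzero : (discPoly α β).IsRoot t := by simp [hp, ht.eq_zero]
  have hderiv : (derivative (discPoly α β)).IsRoot t := by simp [hp, ht.eq_zero, derivative_pow]
  have hsecond : (derivative (derivative (discPoly α β))).eval t =
      2 * (derivative (q α β)).eval t ^ 2 * (p0 α β).eval t := by
    rw [hp, sq]
    simp only [derivative_mul, derivative_add, eval_add, eval_mul, ht.eq_zero]
    ring
  have ht_nonpos : t ≤ 0 := not_lt.1 <| mt Complex.ofReal_mem_slitPlane.2 <|
    notMem_slitPlane_of_aeval_discPoly_eq_zero hk hα hβ
      (by rw [aeval_complex_ofReal, hzero.eq_zero, Complex.ofReal_zero])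
  have ht_neg : t < 0 := by
    refine ht_nonpos.lt_of_ne ?_
    rintro rfl
    exact (discPoly_derivative_eval_zero_pos hk (fun m => (hα m).le) hβ hαβ).ne' hderiv
  have hneg := discPoly_double_zero hk hα hβ ht_neg hzero hderiv
  rw [hsecond] at hneg
  exact neg_of_mul_neg_right hneg (by positivity)

theorem isSpectralPoly_p0 : IsSpectralPoly (kPrime α β - 1) (p0 α β) (x α β) := by
  obtain ⟨hp, hsq, -⟩ := factorPair_spec hk α β hα hβ
  refine isSpectralPoly_sortedRoot (natDegree_p0 hk hα hβ) (p0_leadingCoeff_pos hk hα hβ) hsq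
    (fun z hz => notMem_slitPlane_of_aeval_discPoly_eq_zero hk hα hβ ?_) ?_
  · rw [hp, map_mul, hz, mul_zero]
  · have hzero : (q α β).eval 0 ^ 2 * (p0 α β).eval 0 = 0 := by
      rw [← eval_pow, ← eval_mul, ← hp, discPoly_eval_zero (fun m => (hβ m).ne') hαβ]
    refine (mul_eq_zero.1 hzero).resolve_left (pow_ne_zero 2 fun hq => ?_)
    have hpos := discPoly_derivative_eval_zero_pos hk (fun m => (hα m).le) hβ hαβ
    simp [hp, hq, derivative_pow] at hpos

theorem exists_reducedNumer_isRoot {l : ℕ} (hl : l < kPrime α β - 1) :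
    ∃ c ∈ Set.Ioo (x α β (2 * l + 2)) (x α β (2 * l + 1)), (reducedNumer α β).IsRoot c := by
  have hp := (factorPair_spec hk α β hα hβ).1
  have hspec := isSpectralPoly_p0 hk hα hβ hαβ
  have hneg : x α β (2 * l + 1) < 0 := hspec.x_neg (by omega) (by omega)
  have hroot : ∀ j < 2 * (kPrime α β - 1) + 1, (discPoly α β).IsRoot (x α β j) := fun j hj => by
    rw [IsRoot, hp, eval_mul, hspec.eval_x hj, mul_zero]
  obtain ⟨c, hc, hc_eq⟩ := exists_sub_mul_derivative_eq (a := 1)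
    (hspec.x_lt (2 * l + 1) (2 * l + 2) (by omega) (by omega))
    (fun h1 => by linarith [h1.2]) (hroot _ (by omega)) (hroot _ (by omega)) (2 * k)
  have hp0 : 0 < (p0 α β).eval c := hspec.eval_pos_of_mem_Ioo hl hc
  have hdisc : 0 ≤ (discPoly α β).eval c := by
    rw [hp, eval_mul, eval_pow]
    positivity
  have hprod := congrArg (eval c) (two_mul_trPoly_mul_traceNumer (α := α) (β := β) hk)
  rw [← q_mul_reducedNumer hk hα hβ] at hprod
  simp only [eval_mul, eval_sub, eval_C, eval_X, eval_one, eval_natCast, hc_eq, sub_self] at hprod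
  have hT := trPoly_eval_ne_zero (show c ≠ 1 by linarith [hc.2]) hdisc
  have hq : (q α β).eval c ≠ 0 := fun hzero =>
    (p0_eval_neg_of_q_isRoot hk hα hβ hαβ hzero).not_gt hp0
  exact ⟨c, hc, ((mul_eq_zero.1 ((mul_eq_zero.1 hprod).resolve_left
    (mul_ne_zero two_ne_zero hT))).resolve_left hq)⟩

theorem isHarnackPair_reducedNumer :
    IsHarnackPair (kPrime α β - 1) k (p0 α β) (reducedNumer α β) (x α β) where
  toIsSpectralPoly := isSpectralPoly_p0 hk hα hβ hαβ
  kappa_pos := Nat.cast_pos.2 hk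
  natDegree_le := by
    have hdeg := natDegree_q_add_natDegree_p0 hk hα hβ
    have hp0 := natDegree_p0 hk hα hβ
    have hnumer := natDegree_traceNumer_le (α := α) (β := β)
    rw [reducedNumer, natDegree_divByMonic _ (factorPair_spec hk α β hα hβ).2.2]
    omega
  eval_one := by
    have hmul := congrArg (eval 1) (q_mul_reducedNumer hk hα hβ)
    have hdisc := congrArg (eval 1) (discPoly_eq_trPoly (α := α) (β := β))
    simp only [(factorPair_spec hk α β hα hβ).1, traceNumer, eval_mul, eval_sub, eval_pow, eval_X,
      eval_one, eval_natCast, sub_self, zero_mul, zero_sub,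
      zero_pow (Nat.mul_ne_zero two_ne_zero hk.ne'), mul_zero, sub_zero] at hmul hdisc
    refine mul_left_cancel₀ (pow_ne_zero 2 (q_eval_one_ne_zero hk hα hβ)) ?_
    rw [mul_left_comm, hdisc, ← mul_pow, hmul]
    ring
  exists_isRoot := fun _ hl => exists_reducedNumer_isRoot hk hα hβ hαβ hl

end

/-! ### The critical points of the action function -/

theorem exists_isLogBranch {h : ℂ → ℂ} (hh : AnalyticAt ℂ h 0) (h0 : h 0 ≠ 0) :
    ∃ f, IsLogBranch h f := by
  refine ⟨fun t => Complex.log (h 0) + Complex.log (h t / h 0), ?_, ?_⟩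
  · exact analyticAt_const.add (hh.div_const.clog (by simp [div_self h0]))
  · filter_upwards [hh.continuousAt.eventually_ne h0] with t ht
    rw [Complex.exp_add, Complex.exp_log h0, Complex.exp_log (div_ne_zero ht h0),
      mul_div_cancel₀ _ h0]

theorem IsLogBranch.deriv_eq_logDeriv {h f : ℂ → ℂ} (hf : IsLogBranch h f) :
    deriv f 0 = logDeriv h 0 := by
  have hexp := hf.1.differentiableAt.hasDerivAt.cexp.congr_of_eventuallyEq
    (hf.2.mono fun t ht => ht.symm)
  rw [logDeriv_apply, hexp.deriv, ← hf.2.self_of_nhds,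
    mul_div_cancel_left₀ _ (Complex.exp_ne_zero _)]

theorem exists_analyticAt_sq_eq {h : ℂ → ℂ} {w : ℂ} (hh : AnalyticAt ℂ h 0) (hw : w ^ 2 = h 0)
    (hw0 : w ≠ 0) : ∃ g : ℂ → ℂ, AnalyticAt ℂ g 0 ∧ g 0 = w ∧ ∀ᶠ t in 𝓝 (0 : ℂ), g t ^ 2 = h t := by
  obtain ⟨f, hf, hexp⟩ := exists_isLogBranch hh (hw ▸ pow_ne_zero 2 hw0)
  refine ⟨fun t => w * Complex.exp ((f t - f 0) / 2),
    analyticAt_const.mul ((hf.sub analyticAt_const).div_const).cexp', by simp, ?_⟩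
  filter_upwards [hexp] with t ht
  rw [mul_pow, hw, ← Complex.exp_nat_mul, Nat.cast_ofNat, mul_div_cancel₀ _ two_ne_zero,
    Complex.exp_sub, hexp.self_of_nhds, ht, mul_div_cancel₀ _ (hw ▸ pow_ne_zero 2 hw0)]

section

variable {k : ℕ} {α β : Fin k → ℝ}

theorem curve_sq_eq (S : Curve α β) : S.1.2 ^ 2 = aeval S.1.1 (p0 α β) := sub_eq_zero.1 S.2

theorem rho_eq {S : ℂ × ℂ} (h0 : S.1 ≠ 0) (h1 : S.1 ≠ 1) :
    rho α β S =
      (aeval S.1 (trPoly α β) + aeval S.1 (q α β) * S.2) / (2 * (S.1 - 1) ^ k) := by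
  have htrace : aeval S.1 (trPoly α β) = (S.1 - 1) ^ k * (Phi α β S.1).trace := by
    rw [← smul_eq_mul, ← Matrix.trace_smul, ← Phi_eq α β h0 h1]
    simp [trPoly, Matrix.trace, Fin.sum_univ_two]
  have hne : (S.1 - 1) ^ k ≠ 0 := pow_ne_zero _ (sub_ne_zero.2 h1)
  rw [rho, htrace]
  field_simp

theorem eventually_rho_eq {γ : ℂ → ℂ × ℂ} (hγ : ContinuousAt γ 0) (h0 : (γ 0).1 ≠ 0)
    (h1 : (γ 0).1 ≠ 1) : (fun t => rho α β (γ t)) =ᶠ[𝓝 0] fun t =>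
      (aeval (γ t).1 (trPoly α β) + aeval (γ t).1 (q α β) * (γ t).2) / (2 * ((γ t).1 - 1) ^ k) := by
  filter_upwards [hγ.fst.eventually_ne h0, hγ.fst.eventually_ne h1] with t ht0 ht1
    using rho_eq ht0 ht1

namespace IsLocalParam

variable {S : Curve α β} {γ : ℂ → ℂ × ℂ}

theorem hasDerivAt_fst (hγ : IsLocalParam α β S γ) :
    HasDerivAt (fun t => (γ t).1) (deriv γ 0).1 0 :=
  hγ.1.differentiableAt.hasDerivAt.fst

theorem hasDerivAt_snd (hγ : IsLocalParam α β S γ) :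
    HasDerivAt (fun t => (γ t).2) (deriv γ 0).2 0 :=
  hγ.1.differentiableAt.hasDerivAt.snd

theorem hasDerivAt_aeval_fst (hγ : IsLocalParam α β S γ) (P : ℝ[X]) :
    HasDerivAt (fun t => aeval (γ t).1 P) (aeval S.1.1 (derivative P) * (deriv γ 0).1) 0 := by
  rw [← hγ.2.1]
  exact (P.hasDerivAt_aeval (γ 0).1).comp 0 hγ.hasDerivAt_fst

theorem hasDerivAt_trPoly_add (hγ : IsLocalParam α β S γ) :
    HasDerivAt (fun t => aeval (γ t).1 (trPoly α β) + aeval (γ t).1 (q α β) * (γ t).2)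
      (aeval S.1.1 (derivative (trPoly α β)) * (deriv γ 0).1 +
        (aeval S.1.1 (derivative (q α β)) * (deriv γ 0).1 * S.1.2 +
          aeval S.1.1 (q α β) * (deriv γ 0).2)) 0 := by
  simpa only [hγ.2.1] using (hγ.hasDerivAt_aeval_fst (trPoly α β)).fun_add
    ((hγ.hasDerivAt_aeval_fst (q α β)).fun_mul hγ.hasDerivAt_snd)

theorem two_mul_snd_mul_deriv_snd (hγ : IsLocalParam α β S γ) :
    2 * S.1.2 * (deriv γ 0).2 = aeval S.1.1 (derivative (p0 α β)) * (deriv γ 0).1 := by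
  have hcurve : (fun t => (γ t).2 ^ 2) =ᶠ[𝓝 0] fun t => aeval (γ t).1 (p0 α β) :=
    hγ.2.2.2.mono fun t ht => sub_eq_zero.1 ht
  have hsq := (hγ.hasDerivAt_snd.pow 2).congr_of_eventuallyEq hcurve.symm
  rw [← hsq.unique (hγ.hasDerivAt_aeval_fst (p0 α β)), hγ.2.1]
  ring

theorem deriv_fst_ne_zero (hγ : IsLocalParam α β S γ) (hw : S.1.2 ≠ 0) : (deriv γ 0).1 ≠ 0 := by
  intro hzero
  have hsnd := hγ.two_mul_snd_mul_deriv_snd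
  rw [hzero, mul_zero] at hsnd
  exact hγ.2.2.1 (Prod.ext hzero ((mul_eq_zero.1 hsnd).resolve_left (mul_ne_zero two_ne_zero hw)))

end IsLocalParam

theorem exists_isLocalParam {S : Curve α β} (hw : S.1.2 ≠ 0) : ∃ γ, IsLocalParam α β S γ := by
  have hz : AnalyticAt ℂ (fun t : ℂ => S.1.1 + t) 0 := analyticAt_const.add analyticAt_id
  obtain ⟨g, hg, hg0, hsq⟩ := exists_analyticAt_sq_eq (hz.aeval_polynomial (p0 α β))
    (by simpa only [add_zero] using curve_sq_eq S) hw
  refine ⟨fun t => (S.1.1 + t, g t), hz.prod hg, Prod.ext (add_zero _) hg0, fun hzero => ?_,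
    hsq.mono fun t ht => sub_eq_zero.2 ht⟩
  have hderiv : HasDerivAt (fun t => (S.1.1 + t, g t)) (1, deriv g 0) 0 :=
    ((hasDerivAt_id (0 : ℂ)).const_add S.1.1).prodMk hg.differentiableAt.hasDerivAt
  exact one_ne_zero (congrArg Prod.fst (hderiv.deriv.symm.trans hzero))

variable (hk : 0 < k) (hα : ∀ m, 0 < α m) (hβ : ∀ m, 0 < β m)
include hk hα hβ

theorem trPoly_add_mul_trPoly_sub (S : Curve α β) :
    (aeval S.1.1 (trPoly α β) + aeval S.1.1 (q α β) * S.1.2) *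
      (aeval S.1.1 (trPoly α β) - aeval S.1.1 (q α β) * S.1.2) = 4 * (S.1.1 - 1) ^ (2 * k) := by
  have hdisc := congrArg (aeval S.1.1) (factorPair_spec hk α β hα hβ).1
  have hC4 : aeval S.1.1 (C 4 : ℝ[X]) = 4 := map_ofNat _ 4
  simp only [discPoly_eq_trPoly, map_sub, map_mul, map_pow, aeval_X, map_one, hC4] at hdisc
  linear_combination hdisc - aeval S.1.1 (q α β) ^ 2 * curve_sq_eq S

theorem trPoly_add_ne_zero {S : Curve α β} (h1 : S.1.1 ≠ 1) :
    aeval S.1.1 (trPoly α β) + aeval S.1.1 (q α β) * S.1.2 ≠ 0 := by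
  refine left_ne_zero_of_mul (b := aeval S.1.1 (trPoly α β) - aeval S.1.1 (q α β) * S.1.2) ?_
  rw [trPoly_add_mul_trPoly_sub hk hα hβ]
  exact mul_ne_zero (OfNat.ofNat_ne_zero 4) (pow_ne_zero _ (sub_ne_zero.2 h1))

theorem two_mul_trPoly_mul_reducedNumer :
    C 2 * trPoly α β * reducedNumer α β = (X - 1) * (C 2 * derivative (q α β) * p0 α β +
      q α β * derivative (p0 α β)) - C 2 * (k : ℝ[X]) * q α β * p0 α β := by
  obtain ⟨hp, -, hq⟩ := factorPair_spec hk α β hα hβ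
  have htrace := two_mul_trPoly_mul_traceNumer (α := α) (β := β) hk
  have hC2 : (C 2 : ℝ[X]) = 2 := rfl
  rw [← q_mul_reducedNumer hk hα hβ, hp, sq, derivative_mul, derivative_mul, Nat.cast_mul,
    Nat.cast_ofNat] at htrace
  rw [hC2] at htrace ⊢
  refine mul_left_cancel₀ hq.ne_zero ?_
  linear_combination htrace

theorem deriv_rho_identity {S : Curve α β} {z' w' : ℂ}
    (hcurve : 2 * S.1.2 * w' = aeval S.1.1 (derivative (p0 α β)) * z') :
    (S.1.1 - 1) * S.1.2 * (aeval S.1.1 (derivative (trPoly α β)) * z' +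
        (aeval S.1.1 (derivative (q α β)) * z' * S.1.2 + aeval S.1.1 (q α β) * w')) -
      k * S.1.2 * z' * (aeval S.1.1 (trPoly α β) + aeval S.1.1 (q α β) * S.1.2) =
    aeval S.1.1 (reducedNumer α β) * z' *
      (aeval S.1.1 (trPoly α β) + aeval S.1.1 (q α β) * S.1.2) := by
  have hnumer := congrArg (aeval S.1.1) (q_mul_reducedNumer hk hα hβ)
  have htrace := congrArg (aeval S.1.1) (two_mul_trPoly_mul_reducedNumer hk hα hβ)
  have hC2 : aeval S.1.1 (C 2 : ℝ[X]) = 2 := map_ofNat _ 2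
  simp only [traceNumer, map_sub, map_mul, map_add, aeval_X, map_one, map_natCast, hC2]
    at hnumer htrace
  linear_combination -S.1.2 * z' * hnumer - z' / 2 * htrace +
    (S.1.1 - 1) * z' * aeval S.1.1 (derivative (q α β)) * curve_sq_eq S +
    (S.1.1 - 1) * aeval S.1.1 (q α β) / 2 * hcurve -
    k * aeval S.1.1 (q α β) * z' * curve_sq_eq S

theorem logDeriv_rho {S : Curve α β} (h0 : S.1.1 ≠ 0) (h1 : S.1.1 ≠ 1) (hw : S.1.2 ≠ 0)
    {γ : ℂ → ℂ × ℂ} (hγ : IsLocalParam α β S γ) :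
    logDeriv (fun t => rho α β (γ t)) 0 =
      aeval S.1.1 (reducedNumer α β) * (deriv γ 0).1 / ((S.1.1 - 1) * S.1.2) := by
  have hz1 : S.1.1 - 1 ≠ 0 := sub_ne_zero.2 h1
  have hne := trPoly_add_ne_zero hk hα hβ h1
  have hsub := hγ.hasDerivAt_fst.sub_const 1
  have hev := eventually_rho_eq (α := α) (β := β) hγ.1.continuousAt (hγ.2.1 ▸ h0) (hγ.2.1 ▸ h1)
  have hcongr := congrArg₂ (· / ·) hev.deriv_eq hev.self_of_nhds
  simp only [← logDeriv_apply] at hcongr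
  rw [hcongr, logDeriv_div _ (by rwa [hγ.2.1]) (by simp [hγ.2.1, hz1])
      hγ.hasDerivAt_trPoly_add.differentiableAt
      ((hsub.fun_pow k).const_mul 2).differentiableAt,
    logDeriv_const_mul _ _ two_ne_zero, logDeriv_fun_pow hsub.differentiableAt,
    logDeriv_apply, logDeriv_apply, hsub.deriv, hγ.hasDerivAt_trPoly_add.deriv, hγ.2.1]
  have hid := deriv_rho_identity hk hα hβ hγ.two_mul_snd_mul_deriv_snd
  generalize aeval S.1.1 (trPoly α β) + aeval S.1.1 (q α β) * S.1.2 = N at hid hne ⊢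
  field_simp
  linear_combination hid

theorem IsBranchOfF.deriv_eq_zero_iff {S : Curve α β} (h0 : S.1.1 ≠ 0) (h1 : S.1.1 ≠ 1)
    (hw : S.1.2 ≠ 0) {v : ℝ × ℝ} {γ : ℂ → ℂ × ℂ} {f : ℂ → ℂ} (hγ : IsLocalParam α β S γ)
    (hf : IsBranchOfF α β v γ f) :
    deriv f 0 = 0 ↔ CritEq k (reducedNumer α β) v S.1 := by
  obtain ⟨a, b, c, ha, hb, hc, rfl⟩ := hf
  have hz1 : S.1.1 - 1 ≠ 0 := sub_ne_zero.2 h1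
  have hderiv := ((ha.1.differentiableAt.hasDerivAt.const_mul
    ((k : ℂ) / 4 * ((v.2 : ℂ) + 1))).sub
    (hb.1.differentiableAt.hasDerivAt.const_mul ((k : ℂ) / 2))).sub
    (hc.1.differentiableAt.hasDerivAt.const_mul ((v.1 : ℂ) / 2))
  rw [ha.deriv_eq_logDeriv, hb.deriv_eq_logDeriv, hc.deriv_eq_logDeriv,
    logDeriv_rho hk hα hβ h0 h1 hw hγ, logDeriv_apply, logDeriv_apply,
    hγ.hasDerivAt_fst.deriv, (hγ.hasDerivAt_fst.sub_const 1).deriv, hγ.2.1] at hderiv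
  have hfactor : (deriv γ 0).1 / (4 * S.1.1 * (S.1.1 - 1) * S.1.2) ≠ 0 :=
    div_ne_zero (hγ.deriv_fst_ne_zero hw)
      (mul_ne_zero (mul_ne_zero (mul_ne_zero (OfNat.ofNat_ne_zero 4) h0) hz1) hw)
  have hval : deriv (fun t => (k : ℂ) / 4 * ((v.2 : ℂ) + 1) * a t - (k : ℂ) / 2 * b t -
      (v.1 : ℂ) / 2 * c t) 0 = (deriv γ 0).1 / (4 * S.1.1 * (S.1.1 - 1) * S.1.2) *
        (k * ((v.2 - 1) * S.1.1 - (v.2 + 1)) * S.1.2 -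
          2 * v.1 * S.1.1 * aeval S.1.1 (reducedNumer α β)) := by
    refine hderiv.deriv.trans ?_
    field_simp
    ring
  rw [hval, mul_eq_zero, or_iff_right hfactor, sub_eq_zero, CritEq]
  norm_cast

theorem exists_isBranchOfF {S : Curve α β} (h0 : S.1.1 ≠ 0) (h1 : S.1.1 ≠ 1) {γ : ℂ → ℂ × ℂ}
    (hγ : IsLocalParam α β S γ) (v : ℝ × ℝ) : ∃ f, IsBranchOfF α β v γ f := by
  have hγ0 := hγ.2.1
  have hz : AnalyticAt ℂ (fun t => (γ t).1) 0 := analyticAt_fst.fun_comp hγ.1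
  have hw : AnalyticAt ℂ (fun t => (γ t).2) 0 := analyticAt_snd.fun_comp hγ.1
  have hz1 : (γ 0).1 - 1 ≠ 0 := by rwa [hγ0, sub_ne_zero]
  have hden : 2 * ((γ 0).1 - 1) ^ k ≠ 0 := mul_ne_zero two_ne_zero (pow_ne_zero k hz1)
  have hrho : AnalyticAt ℂ (fun t => rho α β (γ t)) 0 :=
    (((hz.aeval_polynomial (trPoly α β)).add ((hz.aeval_polynomial (q α β)).mul hw)).div
      (analyticAt_const.mul ((hz.sub analyticAt_const).pow k)) hden).congr
      (eventually_rho_eq hγ.1.continuousAt (hγ0 ▸ h0) (hγ0 ▸ h1)).symm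
  obtain ⟨a, ha⟩ := exists_isLogBranch hz (hγ0 ▸ h0)
  obtain ⟨b, hb⟩ := exists_isLogBranch (hz.sub analyticAt_const) hz1
  obtain ⟨c, hc⟩ := exists_isLogBranch hrho (by
    rw [rho_eq (hγ0 ▸ h0) (hγ0 ▸ h1)]
    exact div_ne_zero (hγ0 ▸ trPoly_add_ne_zero hk hα hβ h1) hden)
  exact ⟨_, a, b, c, ha, hb, hc, rfl⟩

theorem isCriticalPoint_iff {S : Curve α β} (h0 : S.1.1 ≠ 0) (h1 : S.1.1 ≠ 1) (hw : S.1.2 ≠ 0)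
    {v : ℝ × ℝ} :
    IsCriticalPoint α β v (S : Surface α β) ↔ CritEq k (reducedNumer α β) v S.1 := by
  constructor
  · rintro ⟨S', hS', -, -, γ, f, hγ, hf, hderiv⟩
    obtain rfl := OnePoint.coe_injective hS'
    exact (hf.deriv_eq_zero_iff hk hα hβ h0 h1 hw hγ).1 hderiv
  · intro hcrit
    obtain ⟨γ, hγ⟩ := exists_isLocalParam hw
    obtain ⟨f, hf⟩ := exists_isBranchOfF hk hα hβ h0 h1 hγ v
    exact ⟨S, rfl, h0, h1, γ, f, hγ, hf, (hf.deriv_eq_zero_iff hk hα hβ h0 h1 hw hγ).2 hcrit⟩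

end

/-! ### The branch of the square root -/

theorem prod_range_two_mul_add_one_eq_mul_last {M : Type*} [CommMonoid M] (f : ℕ → M) (m : ℕ) :
    ∏ j ∈ Finset.range (2 * m + 1), f j =
      (∏ l ∈ Finset.range m, f (2 * l) * f (2 * l + 1)) * f (2 * m) := by
  rw [Finset.prod_range_succ]
  congr 1
  induction m with
  | zero => simp
  | succ m ih =>
    rw [show 2 * (m + 1) = 2 * m + 1 + 1 by ring, Finset.prod_range_succ, Finset.prod_range_succ,
      ih, Finset.prod_range_succ _ m, mul_assoc]

theorem sub_mem_slitPlane {a : ℝ} {z : ℂ} (hz : z ∉ (fun t : ℝ => (t : ℂ)) '' Set.Iic a) :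
    z - a ∈ Complex.slitPlane := by
  by_contra hslit
  rw [Complex.mem_slitPlane_iff, not_or, not_lt, not_not, Complex.sub_re, Complex.sub_im,
    Complex.ofReal_re, Complex.ofReal_im, sub_zero, sub_nonpos] at hslit
  exact hz ⟨z.re, hslit.1, Complex.ext rfl hslit.2.symm⟩

/-- If `(z - a) / (z - b) = -r` with `r ≥ 0`, then `z` is the convex combination
`(a + r b) / (1 + r)`. -/
theorem sub_div_sub_mem_slitPlane {a b : ℝ} (hba : b ≤ a) {z : ℂ}
    (hz : z ∉ (fun t : ℝ => (t : ℂ)) '' Set.Icc b a) :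
    (z - a) / (z - b) ∈ Complex.slitPlane := by
  by_contra hslit
  rw [Complex.mem_slitPlane_iff, not_or, not_lt, not_not] at hslit
  have hb : z - b ≠ 0 := fun hzero => hz ⟨b, ⟨le_rfl, hba⟩, (sub_eq_zero.1 hzero).symm⟩
  obtain ⟨r, hr, hr_eq⟩ : ∃ r : ℝ, 0 ≤ r ∧ (z - a) / (z - b) = -r :=
    ⟨-((z - a) / (z - b)).re, neg_nonneg.2 hslit.1, Complex.ext (by simp) (by simp [hslit.2])⟩
  rw [div_eq_iff hb] at hr_eq
  have hr1 : (1 : ℂ) + r ≠ 0 := by exact_mod_cast (by positivity : 1 + r ≠ 0)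
  refine hz ⟨(a + r * b) / (1 + r), ⟨?_, ?_⟩, ?_⟩
  · rw [le_div_iff₀ (by positivity)]
    linarith
  · rw [div_le_iff₀ (by positivity)]
    nlinarith
  · push_cast
    rw [div_eq_iff hr1]
    linear_combination -hr_eq

theorem ofReal_cpow_half {u : ℝ} (hu : 0 ≤ u) : (u : ℂ) ^ (1 / 2 : ℂ) = (√u : ℝ) := by
  rw [Real.sqrt_eq_rpow, Complex.ofReal_cpow hu]
  norm_num

/-- A square root of `P`, holomorphic off the cuts `[x₂ₗ₊₁, x₂ₗ]` and `(-∞, x₂ₘ]`: the zeros are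
paired along the finite cuts, and `(z - x₂ₗ) (z - x₂ₗ₊₁)` has the root
`(z - x₂ₗ₊₁) ((z - x₂ₗ) / (z - x₂ₗ₊₁))^{1/2}`. -/
def slitSqrt (m : ℕ) (P : ℝ[X]) (x : ℕ → ℝ) (z : ℂ) : ℂ :=
  (√P.leadingCoeff : ℝ) * ((∏ l ∈ Finset.range m, (z - x (2 * l + 1)) *
    ((z - x (2 * l)) / (z - x (2 * l + 1))) ^ (1 / 2 : ℂ)) * (z - x (2 * m)) ^ (1 / 2 : ℂ))

namespace IsSpectralPoly

variable {m : ℕ} {P : ℝ[X]} {x : ℕ → ℝ} (h : IsSpectralPoly m P x)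
include h

theorem differentiableAt_slitSqrt {z : ℂ}
    (hray : z ∉ (fun t : ℝ => (t : ℂ)) '' Set.Iic (x (2 * m)))
    (hcuts : ∀ l < m, z ∉ (fun t : ℝ => (t : ℂ)) '' Set.Icc (x (2 * l + 1)) (x (2 * l))) :
    DifferentiableAt ℂ (slitSqrt m P x) z := by
  have hsub : ∀ a : ℝ, DifferentiableAt ℂ (fun z : ℂ => z - a) z := fun a =>
    differentiableAt_id.sub_const _
  refine (differentiableAt_const _).mul (.mul (.fun_finsetProd fun l hl => ?_)
    ((hsub _).cpow (differentiableAt_const _) (sub_mem_slitPlane hray)))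
  have hl := Finset.mem_range.1 hl
  have hlt := h.x_lt (2 * l) (2 * l + 1) (by omega) (by omega)
  have hne : z - x (2 * l + 1) ≠ 0 := fun hzero =>
    hcuts l hl ⟨_, ⟨le_rfl, hlt.le⟩, (sub_eq_zero.1 hzero).symm⟩
  exact (hsub _).mul (((hsub _).div (hsub _) hne).cpow (differentiableAt_const _)
    (sub_div_sub_mem_slitPlane hlt.le (hcuts l hl)))

theorem slitSqrt_ofReal {t : ℝ} (ht : 0 < t) : slitSqrt m P x t = (√(P.eval t) : ℝ) := by
  have hpos : ∀ j < 2 * m + 1, 0 < t - x j := fun j hj => by linarith [h.x_nonpos hj]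
  have heven : ∀ l ∈ Finset.range m, 0 < t - x (2 * l) := fun l hl =>
    hpos _ (by have := Finset.mem_range.1 hl; omega)
  have hodd : ∀ l ∈ Finset.range m, 0 < t - x (2 * l + 1) := fun l hl =>
    hpos _ (by have := Finset.mem_range.1 hl; omega)
  have hreal : slitSqrt m P x t = ((√P.leadingCoeff * ((∏ l ∈ Finset.range m,
      (t - x (2 * l + 1)) * √((t - x (2 * l)) / (t - x (2 * l + 1)))) * √(t - x (2 * m))) : ℝ) :
        ℂ) := by
    rw [slitSqrt, ← Complex.ofReal_sub, ofReal_cpow_half (hpos (2 * m) (by omega)).le,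
      Finset.prod_congr rfl fun l hl => by rw [← Complex.ofReal_sub, ← Complex.ofReal_sub,
        ← Complex.ofReal_div, ofReal_cpow_half (div_pos (heven l hl) (hodd l hl)).le]]
    push_cast
    rfl
  have hsq : P.eval t = (√P.leadingCoeff * ((∏ l ∈ Finset.range m,
      (t - x (2 * l + 1)) * √((t - x (2 * l)) / (t - x (2 * l + 1)))) * √(t - x (2 * m)))) ^ 2 := by
    have heq := h.aeval_eq t
    rw [prod_range_two_mul_add_one_eq_mul_last] at heq
    simp only [coe_aeval_eq_eval, Algebra.algebraMap_self, RingHom.id_apply] at heq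
    rw [heq, mul_pow, mul_pow, Real.sq_sqrt h.leadingCoeff_pos.le,
      Real.sq_sqrt (hpos (2 * m) (by omega)).le, ← Finset.prod_pow]
    congr 2
    refine Finset.prod_congr rfl fun l hl => ?_
    rw [mul_pow, Real.sq_sqrt (div_pos (heven l hl) (hodd l hl)).le]
    have := (hodd l hl).ne'
    field_simp
  rw [hreal, hsq, Real.sqrt_sq]
  exact mul_nonneg (Real.sqrt_nonneg _) (mul_nonneg
    (Finset.prod_nonneg fun l hl => mul_nonneg (hodd l hl).le (Real.sqrt_nonneg _))
    (Real.sqrt_nonneg _))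

end IsSpectralPoly

theorem eqOn_slitPlane {f g : ℂ → ℂ} (hf : DifferentiableOn ℂ f Complex.slitPlane)
    (hg : DifferentiableOn ℂ g Complex.slitPlane) (hfg : ∀ t : ℝ, 0 < t → f t = g t) :
    Set.EqOn f g Complex.slitPlane := by
  refine (hf.analyticOnNhd Complex.isOpen_slitPlane).eqOn_of_preconnected_of_frequently_eq
    (hg.analyticOnNhd Complex.isOpen_slitPlane)
    (Complex.starConvex_one_slitPlane.isPathConnected
      Complex.one_mem_slitPlane).isConnected.isPreconnected Complex.one_mem_slitPlane ?_
  have hcoe : Filter.Tendsto (fun t : ℝ => (t : ℂ)) (𝓝[≠] 1) (𝓝[≠] 1) := by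
    refine tendsto_nhdsWithin_iff.2 ⟨?_, ?_⟩
    · exact (Complex.continuous_ofReal.tendsto' 1 1 Complex.ofReal_one).mono_left
        nhdsWithin_le_nhds
    · filter_upwards [self_mem_nhdsWithin] with t ht using Complex.ofReal_ne_one.2 ht
  refine hcoe.frequently (Filter.Eventually.frequently ?_)
  filter_upwards [nhdsWithin_le_nhds (lt_mem_nhds one_pos)] with t ht using hfg t ht

section

variable {k : ℕ} {α β : Fin k → ℝ} (h : IsSpectralPoly (kPrime α β - 1) (p0 α β) (x α β))
include h

theorem isSqrtContinuation_slitSqrt :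
    IsSqrtContinuation α β (slitSqrt (kPrime α β - 1) (p0 α β) (x α β)) := by
  refine ⟨fun z hz => (h.differentiableAt_slitSqrt (fun hray => hz ?_) fun l hl hcut =>
    hz ?_).differentiableWithinAt, fun t ht => h.slitSqrt_ofReal ht⟩
  · exact Set.image_mono Set.subset_union_left hray
  · exact Set.image_mono (Set.subset_union_of_subset_right
      (Set.subset_biUnion_of_mem (u := fun l => Set.Icc (x α β (2 * l + 1)) (x α β (2 * l)))
        (Finset.mem_range.2 hl)) _) hcut

theorem isSqrtContinuation_sqrtP0 : IsSqrtContinuation α β (sqrtP0 α β) :=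
  Classical.epsilon_spec ⟨_, isSqrtContinuation_slitSqrt h⟩

theorem nonpos_of_mem_cuts {t : ℝ} (ht : t ∈ cuts α β) : t ≤ 0 := by
  rcases ht with hray | hcut
  · exact le_trans hray (h.x_nonpos (by omega))
  · obtain ⟨l, hl, -, hle⟩ := Set.mem_iUnion₂.1 hcut
    have hl := Finset.mem_range.1 hl
    exact hle.trans (h.x_nonpos (by omega))

theorem differentiableOn_sqrtP0 : DifferentiableOn ℂ (sqrtP0 α β) Complex.slitPlane := by
  refine (isSqrtContinuation_sqrtP0 h).1.mono ?_
  rintro _ hz ⟨t, ht, rfl⟩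
  exact (nonpos_of_mem_cuts h ht).not_gt (Complex.ofReal_mem_slitPlane.1 hz)

theorem sqrtP0_sq {z : ℂ} (hz : z ∈ Complex.slitPlane) :
    sqrtP0 α β z ^ 2 = aeval z (p0 α β) := by
  refine eqOn_slitPlane ((differentiableOn_sqrtP0 h).pow 2)
    (p0 α β).differentiable_aeval.differentiableOn (fun t ht => ?_) hz
  rw [Pi.pow_apply, (isSqrtContinuation_sqrtP0 h).2 t ht, aeval_complex_ofReal,
    ← Complex.ofReal_pow, Real.sq_sqrt (h.eval_nonneg ht.le)]

theorem sqrtP0_conj {z : ℂ} (hz : z ∈ Complex.slitPlane) :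
    sqrtP0 α β (conj z) = conj (sqrtP0 α β z) := by
  have hconj : Set.EqOn (fun z => conj (sqrtP0 α β (conj z))) (sqrtP0 α β) Complex.slitPlane := by
    refine eqOn_slitPlane (fun z hz => ?_) (differentiableOn_sqrtP0 h) fun t ht => ?_
    · have hz_conj : conj z ∈ Complex.slitPlane := by
        simpa [Complex.mem_slitPlane_iff] using hz
      have hdiff := ((differentiableOn_sqrtP0 h).differentiableAt
        (Complex.isOpen_slitPlane.mem_nhds hz_conj)).conj_conj
      rw [Complex.conj_conj] at hdiff
      exact hdiff.differentiableWithinAt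
    · simp only [Complex.conj_ofReal, (isSqrtContinuation_sqrtP0 h).2 t ht]
  rw [← hconj hz, Complex.conj_conj]

end

/-! ### The region `ℛ₁₂` -/

theorem exists_continuousAt_sq_eq {X : Type*} [TopologicalSpace X] {f : X → ℂ} {a : X}
    (hf : ContinuousAt f a) {w : ℂ} (hw : w ^ 2 = f a) :
    ∃ g : X → ℂ, ContinuousAt g a ∧ g a = w ∧ ∀ t, g t ^ 2 = f t := by
  have hsq : ∀ u : ℂ, (u ^ (2⁻¹ : ℂ)) ^ 2 = u := fun u => by
    exact_mod_cast Complex.cpow_nat_inv_pow u two_ne_zero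
  by_cases hw0 : w = 0
  · have hfa : f a = 0 := by rw [← hw, hw0, zero_pow two_ne_zero]
    refine ⟨fun t => f t ^ (2⁻¹ : ℂ), ?_, by simp [hfa, hw0], fun t => hsq (f t)⟩
    have hcpow := Complex.continuousAt_cpow_zero_of_re_pos (z := (2⁻¹ : ℂ)) (by norm_num)
    rw [← hfa] at hcpow
    exact hcpow.comp (f := fun t => (f t, (2⁻¹ : ℂ))) (hf.prodMk continuousAt_const)
  · have hfa : f a ≠ 0 := hw ▸ pow_ne_zero 2 hw0
    refine ⟨fun t => w * (f t / f a) ^ (2⁻¹ : ℂ), ?_, by simp [hfa], fun t => ?_⟩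
    · exact continuousAt_const.mul ((hf.div_const (f a)).cpow continuousAt_const (by simp [hfa]))
    · rw [mul_pow, hsq, hw, mul_div_cancel₀ _ hfa]

section

variable {k : ℕ} {α β : Fin k → ℝ}

/-- Complex conjugation on the curve. -/
def curveConj (S : Curve α β) : Curve α β :=
  ⟨(conj S.1.1, conj S.1.2), by
    rw [sub_eq_zero, ← map_pow, curve_sq_eq, aeval_conj]⟩

theorem continuous_curveConj : Continuous (curveConj : Curve α β → Curve α β) :=
  (((Complex.continuous_conj.comp continuous_fst).prodMk
    (Complex.continuous_conj.comp continuous_snd)).comp continuous_subtype_val).subtype_mk _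

theorem logDer_curveConj (n : ℝ[X]) (S : Curve α β) :
    logDer n (curveConj S).1 = conj (logDer n S.1) := logDer_conj n S.1

theorem curveConj_eq_self {S : Curve α β} (hS : S.1 ∉ nonrealCurve (p0 α β)) :
    curveConj S = S := by
  have him : S.1.1.im = 0 ∧ S.1.2.im = 0 := by
    simpa only [nonrealCurve, Set.mem_ofPred_eq, curve_sq_eq S, true_and, not_or, not_not] using hS
  exact Subtype.ext (Prod.ext (Complex.conj_eq_iff_im.2 him.1) (Complex.conj_eq_iff_im.2 him.2))

theorem logDer_neg (n : ℝ[X]) (z w : ℂ) : logDer n (z, -w) = -logDer n (z, w) := by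
  rw [logDer, logDer, mul_neg, div_neg]

theorem mem_nonrealCurve_of_im_ne_zero {S : Curve α β} (hS : S.1.1.im ≠ 0) :
    S.1 ∈ nonrealCurve (p0 α β) := ⟨curve_sq_eq S, Or.inl hS⟩

theorem exists_mem_im_ne_zero (S : Curve α β) {U : Set (Curve α β)} (hU : U ∈ 𝓝 S) :
    ∃ S' ∈ U, S'.1.1.im ≠ 0 := by
  by_cases him : S.1.1.im = 0
  swap
  · exact ⟨S, mem_of_mem_nhds hU, him⟩
  have hline : Continuous fun s : ℝ => S.1.1 + s * Complex.I := by fun_prop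
  obtain ⟨g, hg, hg0, hsq⟩ := exists_continuousAt_sq_eq (w := S.1.2) (a := (0 : ℝ))
    ((p0 α β).continuous_aeval.comp hline).continuousAt (by simp [curve_sq_eq S])
  let path : ℝ → Curve α β := fun s => ⟨(S.1.1 + s * Complex.I, g s), sub_eq_zero.2 (hsq s)⟩
  have hpath0 : path 0 = S := Subtype.ext (Prod.ext (by simp [path]) hg0)
  have hpath : ContinuousAt path 0 :=
    Topology.IsInducing.subtypeVal.continuousAt_iff.2 (hline.continuousAt.prodMk hg)
  have hmem : ∀ᶠ s in 𝓝[≠] (0 : ℝ), path s ∈ U ∧ s ≠ 0 :=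
    ((hpath.eventually_mem (hpath0.symm ▸ hU)).filter_mono nhdsWithin_le_nhds).and
      self_mem_nhdsWithin
  obtain ⟨s, hs, hs0⟩ := hmem.exists
  exact ⟨path s, hs, by simp [path, him, hs0]⟩

theorem exists_im_ne_zero_notMem {K : Set (Curve α β)} (hK : IsCompact K) :
    ∃ S : Curve α β, S.1.1.im ≠ 0 ∧ S ∉ K ∧ curveConj S ∉ K := by
  obtain ⟨M, hM⟩ := (hK.image
    (continuous_fst.comp continuous_subtype_val).norm).bddAbove
  have hpos : 0 < |M| + 1 := by positivity
  have hlt : M < |M| + 1 := (le_abs_self M).trans_lt (lt_add_one _)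
  obtain ⟨w, hw⟩ := IsAlgClosed.exists_pow_nat_eq
    (aeval (((|M| + 1 : ℝ) : ℂ) * Complex.I) (p0 α β)) two_pos
  let S : Curve α β := ⟨(((|M| + 1 : ℝ) : ℂ) * Complex.I, w), sub_eq_zero.2 hw⟩
  have hnorm : ‖S.1.1‖ = |M| + 1 := by
    simp only [S, norm_mul, Complex.norm_real, Real.norm_of_nonneg hpos.le, Complex.norm_I, mul_one]
  refine ⟨S, ?_, fun hS => ?_, fun hS => ?_⟩
  · simpa [S] using hpos.ne'
  · exact (hM (Set.mem_image_of_mem _ hS)).not_gt (hlt.trans_eq hnorm.symm)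
  · exact (hM (Set.mem_image_of_mem _ hS)).not_gt
      (hlt.trans_eq (hnorm.symm.trans (Complex.norm_conj S.1.1).symm))

/-- The upper half of the sheet of `p₀^{1/2}` together with the lower half of the sheet of
`-p₀^{1/2}`, whose closure has interior `ℛ₁₂`. -/
def halfSheets (α β : Fin k → ℝ) : Set (Curve α β) :=
  {S | (0 < S.1.1.im ∧ S.1.2 = sqrtP0 α β S.1.1) ∨ (S.1.1.im < 0 ∧ S.1.2 = -sqrtP0 α β S.1.1)}

theorem R12_eq_interior_closure :
    R12 α β = interior (closure (((↑) : Curve α β → Surface α β) '' halfSheets α β)) := by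
  rw [R12]
  congr 2
  ext P
  exact ⟨fun ⟨S, hS, hmem⟩ => ⟨S, hmem, hS.symm⟩, fun ⟨S, hmem, hS⟩ => ⟨S, hS.symm, hmem⟩⟩

/-- The half of the curve on which `Im (d log ρ / d log z)` has the sign of `ε`: the complement of
the real locus splits into the halves of opposite signs, and one of them is `ℛ₁₂`. -/
def signHalf (n : ℝ[X]) (ε : ℝ) : Set (Curve α β) := {S | 0 < ε * (logDer n S.1).im}

theorem im_ne_zero_of_mem_halfSheets {S : Curve α β} (hS : S ∈ halfSheets α β) : S.1.1.im ≠ 0 :=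
  hS.elim (fun hup => hup.1.ne') fun hdown => hdown.1.ne

variable {κ : ℝ} {n : ℝ[X]} (h : IsHarnackPair (kPrime α β - 1) κ (p0 α β) n (x α β))
include h

theorem logDer_im_ne_zero_iff {S : Curve α β} :
    (logDer n S.1).im ≠ 0 ↔ S.1 ∈ nonrealCurve (p0 α β) := by
  refine ⟨fun him => by_contra fun hS => him ?_, h.logDer_im_ne_zero⟩
  have hconj := logDer_curveConj n S
  rw [curveConj_eq_self hS] at hconj
  exact Complex.conj_eq_iff_im.1 hconj.symm

theorem mem_nonrealCurve_of_mem_signHalf {ε : ℝ} {S : Curve α β} (hS : S ∈ signHalf n ε) :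
    S.1 ∈ nonrealCurve (p0 α β) :=
  (logDer_im_ne_zero_iff h).1 (right_ne_zero_of_mul (ne_of_gt hS))

theorem continuousAt_logDer {S : ℂ × ℂ} (hS : S ∈ nonrealCurve (p0 α β)) :
    ContinuousAt (logDer n) S :=
  (continuousAt_fst.mul (n.continuous_aeval.comp continuous_fst).continuousAt).div
    ((continuousAt_fst.sub continuousAt_const).mul continuousAt_snd)
    (mul_ne_zero (sub_ne_zero.2 (h.fst_ne_one hS)) (h.snd_ne_zero hS))

theorem isOpen_signHalf (ε : ℝ) : IsOpen (signHalf n ε : Set (Curve α β)) := by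
  refine isOpen_iff_mem_nhds.2 fun S hS => ?_
  have hcont : ContinuousAt (fun S : Curve α β => ε * (logDer n S.1).im) S :=
    continuousAt_const.mul (Complex.continuous_im.continuousAt.comp
      ((continuousAt_logDer h (mem_nonrealCurve_of_mem_signHalf h hS)).comp
        continuousAt_subtype_val))
  exact hcont.eventually (lt_mem_nhds hS)

theorem sqrtP0_mem_nonrealCurve {z : ℂ} (hz : z.im ≠ 0) :
    (z, sqrtP0 α β z) ∈ nonrealCurve (p0 α β) :=
  ⟨sqrtP0_sq h.toIsSpectralPoly (Or.inr hz), Or.inl hz⟩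

theorem exists_sign_upper : ∃ ε : ℝ, ε ≠ 0 ∧
    ∀ z : ℂ, 0 < z.im → 0 < ε * (logDer n (z, sqrtP0 α β z)).im := by
  have hne : ∀ z : ℂ, 0 < z.im → (logDer n (z, sqrtP0 α β z)).im ≠ 0 := fun z hz =>
    h.logDer_im_ne_zero (sqrtP0_mem_nonrealCurve h hz.ne')
  have hcont : ContinuousOn (fun z => (logDer n (z, sqrtP0 α β z)).im) {z : ℂ | 0 < z.im} :=
    fun z hz => (Complex.continuous_im.continuousAt.comp
      (ContinuousAt.comp (f := fun z => (z, sqrtP0 α β z))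
        (continuousAt_logDer h (sqrtP0_mem_nonrealCurve h (ne_of_gt hz)))
        (continuousAt_id.prodMk
          ((differentiableOn_sqrtP0 h.toIsSpectralPoly).continuousOn.continuousAt
          (Complex.isOpen_slitPlane.mem_nhds (Or.inr (ne_of_gt hz))))))).continuousWithinAt
  have hI : Complex.I ∈ {z : ℂ | 0 < z.im} := by simp
  refine ⟨(logDer n (Complex.I, sqrtP0 α β Complex.I)).im, hne _ hI, fun z hz => ?_⟩
  by_contra! hle
  obtain ⟨u, hu, hu0⟩ := (convex_halfSpace_im_gt 0).isPreconnected.intermediate_value₂ hz hI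
    (continuousOn_const.mul hcont) continuousOn_const hle (mul_self_pos.2 (hne _ hI)).le
  exact mul_ne_zero (hne _ hI) (hne u hu) hu0

/-- Conjugation exchanges the two half sheets, so the sign found on the upper one is also that on
the lower one. -/
theorem exists_mem_halfSheets_iff : ∃ ε : ℝ, ε ≠ 0 ∧ ∀ S : Curve α β, S.1.1.im ≠ 0 →
    (S ∈ halfSheets α β ↔ S ∈ signHalf n ε) := by
  obtain ⟨ε, hε, hup⟩ := exists_sign_upper h
  have hdown : ∀ z : ℂ, z.im < 0 → 0 < ε * (logDer n (z, -sqrtP0 α β z)).im := fun z hz => by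
    have hconj := hup (conj z) (by simpa using hz)
    rw [sqrtP0_conj h.toIsSpectralPoly (Or.inr hz.ne), logDer_conj n (z, sqrtP0 α β z)] at hconj
    rw [logDer_neg]
    simpa using hconj
  refine ⟨ε, hε, fun S hS => ?_⟩
  obtain ⟨⟨z, w⟩, hzw⟩ := S
  have hw : w = sqrtP0 α β z ∨ w = -sqrtP0 α β z :=
    sq_eq_sq_iff_eq_or_eq_neg.1
      ((sub_eq_zero.1 hzw).trans (sqrtP0_sq h.toIsSpectralPoly (Or.inr hS)).symm)
  simp only [halfSheets, signHalf, Set.mem_ofPred_eq]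
  constructor
  · rintro (⟨hz, rfl⟩ | ⟨hz, rfl⟩)
    exacts [hup z hz, hdown z hz]
  · intro hpos
    rcases hw with rfl | rfl
    · refine Or.inl ⟨lt_of_le_of_ne (not_lt.1 fun hz => ?_) (Ne.symm hS), rfl⟩
      have hdown_z := hdown z hz
      rw [logDer_neg, Complex.neg_im] at hdown_z
      linarith
    · refine Or.inr ⟨lt_of_le_of_ne (not_lt.1 fun hz => ?_) hS, rfl⟩
      rw [logDer_neg, Complex.neg_im] at hpos
      linarith [hup z hz]

theorem mul_logDer_im_nonneg {ε : ℝ}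
    (hsign : ∀ S : Curve α β, S.1.1.im ≠ 0 → (S ∈ halfSheets α β ↔ S ∈ signHalf n ε))
    {S : Curve α β} (hS : (S : Surface α β) ∈ closure ((↑) '' halfSheets α β)) :
    0 ≤ ε * (logDer n S.1).im := by
  by_contra! hneg
  have hmem : S ∈ signHalf n (-ε) := by
    rw [signHalf, Set.mem_ofPred_eq, neg_mul]
    exact neg_pos.2 hneg
  obtain ⟨_, ⟨S', hS', rfl⟩, S'', hS'', heq⟩ := mem_closure_iff.1 hS _
    (OnePoint.isOpenEmbedding_coe.isOpenMap _ (isOpen_signHalf h (-ε))) ⟨S, hmem, rfl⟩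
  obtain rfl := OnePoint.coe_injective heq
  have hpos := (hsign _ (im_ne_zero_of_mem_halfSheets hS'')).1 hS''
  rw [signHalf, Set.mem_ofPred_eq] at hpos hS'
  linarith

theorem coe_curveConj_notMem_closure {ε : ℝ} (hε : ε ≠ 0)
    (hsign : ∀ S : Curve α β, S.1.1.im ≠ 0 → (S ∈ halfSheets α β ↔ S ∈ signHalf n ε))
    {S : Curve α β} (him : S.1.1.im ≠ 0)
    (hS : (S : Surface α β) ∈ closure ((↑) '' halfSheets α β)) :
    (curveConj S : Surface α β) ∉ closure ((↑) '' halfSheets α β) := by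
  intro hconj
  have hle := mul_logDer_im_nonneg h hsign hconj
  rw [logDer_curveConj, Complex.conj_im, mul_neg, neg_nonneg] at hle
  exact mul_ne_zero hε ((logDer_im_ne_zero_iff h).2 (mem_nonrealCurve_of_im_ne_zero him))
    (le_antisymm hle (mul_logDer_im_nonneg h hsign hS))

/-- A neighbourhood of `∞` or of a real point contains two nonreal conjugate points, and these do
not both lie in the closure of `halfSheets`. -/
theorem R12_subset_image_signHalf {ε : ℝ} (hε : ε ≠ 0)
    (hsign : ∀ S : Curve α β, S.1.1.im ≠ 0 → (S ∈ halfSheets α β ↔ S ∈ signHalf n ε)) :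
    R12 α β ⊆ (↑) '' (signHalf n ε : Set (Curve α β)) := by
  intro P hP
  rw [R12_eq_interior_closure] at hP
  obtain ⟨O, hsub, hO, hPO⟩ := mem_interior.1 hP
  induction P using OnePoint.rec with
  | infty =>
    obtain ⟨S, him, hS, hconj⟩ := exists_im_ne_zero_notMem ((OnePoint.isOpen_iff_of_mem hPO).1 hO).2
    exact absurd (hsub (Set.notMem_compl_iff.1 hconj)) (coe_curveConj_notMem_closure h hε hsign him
      (hsub (Set.notMem_compl_iff.1 hS)))
  | coe S =>
    refine ⟨S, lt_of_le_of_ne (mul_logDer_im_nonneg h hsign (hsub hPO))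
      (Ne.symm (mul_ne_zero hε ((logDer_im_ne_zero_iff h).2 (by_contra fun hreal => ?_)))), rfl⟩
    have hO' := hO.preimage (OnePoint.continuous_coe (X := Curve α β))
    have hconj : curveConj ⁻¹' ((↑) ⁻¹' O) ∈ 𝓝 S :=
      (hO'.preimage continuous_curveConj).mem_nhds
        (by rwa [Set.mem_preimage, curveConj_eq_self hreal])
    obtain ⟨S', ⟨hmem, hmem_conj⟩, him⟩ :=
      exists_mem_im_ne_zero S (Filter.inter_mem (hO'.mem_nhds hPO) hconj)
    exact coe_curveConj_notMem_closure h hε hsign him (hsub hmem) (hsub hmem_conj)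

theorem image_signHalf_subset_R12 {ε : ℝ}
    (hsign : ∀ S : Curve α β, S.1.1.im ≠ 0 → (S ∈ halfSheets α β ↔ S ∈ signHalf n ε)) :
    (↑) '' (signHalf n ε : Set (Curve α β)) ⊆ R12 α β := by
  rw [R12_eq_interior_closure]
  refine interior_maximal ?_ (OnePoint.isOpenEmbedding_coe.isOpenMap _ (isOpen_signHalf h ε))
  rintro _ ⟨S, hS, rfl⟩
  refine mem_closure_iff.2 fun O hO hSO => ?_
  obtain ⟨S', ⟨hmem, hmem_half⟩, him⟩ := exists_mem_im_ne_zero S (Filter.inter_mem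
    ((hO.preimage OnePoint.continuous_coe).mem_nhds hSO) ((isOpen_signHalf h ε).mem_nhds hS))
  exact ⟨S', hmem, S', (hsign S' him).2 hmem_half, rfl⟩

theorem exists_R12_eq : ∃ ε : ℝ, ε ≠ 0 ∧ R12 α β = (↑) '' (signHalf n ε : Set (Curve α β)) := by
  obtain ⟨ε, hε, hsign⟩ := exists_mem_halfSheets_iff h
  exact ⟨ε, hε, (R12_subset_image_signHalf h hε hsign).antisymm
    (image_signHalf_subset_R12 h hsign)⟩

omit h in
theorem coe_mem_realLocus_iff (hk : 0 < kPrime α β) (S : Curve α β) :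
    (S : Surface α β) ∈ realLocus α β ↔
      ∃ t : ℝ, S.1.1 = t ∧ (0 ≤ t ∨ InGap (kPrime α β - 1) (x α β) t) := by
  simp only [realLocus, Set.mem_iUnion]
  constructor
  · rintro ⟨l, hl, hS⟩
    have hl := Finset.mem_range.1 hl
    rcases l with _ | l
    · obtain ⟨S', hS', t, ht, hz⟩ := hS.resolve_left (OnePoint.coe_ne_infty S)
      obtain rfl := OnePoint.coe_injective hS'
      exact ⟨t, hz, Or.inl ht⟩
    · obtain ⟨S', hS', t, ht, hz⟩ := hS
      obtain rfl := OnePoint.coe_injective hS'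
      exact ⟨t, hz, Or.inr ⟨l, by omega, ht.1, ht.2⟩⟩
  · rintro ⟨t, hz, ht | ⟨l, hl, hlow, hhigh⟩⟩
    · exact ⟨0, Finset.mem_range.2 hk, Or.inr ⟨S, rfl, t, ht, hz⟩⟩
    · exact ⟨l + 1, Finset.mem_range.2 (by omega), S, rfl, t, ⟨hlow, hhigh⟩, hz⟩

theorem coe_notMem_realLocus_iff (hk : 0 < kPrime α β) (S : Curve α β) :
    (S : Surface α β) ∉ realLocus α β ↔ S.1 ∈ nonrealCurve (p0 α β) := by
  rw [coe_mem_realLocus_iff hk, not_iff_comm]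
  constructor
  · intro hreal
    have hz : (S.1.1.re : ℂ) = S.1.1 :=
      Complex.conj_eq_iff_re.1 (congrArg (·.1.1) (curveConj_eq_self hreal))
    have hw : (S.1.2.re : ℂ) = S.1.2 :=
      Complex.conj_eq_iff_re.1 (congrArg (·.1.2) (curveConj_eq_self hreal))
    have hsq : S.1.2.re ^ 2 = (p0 α β).eval S.1.1.re := by
      exact_mod_cast hw ▸ (curve_sq_eq S).trans
        ((congrArg (aeval · (p0 α β)) hz.symm).trans (aeval_complex_ofReal _ _))
    exact ⟨_, hz.symm, h.eval_nonneg_iff.1 (hsq ▸ sq_nonneg _)⟩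
  · rintro ⟨t, hz, ht⟩ hS
    obtain ⟨t', s, hneg, -, heq⟩ := exists_eq_of_mem_nonrealCurve hS (by rw [hz, Complex.ofReal_im])
    have htt' : t' = t := Complex.ofReal_injective ((congrArg Prod.fst heq).symm.trans hz)
    exact (h.eval_nonneg_iff.2 (htt' ▸ ht)).not_gt hneg

end

/-! ### Smooth dependence of the critical point on the parameters -/

/-- The defect of the system formed by `w² = P(z)` and `CritEq`, as a function of the parameters
and of the point `(z, w)`. -/
def critSystem (κ : ℝ) (P n : ℝ[X]) (u : (ℝ × ℝ) × (ℂ × ℂ)) : ℂ × ℂ :=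
  (u.2.2 ^ 2 - aeval u.2.1 P,
    κ * ((u.1.2 - 1) * u.2.1 - (u.1.2 + 1)) * u.2.2 - 2 * u.1.1 * u.2.1 * aeval u.2.1 n)

theorem critSystem_eq_zero_iff {κ : ℝ} {P n : ℝ[X]} {v : ℝ × ℝ} {S : ℂ × ℂ} :
    critSystem κ P n (v, S) = 0 ↔ S.2 ^ 2 = aeval S.1 P ∧ CritEq κ n v S := by
  simp only [critSystem, Prod.mk_eq_zero, sub_eq_zero, CritEq]

theorem contDiff_critSystem (κ : ℝ) (P n : ℝ[X]) : ContDiff ℝ ∞ (critSystem κ P n) := by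
  have haeval : ∀ p : ℝ[X], ContDiff ℝ ∞ fun u : (ℝ × ℝ) × (ℂ × ℂ) => aeval u.2.1 p := fun p =>
    (p.contDiff_aeval (𝕜 := ℂ) ∞).restrict_scalars ℝ |>.comp (contDiff_fst.comp contDiff_snd)
  have hχ : ContDiff ℝ ∞ fun u : (ℝ × ℝ) × (ℂ × ℂ) => (u.1.1 : ℂ) :=
    Complex.ofRealCLM.contDiff.comp (contDiff_fst.comp contDiff_fst)
  have hη : ContDiff ℝ ∞ fun u : (ℝ × ℝ) × (ℂ × ℂ) => (u.1.2 : ℂ) :=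
    Complex.ofRealCLM.contDiff.comp (contDiff_snd.comp contDiff_fst)
  have hz : ContDiff ℝ ∞ fun u : (ℝ × ℝ) × (ℂ × ℂ) => u.2.1 := by fun_prop
  have hw : ContDiff ℝ ∞ fun u : (ℝ × ℝ) × (ℂ × ℂ) => u.2.2 := by fun_prop
  exact ((hw.pow 2).sub (haeval P)).prodMk
    (((contDiff_const.mul (((hη.sub contDiff_const).mul hz).sub (hη.add contDiff_const))).mul
      hw).sub (((contDiff_const.mul hχ).mul hz).mul (haeval n)))

theorem hasDerivAt_add_ofReal_mul (c d : ℂ) : HasDerivAt (fun t : ℝ => c + t * d) d 0 := by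
  simpa using ((hasDerivAt_id (0 : ℝ)).ofReal_comp.mul_const d).const_add c

theorem hasDerivAt_critSystem_line (κ : ℝ) (P n : ℝ[X]) (v : ℝ × ℝ) (S : ℂ × ℂ) (a b : ℂ) :
    HasDerivAt (fun t : ℝ => critSystem κ P n (v, (S.1 + t * a, S.2 + t * b)))
      (2 * S.2 * b - aeval S.1 (derivative P) * a,
        κ * ((v.2 - 1) * a) * S.2 + κ * ((v.2 - 1) * S.1 - (v.2 + 1)) * b -
          2 * v.1 * (a * aeval S.1 n + S.1 * (aeval S.1 (derivative n) * a))) 0 := by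
  have hline := hasDerivAt_add_ofReal_mul
  have haeval : ∀ p : ℝ[X], HasDerivAt (fun t : ℝ => aeval (S.1 + t * a) p)
      (aeval S.1 (derivative p) * a) 0 := fun p => by
    have hcomp := (p.hasDerivAt_aeval (S.1 + (0 : ℝ) * a)).comp (0 : ℝ) (hline S.1 a)
    simp only [Complex.ofReal_zero, zero_mul, add_zero] at hcomp
    exact hcomp
  refine ((((hline S.2 b).fun_pow 2).sub (haeval P)).prodMk
    ((((((hline S.1 a).const_mul ((v.2 : ℂ) - 1)).sub_const (v.2 + 1 : ℂ)).const_mul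
      (κ : ℂ)).mul (hline S.2 b)).sub
        (((hline S.1 a).const_mul (2 * v.1 : ℂ)).mul (haeval n)))).congr_deriv ?_
  ext
  · simp
  · simp only [Complex.ofReal_zero, zero_mul, add_zero]
    ring

theorem fderiv_critSystem_apply (κ : ℝ) (P n : ℝ[X]) (v : ℝ × ℝ) (S : ℂ × ℂ) (a b : ℂ) :
    fderiv ℝ (critSystem κ P n) (v, S) (0, (a, b)) =
      (2 * S.2 * b - aeval S.1 (derivative P) * a,
        κ * ((v.2 - 1) * a) * S.2 + κ * ((v.2 - 1) * S.1 - (v.2 + 1)) * b -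
          2 * v.1 * (a * aeval S.1 n + S.1 * (aeval S.1 (derivative n) * a))) := by
  have hline : HasDerivAt (fun t : ℝ => (v, (S.1 + t * a, S.2 + t * b))) (0, (a, b)) 0 :=
    (hasDerivAt_const _ _).prodMk
      ((hasDerivAt_add_ofReal_mul S.1 a).prodMk (hasDerivAt_add_ofReal_mul S.2 b))
  have hsystem : HasFDerivAt (critSystem κ P n) (fderiv ℝ (critSystem κ P n) (v, S))
      (v, (S.1 + (0 : ℝ) * a, S.2 + (0 : ℝ) * b)) := by
    simpa only [Complex.ofReal_zero, zero_mul, add_zero] using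
      ((contDiff_critSystem κ P n).differentiable (by simp) (v, S)).hasFDerivAt
  have hcomp := hsystem.comp_hasDerivAt (0 : ℝ) hline
  exact hcomp.unique (hasDerivAt_critSystem_line κ P n v S a b)

theorem isInvertible_fderiv_critSystem {κ : ℝ} {P n : ℝ[X]} {v : ℝ × ℝ} {S : ℂ × ℂ}
    (hw : S.2 ≠ 0) (hJ : critJacobian κ P n v S ≠ 0) :
    (fderiv ℝ (critSystem κ P n) (v, S) ∘L .inr ℝ (ℝ × ℝ) (ℂ × ℂ)).IsInvertible := by
  have hinj : Function.Injective
      (fderiv ℝ (critSystem κ P n) (v, S) ∘L .inr ℝ (ℝ × ℝ) (ℂ × ℂ)).toLinearMap := by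
    refine (injective_iff_map_eq_zero _).2 fun ⟨a, b⟩ hab => ?_
    obtain ⟨hfst, hsnd⟩ :=
      Prod.mk_eq_zero.1 ((fderiv_critSystem_apply κ P n v S a b).symm.trans hab)
    have ha : a = 0 := by
      refine (mul_eq_zero.1 (show critJacobian κ P n v S * a = 0 from ?_)).resolve_left hJ
      rw [critJacobian]
      linear_combination 2 * S.2 * hsnd - κ * ((v.2 - 1) * S.1 - (v.2 + 1)) * hfst
    have hb : b = 0 := by simpa [ha, hw] using hfst
    rw [ha, hb, Prod.mk_zero_zero]
  exact ⟨(LinearEquiv.ofInjectiveEndo _ hinj).toContinuousLinearEquiv, by ext <;> rfl⟩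

theorem IsHarnackPair.exists_contDiffAt_critEq {m : ℕ} {κ : ℝ} {P n : ℝ[X]} {x : ℕ → ℝ}
    (h : IsHarnackPair m κ P n x) {S : ℂ × ℂ} (hS : S ∈ nonrealCurve P) {v : ℝ × ℝ}
    (hv : CritEq κ n v S) :
    ∃ ψ : ℝ × ℝ → ℂ × ℂ, ContDiffAt ℝ ∞ ψ v ∧ ψ v = S ∧
      ∀ᶠ v' in 𝓝 v, (ψ v').2 ^ 2 = aeval (ψ v').1 P ∧ CritEq κ n v' (ψ v') := by
  have hsmooth : ContDiffAt ℝ ∞ (critSystem κ P n) (v, S) := (contDiff_critSystem κ P n).contDiffAt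
  have hinv := isInvertible_fderiv_critSystem (h.snd_ne_zero hS) (h.critJacobian_ne_zero hS hv)
  have hne : (∞ : WithTop ℕ∞) ≠ 0 := by simp
  refine ⟨hsmooth.implicitFunction hne hinv, hsmooth.contDiffAt_implicitFunction hne hinv,
    hsmooth.implicitFunction_apply_self hne hinv, ?_⟩
  filter_upwards [hsmooth.eventually_apply_implicitFunction hne hinv] with v' hv'
  exact critSystem_eq_zero_iff.1 (hv'.trans (critSystem_eq_zero_iff.2 ⟨hS.1, hv⟩))

/-- The points of `ℂ²` at which `critParam` is smooth. -/
def regularSet (n : ℝ[X]) : Set (ℂ × ℂ) :=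
  {S | S.1 - 1 ≠ 0 ∧ S.2 ≠ 0} ∩ {S | (logDer n S).im ≠ 0}

theorem contDiffOn_logDer (n : ℝ[X]) :
    ContDiffOn ℝ ∞ (logDer n) {S | S.1 - 1 ≠ 0 ∧ S.2 ≠ 0} := by
  refine ContDiffOn.restrict_scalars (𝕜' := ℂ) ℝ (ContDiffOn.div ?_ ?_ fun S hS =>
    mul_ne_zero hS.1 hS.2)
  · exact (contDiff_fst.mul ((n.contDiff_aeval ∞).comp contDiff_fst)).contDiffOn
  · exact ((contDiff_fst.sub contDiff_const).mul contDiff_snd).contDiffOn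

theorem isOpen_regularSet (n : ℝ[X]) : IsOpen (regularSet n) :=
  (Complex.continuous_im.comp_continuousOn (contDiffOn_logDer n).continuousOn).isOpen_inter_preimage
    ((isOpen_ne_fun (by fun_prop) (by fun_prop)).inter (isOpen_ne_fun (by fun_prop) (by fun_prop)))
    isOpen_ne

theorem contDiffOn_critParam (κ : ℝ) (n : ℝ[X]) :
    ContDiffOn ℝ ∞ (critParam κ n) (regularSet n) := by
  have hlogDer := (contDiffOn_logDer n).mono (Set.inter_subset_left : regularSet n ⊆ _)
  have hquot : ContDiffOn ℝ ∞ (fun S : ℂ × ℂ => (S.1 + 1) / (S.1 - 1)) (regularSet n) :=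
    ContDiffOn.restrict_scalars (𝕜' := ℂ) ℝ
      ((contDiff_fst.add contDiff_const).contDiffOn.div
        (contDiff_fst.sub contDiff_const).contDiffOn fun S hS => hS.1.1)
  have hlogDer_im := Complex.imCLM.contDiff.comp_contDiffOn hlogDer
  have hquot_im := Complex.imCLM.contDiff.comp_contDiffOn hquot
  exact ((contDiffOn_const.mul hquot_im).div (contDiffOn_const.mul hlogDer_im)
    fun S hS => mul_ne_zero two_ne_zero hS.2).prodMk
      ((Complex.reCLM.contDiff.comp_contDiffOn hquot).sub
        ((hquot_im.div hlogDer_im fun S hS => hS.2).mul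
          (Complex.reCLM.contDiff.comp_contDiffOn hlogDer)))

theorem IsHarnackPair.nonrealCurve_subset_regularSet {m : ℕ} {κ : ℝ} {P n : ℝ[X]} {x : ℕ → ℝ}
    (h : IsHarnackPair m κ P n x) : nonrealCurve P ⊆ regularSet n := fun _ hS =>
  ⟨⟨sub_ne_zero.2 (h.fst_ne_one hS), h.snd_ne_zero hS⟩, h.logDer_im_ne_zero hS⟩

/-! ### The critical point as a function of the parameters -/

section

variable {k : ℕ} {α β : Fin k → ℝ}

/-- The parameters `(χ, η)` for which a given point of the surface is critical (a junk value
outside the nonreal part of the curve). -/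
def surfaceParam (P : Surface α β) : ℝ × ℝ :=
  critParam k (reducedNumer α β) (affineCoord α β P)

/-- The point of `ℛ₁₂` with given parameters: the map `L`. -/
def criticalPoint (α β : Fin k → ℝ) : ℝ × ℝ → Surface α β :=
  Function.invFunOn surfaceParam (R12 α β)

variable (hk : 0 < k) (hα : ∀ m, 0 < α m) (hβ : ∀ m, 0 < β m) (hαβ : ∏ m, α m = ∏ m, β m)
include hk hα hβ hαβ

theorem mem_nonrealCurve_of_coe_mem_R12 {S : Curve α β} (hS : (S : Surface α β) ∈ R12 α β) :
    S.1 ∈ nonrealCurve (p0 α β) := by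
  have h := isHarnackPair_reducedNumer hk hα hβ hαβ
  obtain ⟨ε, -, hR⟩ := exists_R12_eq h
  rw [hR, OnePoint.coe_injective.mem_set_image] at hS
  exact mem_nonrealCurve_of_mem_signHalf h hS

theorem infty_notMem_R12 : OnePoint.infty ∉ R12 α β := by
  obtain ⟨ε, -, hR⟩ := exists_R12_eq (isHarnackPair_reducedNumer hk hα hβ hαβ)
  rw [hR]
  exact OnePoint.infty_notMem_image_coe

theorem exists_coe_of_mem_R12 {P : Surface α β} (hP : P ∈ R12 α β) :
    ∃ S : Curve α β, P = S ∧ S.1 ∈ nonrealCurve (p0 α β) := by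
  obtain ⟨S, rfl⟩ := OnePoint.ne_infty_iff_exists.1
    (ne_of_mem_of_not_mem hP (infty_notMem_R12 hk hα hβ hαβ))
  exact ⟨S, rfl, mem_nonrealCurve_of_coe_mem_R12 hk hα hβ hαβ hP⟩

theorem logDer_im_mul_logDer_im_pos {S S' : Curve α β} (hS : (S : Surface α β) ∈ R12 α β)
    (hS' : (S' : Surface α β) ∈ R12 α β) :
    0 < (logDer (reducedNumer α β) S.1).im * (logDer (reducedNumer α β) S'.1).im := by
  obtain ⟨ε, hε, hR⟩ := exists_R12_eq (isHarnackPair_reducedNumer hk hα hβ hαβ)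
  rw [hR, OnePoint.coe_injective.mem_set_image, signHalf, Set.mem_ofPred_eq] at hS hS'
  have hpos := mul_pos hS hS'
  rw [mul_mul_mul_comm] at hpos
  exact pos_of_mul_pos_right hpos (mul_self_nonneg ε)

theorem coe_mem_R12_or_coe_curveConj_mem_R12 {S : Curve α β} (hS : S.1 ∈ nonrealCurve (p0 α β)) :
    (S : Surface α β) ∈ R12 α β ∨ (curveConj S : Surface α β) ∈ R12 α β := by
  have h := isHarnackPair_reducedNumer hk hα hβ hαβ
  obtain ⟨ε, hε, hR⟩ := exists_R12_eq h
  simp only [hR, OnePoint.coe_injective.mem_set_image, signHalf, Set.mem_ofPred_eq,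
    logDer_curveConj, Complex.conj_im, mul_neg, neg_pos]
  exact (mul_ne_zero hε (h.logDer_im_ne_zero hS)).lt_or_gt.symm

theorem isCriticalPoint_coe_iff {S : Curve α β} (hS : S.1 ∈ nonrealCurve (p0 α β)) {v : ℝ × ℝ} :
    IsCriticalPoint α β v (S : Surface α β) ↔ CritEq k (reducedNumer α β) v S.1 := by
  have h := isHarnackPair_reducedNumer hk hα hβ hαβ
  exact isCriticalPoint_iff hk hα hβ (h.fst_ne_zero hS) (h.fst_ne_one hS) (h.snd_ne_zero hS)

theorem isCriticalPoint_iff_surfaceParam_eq {P : Surface α β} (hP : P ∈ R12 α β) {v : ℝ × ℝ} :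
    IsCriticalPoint α β v P ↔ surfaceParam P = v := by
  obtain ⟨S, rfl, hS⟩ := exists_coe_of_mem_R12 hk hα hβ hαβ hP
  rw [isCriticalPoint_coe_iff hk hα hβ hαβ hS,
    (isHarnackPair_reducedNumer hk hα hβ hαβ).critEq_iff hS, eq_comm]
  rfl

theorem mem_roughRegion_iff {v : ℝ × ℝ} :
    v ∈ roughRegion α β ↔ ∃ P ∈ R12 α β, IsCriticalPoint α β v P := by
  have h := isHarnackPair_reducedNumer hk hα hβ hαβ
  have hkPrime : 0 < kPrime α β := by
    have hdeg := natDegree_p0 hk hα hβ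
    unfold kPrime at hdeg ⊢
    omega
  constructor
  · rintro ⟨-, P, hP, hcrit⟩
    obtain ⟨S, rfl, -⟩ := id hcrit
    have hS := (coe_notMem_realLocus_iff h hkPrime S).1 hP
    rcases coe_mem_R12_or_coe_curveConj_mem_R12 hk hα hβ hαβ hS with hmem | hmem
    · exact ⟨S, hmem, hcrit⟩
    refine ⟨curveConj S, hmem, ?_⟩
    rw [isCriticalPoint_coe_iff hk hα hβ hαβ
      (mem_nonrealCurve_of_coe_mem_R12 hk hα hβ hαβ hmem)]
    exact ((isCriticalPoint_coe_iff hk hα hβ hαβ hS).1 hcrit).conj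
  · rintro ⟨P, hP, hcrit⟩
    obtain ⟨S, rfl, hS⟩ := exists_coe_of_mem_R12 hk hα hβ hαβ hP
    exact ⟨h.critEq_mem hS ((isCriticalPoint_coe_iff hk hα hβ hαβ hS).1 hcrit), S,
      (coe_notMem_realLocus_iff h hkPrime S).2 hS, hcrit⟩

theorem bijOn_surfaceParam : Set.BijOn surfaceParam (R12 α β) (roughRegion α β) := by
  refine ⟨fun P hP => ?_, fun P hP P' hP' heq => ?_, fun v hv => ?_⟩
  · exact (mem_roughRegion_iff hk hα hβ hαβ).2
      ⟨P, hP, (isCriticalPoint_iff_surfaceParam_eq hk hα hβ hαβ hP).2 rfl⟩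
  · have hcrit := (isCriticalPoint_iff_surfaceParam_eq hk hα hβ hαβ hP).2 heq
    have hcrit' := (isCriticalPoint_iff_surfaceParam_eq hk hα hβ hαβ hP').2 rfl
    obtain ⟨S, rfl, hS⟩ := exists_coe_of_mem_R12 hk hα hβ hαβ hP
    obtain ⟨S', rfl, hS'⟩ := exists_coe_of_mem_R12 hk hα hβ hαβ hP'
    rw [isCriticalPoint_coe_iff hk hα hβ hαβ hS] at hcrit
    rw [isCriticalPoint_coe_iff hk hα hβ hαβ hS'] at hcrit'
    exact congrArg _ (Subtype.ext ((isHarnackPair_reducedNumer hk hα hβ hαβ).critEq_unique hS' hS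
      hcrit' hcrit (logDer_im_mul_logDer_im_pos hk hα hβ hαβ hP' hP)))
  · obtain ⟨P, hP, hcrit⟩ := (mem_roughRegion_iff hk hα hβ hαβ).1 hv
    exact ⟨P, hP, (isCriticalPoint_iff_surfaceParam_eq hk hα hβ hαβ hP).1 hcrit⟩

theorem bijOn_criticalPoint : Set.BijOn (criticalPoint α β) (roughRegion α β) (R12 α β) :=
  (bijOn_surfaceParam hk hα hβ hαβ).symm (bijOn_surfaceParam hk hα hβ hαβ).invOn_invFunOn.symm

theorem surfaceParam_criticalPoint {v : ℝ × ℝ} (hv : v ∈ roughRegion α β) :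
    surfaceParam (criticalPoint α β v) = v :=
  (bijOn_surfaceParam hk hα hβ hαβ).invOn_invFunOn.2 hv

theorem isCriticalPoint_iff_eq_criticalPoint {v : ℝ × ℝ} (hv : v ∈ roughRegion α β)
    {P : Surface α β} (hP : P ∈ R12 α β) : IsCriticalPoint α β v P ↔ P = criticalPoint α β v := by
  rw [isCriticalPoint_iff_surfaceParam_eq hk hα hβ hαβ hP]
  refine ⟨fun heq => ?_, fun heq => heq ▸ surfaceParam_criticalPoint hk hα hβ hαβ hv⟩
  rw [← heq]
  exact ((bijOn_surfaceParam hk hα hβ hαβ).invOn_invFunOn.1 hP).symm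

theorem exists_contDiffAt_criticalPoint {v : ℝ × ℝ} (hv : v ∈ roughRegion α β) :
    ∃ ψ : ℝ × ℝ → ℂ × ℂ, ContDiffAt ℝ ∞ ψ v ∧
      ∀ᶠ v' in 𝓝 v, v' ∈ roughRegion α β ∧ affineCoord α β (criticalPoint α β v') = ψ v' := by
  have h := isHarnackPair_reducedNumer hk hα hβ hαβ
  obtain ⟨P, hP, hcrit⟩ := (mem_roughRegion_iff hk hα hβ hαβ).1 hv
  obtain ⟨S, rfl, hS⟩ := exists_coe_of_mem_R12 hk hα hβ hαβ hP
  obtain ⟨ψ, hψ, hψS, hev⟩ :=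
    h.exists_contDiffAt_critEq hS ((isCriticalPoint_coe_iff hk hα hβ hαβ hS).1 hcrit)
  have hopen : IsOpen (((↑) : Curve α β → Surface α β) ⁻¹' R12 α β) :=
    isOpen_interior.preimage OnePoint.continuous_coe
  obtain ⟨U, hU, hUR⟩ := isOpen_induced_iff.1 hopen
  have hSU : S ∈ Subtype.val ⁻¹' U := hUR ▸ hP
  refine ⟨ψ, hψ, ?_⟩
  filter_upwards [hev, hψ.continuousAt.eventually_mem (hU.mem_nhds (hψS ▸ hSU))]
    with v' ⟨hcurve, hcritEq⟩ hmem
  let S' : Curve α β := ⟨ψ v', sub_eq_zero.2 hcurve⟩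
  have hS' : (S' : Surface α β) ∈ R12 α β := hUR.subset hmem
  have hcrit' := (isCriticalPoint_coe_iff hk hα hβ hαβ
    (mem_nonrealCurve_of_coe_mem_R12 hk hα hβ hαβ hS')).2 hcritEq
  have hv' := (mem_roughRegion_iff hk hα hβ hαβ).2 ⟨_, hS', hcrit'⟩
  have heq := (isCriticalPoint_iff_eq_criticalPoint hk hα hβ hαβ hv' hS').1 hcrit'
  exact ⟨hv', congrArg (affineCoord α β) heq.symm⟩

theorem isOpen_roughRegion : IsOpen (roughRegion α β) :=
  isOpen_iff_mem_nhds.2 fun _ hv =>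
    let ⟨_, _, hev⟩ := exists_contDiffAt_criticalPoint hk hα hβ hαβ hv
    hev.mono fun _ hv' => hv'.1

theorem contDiffOn_criticalPoint :
    ContDiffOn ℝ ∞ (fun v => affineCoord α β (criticalPoint α β v)) (roughRegion α β) :=
  fun _ hv =>
    let ⟨_, hψ, hev⟩ := exists_contDiffAt_criticalPoint hk hα hβ hαβ hv
    (hψ.congr_of_eventuallyEq (hev.mono fun _ hv' => hv'.2)).contDiffWithinAt

theorem isDiffeomorphism_criticalPoint :
    IsDiffeomorphism α β (criticalPoint α β) (roughRegion α β) (R12 α β) := by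
  refine ⟨isOpen_roughRegion hk hα hβ hαβ, isOpen_interior, infty_notMem_R12 hk hα hβ hαβ,
    bijOn_criticalPoint hk hα hβ hαβ, contDiffOn_criticalPoint hk hα hβ hαβ, fun P hP =>
    ⟨regularSet (reducedNumer α β), isOpen_regularSet _, ?_, critParam k (reducedNumer α β),
      contDiffOn_critParam _ _, fun v hv _ => surfaceParam_criticalPoint hk hα hβ hαβ hv⟩⟩
  obtain ⟨S, rfl, hS⟩ := exists_coe_of_mem_R12 hk hα hβ hαβ hP
  exact (isHarnackPair_reducedNumer hk hα hβ hαβ).nonrealCurve_subset_regularSet hS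

end

end Aztec

end

theorem mainTheorem8 (k : ℕ) (hk : 0 < k) (α β : Fin k → ℝ)
    (hα : ∀ m, 0 < α m) (hβ : ∀ m, 0 < β m) (hαβ : ∏ m, α m = ∏ m, β m) :
    (∀ v ∈ Aztec.roughRegion α β,
      ∃! P : Aztec.Surface α β, P ∈ Aztec.R12 α β ∧ Aztec.IsCriticalPoint α β v P) ∧
    ∃ L : ℝ × ℝ → Aztec.Surface α β,
      (∀ v ∈ Aztec.roughRegion α β,
        L v ∈ Aztec.R12 α β ∧ Aztec.IsCriticalPoint α β v (L v)) ∧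
      Aztec.IsDiffeomorphism α β L (Aztec.roughRegion α β) (Aztec.R12 α β) := by
  have hiff : ∀ v ∈ Aztec.roughRegion α β, ∀ P ∈ Aztec.R12 α β,
      (Aztec.IsCriticalPoint α β v P ↔ P = Aztec.criticalPoint α β v) := fun v hv P hP =>
    Aztec.isCriticalPoint_iff_eq_criticalPoint hk hα hβ hαβ hv hP
  have hcritical : ∀ v ∈ Aztec.roughRegion α β, Aztec.criticalPoint α β v ∈ Aztec.R12 α β ∧
      Aztec.IsCriticalPoint α β v (Aztec.criticalPoint α β v) := fun v hv =>
    have hmem := (Aztec.bijOn_criticalPoint hk hα hβ hαβ).mapsTo hv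
    ⟨hmem, (hiff v hv _ hmem).2 rfl⟩
  exact ⟨fun v hv => ⟨Aztec.criticalPoint α β v, hcritical v hv, fun P hP =>
      (hiff v hv P hP.1).1 hP.2⟩,
    Aztec.criticalPoint α β, hcritical, Aztec.isDiffeomorphism_criticalPoint hk hα hβ hαβ⟩
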